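/- Let $\Omega\subset\mathbb R^3$ be a domain (open and connected) whose boundary is compact, of class $C^{2,\alpha}$ for some $0<\alpha<1$, and has finitely many connected components. For positive $\kappa,q,\tau,K_1,K_2,K_3$ and $K_4\in\mathbb R$ consider, for $\psi\in H^1(\Omega;\mathbb C)$ and $\mathbf n\in H^1(\Omega;\mathbb S^2)$ (that is, $\mathbf n\in H^1(\Omega;\mathbb R^3)$ with $|\mathbf n|=1$ a.e.), the Landau–de Gennes energy $$\mathcal E(\psi,\mathbf n)=\int_\Omega\Big(|(\nabla-iq\mathbf n)\psi|^2-\kappa^2|\psi|^2+\tfrac{\kappa^2}{2}|\psi|^4\Big)dx+\mathcal F_N^+(\mathbf n)+(K_2+K_4)\int_\Omega\Big(\operatorname{tr}\big((D\mathbf n)^2\big)-|\operatorname{div}\mathbf n|^2\Big)dx,$$ $$\mathcal F_N^+(\mathbf n)=\int_\Omega\Big(K_1|\operatorname{div}\mathbf n|^2+K_2|(\operatorname{curl}\mathbf n)\cdot\mathbf n+\tau|^2+K_3|\operatorname{curl}\mathbf n\times\mathbf n|^2\Big)dx.$$ For $\tau>0$ let $\mathcal C(\tau)$ be the set of minimizers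 of $\mathcal F_N^+$ in $H^1(\Omega;\mathbb S^2)$. Let $M>1$, let $e(\kappa)$ be a positive function of $\kappa>0$ with $e(\kappa)/\kappa^2\to\infty$ as $\kappa\to\infty$, let $c_2>c_1>0$, and let $(\kappa_j,q_j,\tau_j,K_{1,j},K_{2,j},K_{3,j})$ be a sequence of 6-tuples of positive numbers and $(K_{4,j})$ a real sequence such that $\kappa_j\to\infty$, $\tau_j\to\tau$ for some $\tau>0$ (for instance $\tau_j=\tau$ for all $j$), and, for all $j$, $$e(\kappa_j)\le\min(K_{1,j},K_{2,j},K_{3,j})\le\max(K_{1,j},K_{2,j},K_{3,j})\le M\,e(\kappa_j),\qquad c_1\kappa_j^2\le K_{2,j}+K_{4,j}\le c_2\kappa_j^2.$$ For each $j$ let $(\psi_j,\mathbf n_j)$ be a minimizer of $\mathcal E$, with these parameters, over $H^1(\Omega;\mathbb C)\times H^1(\Omega;\mathbb S^2)$ (no boundary condition is imposed). Then there are a subsequence $(\psi_{j_s},\mathbf n_{j_s})$ and a field $\mathbf n_0$ that belongs to $\mathcal C(\tau)$ for every choice of $K_1,K_2,K_3>0$ in $\mathcal F_N^+$, and that is a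 rotated helix, $\mathbf n_0(x)=Q\,N_\tau(Q^{t}x)$ for a.e. $x\in\Omega$ with some $Q\in SO(3)$ and $N_\tau(x)=(\cos(\tau x_3),\sin(\tau x_3),0)$, such that, as $s\to\infty$, $\mathbf n_{j_s}\to\mathbf n_0$ in $H^1_{\rm loc}(\Omega;\mathbb R^3)$, in $L^p(\Omega;\mathbb R^3)$ for all $1\le p<\infty$, in $W^{1,r}(\Omega;\mathbb R^3)$ for all $1\le r<2$, and the boundary traces of $\mathbf n_{j_s}$ converge to that of $\mathbf n_0$ in $L^r(\partial\Omega;\mathbb R^3)$ for all $1\le r<2$. -/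

import Mathlib

open MeasureTheory Filter Topology
open scoped ENNReal NNReal ContDiff

noncomputable section

namespace LandauDeGennes

/-- Three dimensional Euclidean space. -/
abbrev E3 : Type := EuclideanSpace ℝ (Fin 3)

/-- The `j`-th vector of the standard basis of `ℝ³`. -/
def basisVec (j : Fin 3) : E3 := EuclideanSpace.single j 1

/-! ### Domains -/

/-- `γ : ℝ² → ℝ` is of class `C^{2,α}`: it is `C²` and its second derivative is Hölder continuous
with exponent `α`. -/
def IsC2Holder (α : ℝ≥0) (γ : EuclideanSpace ℝ (Fin 2) → ℝ) : Prop :=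
  ContDiff ℝ 2 γ ∧ ∃ C : ℝ≥0, HolderWith C α (iteratedFDeriv ℝ 2 γ)

/-- The boundary of `Ω` is `C^{2,α}`: near each boundary point, in suitable orthonormal
coordinates, `Ω` is the region above the graph of a `C^{2,α}` function of two variables. -/
def HasC2HolderBoundary (α : ℝ≥0) (Ω : Set E3) : Prop :=
  ∀ x ∈ frontier Ω, ∃ (r : ℝ) (e : E3 ≃ₗᵢ[ℝ] E3) (γ : EuclideanSpace ℝ (Fin 2) → ℝ),
    0 < r ∧ IsC2Holder α γ ∧
      ∀ y ∈ Metric.ball x r, y ∈ Ω ↔ γ !₂[e y 0, e y 1] < e y 2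

/-! ### Sobolev functions on an open set of `ℝ³` -/

section Sobolev

variable {F : Type*} [NormedAddCommGroup F] [NormedSpace ℝ F]

/-- `G` is a weak (distributional) gradient of `f` on `Ω`. -/
def HasWeakGrad (Ω : Set E3) (f : E3 → F) (G : E3 → E3 →L[ℝ] F) : Prop :=
  LocallyIntegrableOn f Ω ∧ LocallyIntegrableOn G Ω ∧
    ∀ φ : E3 → ℝ, ContDiff ℝ ∞ φ → HasCompactSupport φ → tsupport φ ⊆ Ω →
      ∀ v : E3, ∫ x in Ω, fderiv ℝ φ x v • f x = - ∫ x in Ω, φ x • G x v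

open Classical in
/-- The weak gradient of `f` on `Ω` (unique up to null sets; `0` if there is none). -/
def weakGrad (Ω : Set E3) (f : E3 → F) : E3 → E3 →L[ℝ] F :=
  if h : ∃ G, HasWeakGrad Ω f G then h.choose else 0

/-- `f ∈ H¹(Ω; F)`: `f` is in `L²(Ω)`, and so is its weak gradient, which exists. -/
def MemH1 (Ω : Set E3) (f : E3 → F) : Prop :=
  MemLp f 2 (volume.restrict Ω) ∧
    ∃ G, HasWeakGrad Ω f G ∧ MemLp G 2 (volume.restrict Ω)

/-- Surface measure on `∂Ω`: the two dimensional Hausdorff measure. (Mathlib's normalization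
differs from the usual one by a constant factor.) -/
def surfaceMeasure (Ω : Set E3) : Measure E3 :=
  (Measure.hausdorffMeasure 2).restrict (frontier Ω)

/-- `g ∈ L²(∂Ω)` is the boundary trace of `f ∈ H¹(Ω)`: there are functions, smooth up to the
boundary, that converge to `f` in `H¹(Ω)` and whose restrictions to `∂Ω` converge to `g` in
`L²(∂Ω)`. -/
def HasTrace (Ω : Set E3) (f g : E3 → F) : Prop :=
  MemH1 Ω f ∧ MemLp g 2 (surfaceMeasure Ω) ∧
    ∃ φ : ℕ → E3 → F, (∀ k, ContDiff ℝ ∞ (φ k)) ∧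
      Tendsto (fun k => eLpNorm (φ k - f) 2 (volume.restrict Ω)) atTop (𝓝 0) ∧
      Tendsto (fun k => eLpNorm (fderiv ℝ (φ k) - weakGrad Ω f) 2 (volume.restrict Ω))
        atTop (𝓝 0) ∧
      Tendsto (fun k => eLpNorm (φ k - g) 2 (surfaceMeasure Ω)) atTop (𝓝 0)

end Sobolev

/-- `n ∈ H¹(Ω; 𝕊²)`. -/
def MemH1Sphere (Ω : Set E3) (n : E3 → E3) : Prop :=
  MemH1 Ω n ∧ ∀ᵐ x ∂(volume.restrict Ω), ‖n x‖ = 1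

/-! ### The energies -/

/-- The Jacobian matrix `(∂_j n_i)_{i j}` of a vector field with derivative `A` at a point. -/
def jacobian (A : E3 →L[ℝ] E3) : Matrix (Fin 3) (Fin 3) ℝ :=
  Matrix.of fun i j => A (basisVec j) i

/-- Divergence, in terms of the derivative. -/
def divOf (A : E3 →L[ℝ] E3) : ℝ := (jacobian A).trace

/-- Curl, in terms of the derivative. -/
def curlOf (A : E3 →L[ℝ] E3) : E3 :=
  !₂[jacobian A 2 1 - jacobian A 1 2, jacobian A 0 2 - jacobian A 2 0,
    jacobian A 1 0 - jacobian A 0 1]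

/-- The cross product on Euclidean space. -/
def cross (a b : E3) : E3 := WithLp.toLp 2 (crossProduct a.ofLp b.ofLp)

/-- The Ginzburg–Landau energy
`∫_Ω |(∇ - i q n) ψ|² - κ² |ψ|² + (κ² / 2) |ψ|⁴`. -/
def energyGL (Ω : Set E3) (κ q : ℝ) (ψ : E3 → ℂ) (n : E3 → E3) : ℝ :=
  ∫ x in Ω, ((∑ j : Fin 3,
      ‖weakGrad Ω ψ x (basisVec j) - Complex.I * (q : ℂ) * (n x j : ℂ) * ψ x‖ ^ 2)
    - κ ^ 2 * ‖ψ x‖ ^ 2 + κ ^ 2 / 2 * ‖ψ x‖ ^ 4)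

/-- The non-negative part of the Oseen–Frank energy
`∫_Ω K₁ |div n|² + K₂ |(curl n) · n + τ|² + K₃ |curl n × n|²`. -/
def energyOFPlus (Ω : Set E3) (τ K₁ K₂ K₃ : ℝ) (n : E3 → E3) : ℝ :=
  ∫ x in Ω, (K₁ * divOf (weakGrad Ω n x) ^ 2
    + K₂ * (inner ℝ (curlOf (weakGrad Ω n x)) (n x) + τ) ^ 2
    + K₃ * ‖cross (curlOf (weakGrad Ω n x)) (n x)‖ ^ 2)

/-- The null Lagrangian `(K₂ + K₄) ∫_Ω tr ((Dn)²) - |div n|²`. -/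
def energyNull (Ω : Set E3) (K₂ K₄ : ℝ) (n : E3 → E3) : ℝ :=
  (K₂ + K₄) * ∫ x in Ω, ((jacobian (weakGrad Ω n x) * jacobian (weakGrad Ω n x)).trace
    - divOf (weakGrad Ω n x) ^ 2)

/-- The parameters of the Landau–de Gennes functional. -/
structure Params where
  κ : ℝ
  q : ℝ
  τ : ℝ
  K₁ : ℝ
  K₂ : ℝ
  K₃ : ℝ
  K₄ : ℝ

/-- The Landau–de Gennes energy. -/
def energyLdG (Ω : Set E3) (P : Params) (ψ : E3 → ℂ) (n : E3 → E3) : ℝ :=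
  energyGL Ω P.κ P.q ψ n + (energyOFPlus Ω P.τ P.K₁ P.K₂ P.K₃ n + energyNull Ω P.K₂ P.K₄ n)

/-- `(ψ, n)` minimizes the Landau–de Gennes energy over `H¹(Ω; ℂ) × H¹(Ω; 𝕊²)`, with no boundary
condition. -/
def IsMinimizerLdG (Ω : Set E3) (P : Params) (ψ : E3 → ℂ) (n : E3 → E3) : Prop :=
  MemH1 Ω ψ ∧ MemH1Sphere Ω n ∧
    ∀ (φ : E3 → ℂ) (u : E3 → E3), MemH1 Ω φ → MemH1Sphere Ω u →
      energyLdG Ω P ψ n ≤ energyLdG Ω P φ u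

/-! ### Limit director fields -/

/-- The set `𝒞(τ)` of minimizers of the non-negative part of the Oseen–Frank energy in
`H¹(Ω; 𝕊²)`. -/
def minimizersOFPlus (Ω : Set E3) (τ K₁ K₂ K₃ : ℝ) : Set (E3 → E3) :=
  {n | MemH1Sphere Ω n ∧
    ∀ u, MemH1Sphere Ω u → energyOFPlus Ω τ K₁ K₂ K₃ n ≤ energyOFPlus Ω τ K₁ K₂ K₃ u}

/-- The helix `N_τ(x) = (cos (τ x₃), sin (τ x₃), 0)`. -/
def helix (τ : ℝ) (x : E3) : E3 := !₂[Real.cos (τ * x 2), Real.sin (τ * x 2), 0]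

/-- The rotated helix `x ↦ Q N_τ(Qᵗ x)`. -/
def rotatedHelix (τ : ℝ) (Q : Matrix (Fin 3) (Fin 3) ℝ) (x : E3) : E3 :=
  Matrix.toEuclideanLin Q (helix τ (Matrix.toEuclideanLin Q.transpose x))

end LandauDeGennes

end

/-! The elastic constants dominate κ², while the null Lagrangian and the Ginzburg–Landau term have
size κ² only; this imbalance forces the limit. The pair consisting of ψ = 0 and the helix with twist
τ_j has energy zero, and the Ginzburg–Landau part of any pair is at least -κ²|Ω|/2, so minimality
leaves an upper bound of order κ² on the elastic part. By the identity |A|² = tr A² + |curl|²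
(`frobSq_eq`, with the Frobenius norm), the null Lagrangian density is |∇n|² - |div n|² - |curl n|².
The two negative terms are absorbed by the Oseen–Frank density (`coercive_density`), up to a
multiple of τ². After division by κ², the gradients are bounded in L², while div n_j and curl n_j +
τ_j n_j tend to zero in L² (`minimizers_asymptotics`).

A weak H¹ limit n₀ is therefore a unit field with div n₀ = 0 and curl n₀ = -τ n₀. Its Oseen–Frank
energy is zero for all elastic constants at once, which puts it in every 𝒞(τ). Local compactness
gives strong L² convergence on compact sets, and an interior estimate of the gradient by divergence,
curl and the field itself, applied to n_j - n₀, gives strong convergence of gradients there.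
Together with global bounds this yields convergence in measure, hence in L^p and in W^{1,r} for r <
2; concentration of the gradient at the boundary is not excluded by the argument. A multiplicative
trace inequality, ‖u‖²_{∂Ω} ≤ C(‖u‖² + ‖u‖‖∇u‖), handles the traces.

It remains to classify unit fields v with div v = 0 and curl v = -τv. The components solve Δv =
-τ²v, and a mean value formula for this equation, obtained from harmonic functions in ℝ⁴, shows that
v is smooth (`exists_smooth_representative`). From |v| = 1 one gets |Dv|² = τ², hence tr (Dv)² = 0,
and linear algebra (`minors_eq_zero`) gives that Dv has rank at most one. Computing |D²v|² = τ⁴ in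
two ways shows that the Hessian is purely normal, ∂ⱼ∂ᵢv = -(∂ᵢv·∂ⱼv) v (`hessian_of_isBeltrami`).
The Gram matrix of the first derivatives is then constant, and what is left is a linear rotation
equation in one fixed direction m, whose solutions are the rotated helices (`eq_rotatedHelix`). -/

noncomputable section

namespace LandauDeGennes

/-! ### Mollification -/

/-- A nonnegative smooth kernel of compact support and unit mass. -/
structure IsMollifier (k : E3 → ℝ) : Prop where
  smooth : ContDiff ℝ ∞ k
  compact : HasCompactSupport k
  nonneg : ∀ x, 0 ≤ k x
  integral_eq : ∫ x, k x = 1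

theorem exists_isMollifier (c : E3) {r : ℝ} (hr : 0 < r) :
    ∃ k, IsMollifier k ∧ tsupport k ⊆ Metric.closedBall c r := by
  let f : ContDiffBump c := ⟨r / 2, r, by positivity, by linarith⟩
  refine ⟨f.normed volume, ⟨f.contDiff_normed, f.hasCompactSupport_normed,
    f.nonneg_normed, f.integral_normed⟩, ?_⟩
  rw [f.tsupport_normed_eq]

theorem IsMollifier.continuous {k : E3 → ℝ} (hk : IsMollifier k) : Continuous k :=
  hk.smooth.continuous

theorem IsMollifier.integrable {k : E3 → ℝ} (hk : IsMollifier k) : Integrable k :=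
  hk.continuous.integrable_of_hasCompactSupport hk.compact

theorem IsMollifier.lintegral_eq {k : E3 → ℝ} (hk : IsMollifier k) :
    ∫⁻ x, ENNReal.ofReal (k x) = 1 := by
  rw [← ofReal_integral_eq_lintegral_ofReal hk.integrable (ae_of_all _ hk.nonneg),
    hk.integral_eq, ENNReal.ofReal_one]

theorem eLpNorm_two_sq {X F : Type*} [MeasurableSpace X] [NormedAddCommGroup F]
    (f : X → F) (μ : Measure X) :
    eLpNorm f 2 μ ^ 2 = ∫⁻ x, ‖f x‖ₑ ^ 2 ∂μ := by
  have := eLpNorm_nnreal_pow_eq_lintegral (f := f) (μ := μ) (p := 2) (by norm_num)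
  simpa using this

/-- Jensen's inequality for the square: Cauchy–Schwarz against the constant 1 for the probability
measure with density `w`. -/
theorem sq_lintegral_le {X : Type*} [MeasurableSpace X] {μ : Measure X} {w g : X → ℝ≥0∞}
    (hw : Measurable w) (hw1 : ∫⁻ x, w x ∂μ = 1) (hg : AEMeasurable g μ) :
    (∫⁻ x, w x * g x ∂μ) ^ 2 ≤ ∫⁻ x, w x * g x ^ 2 ∂μ := by
  let ν := μ.withDensity w
  have hν : ν Set.univ = 1 := by simp [ν, hw1]
  have hg' : AEMeasurable g ν := hg.mono_ac (withDensity_absolutelyContinuous _ _)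
  have h := ENNReal.lintegral_mul_le_Lp_mul_Lq ν
    (show Real.HolderConjugate 2 2 from Real.HolderConjugate.two_two) hg'
    (aemeasurable_const (b := (1 : ℝ≥0∞)))
  simp only [Pi.mul_apply, mul_one, ENNReal.one_rpow, lintegral_const, hν] at h
  have e1 : ∫⁻ x, w x * g x ∂μ = ∫⁻ x, g x ∂ν := by
    rw [lintegral_withDensity_eq_lintegral_mul₀ hw.aemeasurable hg]; rfl
  have e2 : ∫⁻ x, w x * g x ^ 2 ∂μ = ∫⁻ x, g x ^ 2 ∂ν := by
    rw [lintegral_withDensity_eq_lintegral_mul₀ hw.aemeasurable (hg.pow_const 2)]; rfl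
  rw [e1, e2]
  calc (∫⁻ x, g x ∂ν) ^ 2 ≤ ((∫⁻ x, g x ^ (2 : ℝ) ∂ν) ^ (1 / 2 : ℝ)) ^ 2 := by gcongr
    _ = ∫⁻ x, g x ^ 2 ∂ν := by
      rw [← ENNReal.rpow_natCast, ← ENNReal.rpow_mul]
      simp

section Moll

variable {F : Type*} [NormedAddCommGroup F] [NormedSpace ℝ F]

/-- Convolution with a scalar kernel. -/
def moll (k : E3 → ℝ) (f : E3 → F) : E3 → F :=
  convolution k f (ContinuousLinearMap.lsmul ℝ ℝ) volume

theorem moll_apply (k : E3 → ℝ) (f : E3 → F) (x : E3) :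
    moll k f x = ∫ y, k y • f (x - y) := rfl

theorem moll_apply_swap (k : E3 → ℝ) (f : E3 → F) (x : E3) :
    moll k f x = ∫ z, k (x - z) • f z := convolution_lsmul_swap

theorem IsMollifier.integrable_smul {k : E3 → ℝ} (hk : IsMollifier k) {f : E3 → F}
    (hf : LocallyIntegrable f) (x : E3) : Integrable fun y => k y • f (x - y) :=
  (hk.compact.convolutionExists_left (ContinuousLinearMap.lsmul ℝ ℝ) hk.continuous hf x).integrable

theorem IsMollifier.contDiff_moll {k : E3 → ℝ} (hk : IsMollifier k) {f : E3 → F}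
    (hf : LocallyIntegrable f) : ContDiff ℝ ∞ (moll k f) :=
  hk.compact.contDiff_convolution_left _ hk.smooth hf

theorem enorm_moll_sub_le [CompleteSpace F] {k : E3 → ℝ} (hk : IsMollifier k) {f : E3 → F}
    (hf : LocallyIntegrable f) (x : E3) :
    ‖moll k f x - f x‖ₑ ≤ ∫⁻ y, ENNReal.ofReal (k y) * ‖f (x - y) - f x‖ₑ := by
  have h1 : f x = ∫ y, k y • f x := by rw [integral_smul_const, hk.integral_eq, one_smul]
  have h2 : moll k f x - f x = ∫ y, k y • (f (x - y) - f x) := by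
    conv_lhs => rw [h1, moll_apply]
    rw [← integral_sub (hk.integrable_smul hf x) (hk.integrable.smul_const _)]
    simp only [smul_sub]
  rw [h2]
  refine (enorm_integral_le_lintegral_enorm _).trans_eq ?_
  refine lintegral_congr fun y => ?_
  rw [enorm_smul, Real.enorm_eq_ofReal (hk.nonneg y)]

/-- Jensen in the mollification variable, then Tonelli: the mean square error of mollification is
the kernel average of translation errors. Since `D` is arbitrary, this serves both the density of
smooth functions and local compactness. -/
theorem lintegral_moll_sub_sq_le [CompleteSpace F] {k : E3 → ℝ} (hk : IsMollifier k)
    {f : E3 → F} (hf : LocallyIntegrable f) (D : Set E3) :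
    ∫⁻ x in D, ‖moll k f x - f x‖ₑ ^ 2 ≤
      ∫⁻ y, ENNReal.ofReal (k y) * ∫⁻ x in D, ‖f (x - y) - f x‖ₑ ^ 2 := by
  have hfm := hf.aestronglyMeasurable
  have hac : ((volume : Measure E3).restrict D).prod (volume : Measure E3) ≪
      (volume : Measure E3).prod volume :=
    Measure.AbsolutelyContinuous.prod Measure.restrict_le_self.absolutelyContinuous
      Measure.AbsolutelyContinuous.rfl
  have hm1 : AEStronglyMeasurable (fun p : E3 × E3 => f (p.1 - p.2) - f p.1)
      ((volume : Measure E3).prod volume) :=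
    (hfm.comp_quasiMeasurePreserving
      (quasiMeasurePreserving_sub_of_right_invariant volume volume)).sub hfm.comp_fst
  have hkm : Measurable fun y => ENNReal.ofReal (k y) := hk.continuous.measurable.ennreal_ofReal
  have hm2 : AEMeasurable (fun p : E3 × E3 => ENNReal.ofReal (k p.2) *
      ‖f (p.1 - p.2) - f p.1‖ₑ ^ 2) ((volume.restrict D).prod volume) :=
    ((hkm.comp measurable_snd).aemeasurable.mul (hm1.enorm.pow_const 2)).mono_ac hac
  calc ∫⁻ x in D, ‖moll k f x - f x‖ₑ ^ 2
      ≤ ∫⁻ x in D, ∫⁻ y, ENNReal.ofReal (k y) * ‖f (x - y) - f x‖ₑ ^ 2 := by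
        refine lintegral_mono fun x => ?_
        refine (pow_le_pow_left₀ zero_le (enorm_moll_sub_le hk hf x) 2).trans
          (sq_lintegral_le hkm hk.lintegral_eq ?_)
        have : AEStronglyMeasurable (fun y => f (x - y)) volume :=
          hfm.comp_quasiMeasurePreserving
            (quasiMeasurePreserving_sub_left_of_right_invariant volume x)
        exact (this.sub aestronglyMeasurable_const).enorm
    _ = ∫⁻ y, ∫⁻ x in D, ENNReal.ofReal (k y) * ‖f (x - y) - f x‖ₑ ^ 2 :=
        lintegral_lintegral_swap hm2
    _ = _ := by
        refine lintegral_congr fun y => ?_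
        rw [lintegral_const_mul' _ _ ENNReal.ofReal_ne_top]

theorem lintegral_moll_sub_sq_le_of_forall [CompleteSpace F] {k : E3 → ℝ} (hk : IsMollifier k)
    {f : E3 → F} (hf : LocallyIntegrable f) (D : Set E3) {C : ℝ≥0∞}
    (hC : ∀ y ∈ tsupport k, ∫⁻ x in D, ‖f (x - y) - f x‖ₑ ^ 2 ≤ C) :
    ∫⁻ x in D, ‖moll k f x - f x‖ₑ ^ 2 ≤ C := by
  refine (lintegral_moll_sub_sq_le hk hf D).trans ?_
  calc _ ≤ ∫⁻ y, ENNReal.ofReal (k y) * C := by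
        refine lintegral_mono fun y => ?_
        by_cases hy : y ∈ tsupport k
        · dsimp only; gcongr; exact hC y hy
        · simp [image_eq_zero_of_notMem_tsupport hy]
    _ = C := by
        rw [lintegral_mul_const _ hk.continuous.measurable.ennreal_ofReal, hk.lintegral_eq, one_mul]

/-- Strong continuity of the translation action on L². -/
theorem tendsto_eLpNorm_translate_sub {F : Type*} [NormedAddCommGroup F] {f : E3 → F}
    (hf : MemLp f 2) :
    Tendsto (fun y : E3 => eLpNorm (fun x => f (x - y) - f x) 2) (𝓝 0) (𝓝 0) := by
  have : Fact ((2 : ℝ≥0∞) ≠ ⊤) := ⟨by simp⟩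
  have hc : Continuous fun y : E3 => DomAddAct.mk (-y) +ᵥ hf.toLp f :=
    (DomAddAct.continuous_mk.comp continuous_neg).vadd continuous_const
  have h0 := ((hc.sub (continuous_const (y := hf.toLp f))).norm).tendsto 0
  have e0 : ‖(DomAddAct.mk (-0 : E3) +ᵥ hf.toLp f) - hf.toLp f‖ = 0 := by
    rw [neg_zero, DomAddAct.mk_zero, zero_vadd, sub_self, norm_zero]
  simp only [Pi.sub_apply] at h0
  rw [e0] at h0
  have := ENNReal.tendsto_ofReal h0
  rw [ENNReal.ofReal_zero] at this
  refine this.congr fun y => ?_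
  rw [DomAddAct.mk_vadd_toLp, ← MemLp.toLp_sub, Lp.norm_toLp, ENNReal.ofReal_toReal]
  · congr 1
    ext x
    simp [sub_eq_neg_add]
  · exact (MemLp.sub (hf.comp_measurePreserving <| measurePreserving_vadd (-y) volume) hf).2.ne

/-- The radius depends on `f` and `ε` but not on the kernel. This uniformity allows a different,
off-centre kernel in each boundary chart. -/
theorem exists_delta_moll_sub_le [CompleteSpace F] {f : E3 → F} (hf : MemLp f 2) {ε : ℝ≥0∞}
    (hε : 0 < ε) : ∃ δ > 0, ∀ k, IsMollifier k → tsupport k ⊆ Metric.closedBall 0 δ →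
      eLpNorm (moll k f - f) 2 ≤ ε := by
  have h := (tendsto_eLpNorm_translate_sub hf).eventually (ge_mem_nhds hε)
  obtain ⟨δ, hδ, hball⟩ := Metric.nhds_basis_closedBall.eventually_iff.1 h
  refine ⟨δ, hδ, fun k hk hks => ?_⟩
  have hl : LocallyIntegrable f := hf.locallyIntegrable (by norm_num)
  have := lintegral_moll_sub_sq_le_of_forall hk hl Set.univ (C := ε ^ 2) fun y hy => by
    rw [Measure.restrict_univ, ← eLpNorm_two_sq]
    gcongr
    exact hball (hks hy)
  rw [Measure.restrict_univ] at this
  have h2 : eLpNorm (moll k f - f) 2 ^ 2 ≤ ε ^ 2 := by rw [eLpNorm_two_sq]; exact this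
  exact (ENNReal.pow_le_pow_left_iff two_ne_zero).1 h2

end Moll

/-! ### Weak gradients -/

section WeakGrad

variable {F : Type*} [NormedAddCommGroup F] [NormedSpace ℝ F] {Ω : Set E3}

theorem setIntegral_smul_eq_integral {φ : E3 → ℝ} (hφ : tsupport φ ⊆ Ω) (f : E3 → F) :
    ∫ x in Ω, φ x • f x = ∫ x, φ x • f x :=
  setIntegral_eq_integral_of_forall_compl_eq_zero fun x hx => by
    rw [image_eq_zero_of_notMem_tsupport fun h => hx (hφ h), zero_smul]

theorem tsupport_fderiv_apply_subset_of {φ : E3 → ℝ} (v : E3) :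
    tsupport (fun x => fderiv ℝ φ x v) ⊆ tsupport φ :=
  (closure_mono (fun x hx => by
    rw [Function.mem_support] at hx ⊢
    intro h; exact hx (by rw [h]; rfl))).trans (tsupport_fderiv_subset ℝ (f := φ))

theorem clm_apply_eq_sum (A : E3 →L[ℝ] F) (v : E3) : A v = ∑ j, v j • A (basisVec j) := by
  have hv : v = ∑ j, v j • basisVec j := by
    ext i; simp [basisVec, Fin.sum_univ_three]
    fin_cases i <;> simp
  conv_lhs => rw [hv]
  simp

theorem ext_basisVec {A B : E3 →L[ℝ] F} (h : ∀ j, A (basisVec j) = B (basisVec j)) : A = B := by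
  ext v
  rw [clm_apply_eq_sum A, clm_apply_eq_sum B]
  simp [h]

/-- The fundamental lemma of the calculus of variations, for each directional component. It makes
the arbitrary choice in `weakGrad` harmless. -/
theorem HasWeakGrad.ae_unique [CompleteSpace F] (hΩ : IsOpen Ω) {f : E3 → F}
    {G G' : E3 → E3 →L[ℝ] F} (h : HasWeakGrad Ω f G) (h' : HasWeakGrad Ω f G') :
    G =ᵐ[volume.restrict Ω] G' := by
  have key : ∀ j, ∀ᵐ x, x ∈ Ω → G x (basisVec j) - G' x (basisVec j) = 0 := fun j => by
    have l : ∀ {H : E3 → E3 →L[ℝ] F}, LocallyIntegrableOn H Ω →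
        LocallyIntegrableOn (fun x => H x (basisVec j)) Ω := fun hH x hx => by
      obtain ⟨U, hU, hi⟩ := hH x hx
      exact ⟨U, hU, (ContinuousLinearMap.apply ℝ F (basisVec j)).integrable_comp hi⟩
    refine hΩ.ae_eq_zero_of_integral_contDiff_smul_eq_zero ((l h.2.1).sub (l h'.2.1)) ?_
    intro φ hφ hc hs
    have i : ∀ {H : E3 → E3 →L[ℝ] F}, LocallyIntegrableOn H Ω →
        Integrable fun x => φ x • H x (basisVec j) := fun hH => by
      have h1 := (l hH).integrableOn_compact_subset hs hc
      exact (integrableOn_iff_integrable_of_support_subset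
        (fun x hx => subset_tsupport φ fun h => hx (by simp [h]))).1
        (h1.continuousOn_smul hφ.continuous.continuousOn hc)
    simp only [smul_sub]
    rw [integral_sub (i h.2.1) (i h'.2.1), sub_eq_zero, ← setIntegral_smul_eq_integral hs,
      ← setIntegral_smul_eq_integral hs]
    exact neg_injective ((h.2.2 φ hφ hc hs _).symm.trans (h'.2.2 φ hφ hc hs _))
  rw [EventuallyEq, ae_restrict_iff' hΩ.measurableSet]
  filter_upwards [ae_all_iff.2 key] with x hx hxΩ
  exact ext_basisVec fun j => sub_eq_zero.1 (hx j hxΩ)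

theorem hasWeakGrad_weakGrad {f : E3 → F} (h : ∃ G, HasWeakGrad Ω f G) :
    HasWeakGrad Ω f (weakGrad Ω f) := by
  rw [weakGrad, dif_pos h]; exact h.choose_spec

theorem MemH1.hasWeakGrad {f : E3 → F} (h : MemH1 Ω f) : HasWeakGrad Ω f (weakGrad Ω f) :=
  hasWeakGrad_weakGrad (h.2.imp fun _ h => h.1)

theorem HasWeakGrad.weakGrad_ae_eq [CompleteSpace F] (hΩ : IsOpen Ω) {f : E3 → F}
    {G : E3 → E3 →L[ℝ] F} (h : HasWeakGrad Ω f G) : weakGrad Ω f =ᵐ[volume.restrict Ω] G :=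
  HasWeakGrad.ae_unique hΩ (hasWeakGrad_weakGrad ⟨G, h⟩) h

theorem MemH1.memLp_weakGrad [CompleteSpace F] (hΩ : IsOpen Ω) {f : E3 → F} (h : MemH1 Ω f) :
    MemLp (weakGrad Ω f) 2 (volume.restrict Ω) := by
  obtain ⟨G, hG, hGL⟩ := h.2
  exact (memLp_congr_ae (hG.weakGrad_ae_eq hΩ)).2 hGL

theorem hasWeakGrad_fderiv [CompleteSpace F] {f : E3 → F} (hf : ContDiff ℝ 1 f) :
    HasWeakGrad Ω f (fderiv ℝ f) := by
  have hc := hf.continuous_fderiv one_ne_zero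
  refine ⟨hf.continuous.locallyIntegrable.locallyIntegrableOn _,
    hc.locallyIntegrable.locallyIntegrableOn _, fun φ h1 h2 h3 v => ?_⟩
  have h1c : Continuous fun x => fderiv ℝ φ x v :=
    (h1.continuous_fderiv (by simp)).clm_apply continuous_const
  have hs : HasCompactSupport fun x => fderiv ℝ φ x v := h2.fderiv_apply ℝ v
  rw [setIntegral_smul_eq_integral ((tsupport_fderiv_apply_subset_of v).trans h3),
    setIntegral_smul_eq_integral h3, eq_neg_iff_add_eq_zero, add_comm, ← eq_neg_iff_add_eq_zero]
  refine integral_smul_fderiv_eq_neg_fderiv_smul_of_integrable ?_ ?_ ?_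
    (fun x _ => (h1.differentiable (by simp)).differentiableAt)
    (fun x _ => (hf.differentiable one_ne_zero).differentiableAt)
  · exact (h1c.smul hf.continuous).integrable_of_hasCompactSupport hs.smul_right
  · exact (h1.continuous.smul (hc.clm_apply continuous_const)).integrable_of_hasCompactSupport
      h2.smul_right
  · exact (h1.continuous.smul hf.continuous).integrable_of_hasCompactSupport h2.smul_right

theorem HasWeakGrad.sub {f g : E3 → F} {G H : E3 → E3 →L[ℝ] F}
    (hf : HasWeakGrad Ω f G) (hg : HasWeakGrad Ω g H) : HasWeakGrad Ω (f - g) (G - H) := by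
  refine ⟨hf.1.sub hg.1, hf.2.1.sub hg.2.1, fun φ h1 h2 h3 v => ?_⟩
  have h1c : Continuous fun x => fderiv ℝ φ x v :=
    (h1.continuous_fderiv (by simp)).clm_apply continuous_const
  have i : ∀ {E : Type _} [NormedAddCommGroup E] [NormedSpace ℝ E] {u : E3 → E} {χ : E3 → ℝ},
      LocallyIntegrableOn u Ω → Continuous χ → tsupport χ ⊆ tsupport φ →
      IntegrableOn (fun x => χ x • u x) Ω := fun hu hχ hs => by
    have h1 := hu.integrableOn_compact_subset h3 h2
    exact ((integrableOn_iff_integrable_of_support_subset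
      (fun x hx => hs (subset_tsupport _ fun h => hx (by simp [h])))).1
      (h1.continuousOn_smul hχ.continuousOn h2)).integrableOn
  have l : ∀ {H : E3 → E3 →L[ℝ] F}, LocallyIntegrableOn H Ω →
      LocallyIntegrableOn (fun x => H x v) Ω := fun hH x hx => by
    obtain ⟨U, hU, hi⟩ := hH x hx
    exact ⟨U, hU, (ContinuousLinearMap.apply ℝ F v).integrable_comp hi⟩
  have s := tsupport_fderiv_apply_subset_of (φ := φ) v
  simp only [Pi.sub_apply, smul_sub, sub_apply]
  rw [integral_sub (i hf.1 h1c s) (i hg.1 h1c s),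
    integral_sub (i (l hf.2.1) h1.continuous subset_rfl) (i (l hg.2.1) h1.continuous subset_rfl),
    hf.2.2 φ h1 h2 h3, hg.2.2 φ h1 h2 h3]
  abel

theorem MemH1.sub [CompleteSpace F] (hΩ : IsOpen Ω) {f g : E3 → F} (hf : MemH1 Ω f)
    (hg : MemH1 Ω g) : MemH1 Ω (f - g) :=
  ⟨hf.1.sub hg.1, _, hf.hasWeakGrad.sub hg.hasWeakGrad,
    (hf.memLp_weakGrad hΩ).sub (hg.memLp_weakGrad hΩ)⟩

theorem weakGrad_sub_ae_eq [CompleteSpace F] (hΩ : IsOpen Ω) {f g : E3 → F} (hf : MemH1 Ω f)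
    (hg : MemH1 Ω g) :
    weakGrad Ω (f - g) =ᵐ[volume.restrict Ω] weakGrad Ω f - weakGrad Ω g :=
  (hf.hasWeakGrad.sub hg.hasWeakGrad).weakGrad_ae_eq hΩ

theorem memLp_indicator_of_restrict {F : Type*} [NormedAddCommGroup F] (hΩ : IsOpen Ω)
    {f : E3 → F}
    (hf : MemLp f 2 (volume.restrict Ω)) : MemLp (Ω.indicator f) 2 :=
  (memLp_indicator_iff_restrict hΩ.measurableSet).2 hf

theorem locallyIntegrable_indicator {F : Type*} [NormedAddCommGroup F] (hΩ : IsOpen Ω)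
    {f : E3 → F}
    (hf : MemLp f 2 (volume.restrict Ω)) : LocallyIntegrable (Ω.indicator f) :=
  (memLp_indicator_of_restrict hΩ hf).locallyIntegrable (by norm_num)

/-- The reflected translate `k (x - ·)` is an admissible test function exactly when its support lies
in Ω, and then the weak gradient identity moves the derivative from the kernel to `u`. The condition
concerns the single point `x`, so extension by zero does no harm. -/
theorem fderiv_moll_indicator [CompleteSpace F] (hΩ : IsOpen Ω) {k : E3 → ℝ}
    (hk : IsMollifier k)
    {u : E3 → F} {G : E3 → E3 →L[ℝ] F} (h : HasWeakGrad Ω u G)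
    (hu : LocallyIntegrable (Ω.indicator u)) (hG : LocallyIntegrable (Ω.indicator G)) {x : E3}
    (hx : ∀ y ∈ tsupport k, x - y ∈ Ω) :
    fderiv ℝ (moll k (Ω.indicator u)) x = moll k (Ω.indicator G) x := by
  ext v
  have hd := (hk.compact.hasFDerivAt_convolution_left (ContinuousLinearMap.lsmul ℝ ℝ)
    (hk.smooth.of_le (by simp)) hu x).fderiv
  have hi : Integrable (fun t => ((ContinuousLinearMap.lsmul ℝ ℝ).precompL E3 (fderiv ℝ k t))
      (Ω.indicator u (x - t)) : E3 → E3 →L[ℝ] F) :=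
    ((hk.compact.fderiv ℝ).convolutionExists_left _ (hk.smooth.continuous_fderiv (by simp))
      hu x).integrable
  let φ : E3 → ℝ := fun z => k (x - z)
  have hφ1 : ContDiff ℝ ∞ φ := hk.smooth.comp (contDiff_const.sub contDiff_id)
  have hts : tsupport φ = (fun z => x - z) ⁻¹' tsupport k :=
    tsupport_comp_eq_preimage k (Homeomorph.subLeft x)
  have hφ2 : HasCompactSupport φ := hk.compact.comp_homeomorph (Homeomorph.subLeft x)
  have hφ3 : tsupport φ ⊆ Ω := fun z hz => by
    rw [hts] at hz
    simpa using hx _ hz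
  have hφd : ∀ z, fderiv ℝ φ z v = - fderiv ℝ k (x - z) v := fun z => by
    have : HasFDerivAt φ ((fderiv ℝ k (x - z)).comp (-(ContinuousLinearMap.id ℝ E3))) z :=
      ((hk.smooth.differentiable (by simp) (x - z)).hasFDerivAt).comp z
        (by simpa using! (hasFDerivAt_id (𝕜 := ℝ) z).const_sub x)
    rw [this.fderiv]; simp
  have hw := h.2.2 φ hφ1 hφ2 hφ3 v
  have e1 : fderiv ℝ (moll k (Ω.indicator u)) x v = - ∫ z in Ω, fderiv ℝ φ z v • u z := by
    rw [moll, hd, convolution_def, ContinuousLinearMap.integral_apply hi]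
    rw [← integral_sub_left_eq_self _ _ x, ← integral_neg, ← integral_indicator hΩ.measurableSet]
    congr 1 with z
    by_cases hz : z ∈ Ω
    · simp [hz, hφd]
    · simp [hz]
  rw [e1, hw, neg_neg, moll_apply_swap, ContinuousLinearMap.integral_apply,
    ← integral_indicator hΩ.measurableSet]
  · congr 1 with z
    by_cases hz : z ∈ Ω
    · simp [hz, φ]
    · simp [hz]
  · have := (hk.integrable_smul hG x).comp_sub_left x
    simpa using this

end WeakGrad

/-! ### Density of smooth functions -/

section Localization

variable {Ω : Set E3}

/-- The horizontal coordinates of a point in the orthonormal frame `e`. -/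
def horiz (e : E3 ≃ₗᵢ[ℝ] E3) (y : E3) : EuclideanSpace ℝ (Fin 2) := !₂[e y 0, e y 1]

theorem dist_horiz_le (e : E3 ≃ₗᵢ[ℝ] E3) (y z : E3) : dist (horiz e y) (horiz e z) ≤ dist y z := by
  rw [← e.dist_map y z, EuclideanSpace.dist_eq, EuclideanSpace.dist_eq]
  refine Real.sqrt_le_sqrt ?_
  simp only [horiz, Fin.sum_univ_two, Fin.sum_univ_three]
  simp [dist_nonneg]

/-- Of the C^{2,α} regularity of the boundary, density and traces need only a locally Lipschitz
graph. -/
theorem exists_lipschitz_chart {α : ℝ≥0} (h : HasC2HolderBoundary α Ω) {x : E3}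
    (hx : x ∈ frontier Ω) : ∃ (r : ℝ) (e : E3 ≃ₗᵢ[ℝ] E3) (γ : EuclideanSpace ℝ (Fin 2) → ℝ)
      (K : ℝ≥0), 0 < r ∧ Continuous γ ∧ LipschitzOnWith K γ (Metric.ball (horiz e x) r) ∧
      ∀ y ∈ Metric.ball x r, y ∈ Ω ↔ γ (horiz e y) < e y 2 := by
  obtain ⟨r, e, γ, hr, hγ, hy⟩ := h x hx
  obtain ⟨K, t, ht, hl⟩ :=
    ((hγ.1.of_le (by norm_num : (1 : WithTop ℕ∞) ≤ 2)).contDiffAt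
      (x := horiz e x)).exists_lipschitzOnWith
  obtain ⟨s, hs, hst⟩ := Metric.mem_nhds_iff.1 ht
  refine ⟨min r s, e, γ, K, lt_min hr hs, hγ.1.continuous,
    hl.mono ((Metric.ball_subset_ball (min_le_right _ _)).trans hst), fun y hy' => ?_⟩
  exact hy y (Metric.ball_subset_ball (min_le_left _ _) hy')

/-- Above a Lipschitz graph there is a uniform cone of admissible directions. A kernel concentrated
near `-(a • ν)` pushes points upward into that cone, so mollification samples `u` only inside Ω. -/
theorem exists_mollifier_chart {α : ℝ≥0} (h : HasC2HolderBoundary α Ω) {x : E3}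
    (hx : x ∈ frontier Ω) : ∃ ρ > 0, ∀ δ > 0, ∃ k, IsMollifier k ∧
      tsupport k ⊆ Metric.closedBall 0 δ ∧
      ∀ z ∈ Ω ∩ Metric.ball x ρ, ∀ y ∈ tsupport k, z - y ∈ Ω := by
  obtain ⟨r, e, γ, K, hr, -, hl, hΩ⟩ := exists_lipschitz_chart h hx
  refine ⟨r / 2, by positivity, fun δ hδ => ?_⟩
  -- A displacement by `a • ν` with an error of at most `c * a` raises the height by at least `a - c
  -- * a`, while the graph rises by at most `K * c * a`; this choice makes the two equal. Strictness
  -- comes from the initial point lying in Ω.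
  let c : ℝ := (1 + K)⁻¹
  have hc : 0 < c := by positivity
  have hcK : c * (1 + K) = 1 := inv_mul_cancel₀ (by positivity)
  have hc1 : c ≤ 1 := by nlinarith [K.2, mul_nonneg hc.le K.2]
  let a : ℝ := min δ (r / 2) / 2
  have ha : 0 < a := by positivity
  have haδ : 2 * a ≤ δ := by simp only [a]; linarith [min_le_left δ (r / 2)]
  have har : 2 * a ≤ r / 2 := by simp only [a]; linarith [min_le_right δ (r / 2)]
  let ν : E3 := e.symm (basisVec 2)
  have hν : ‖ν‖ = 1 := by simp [ν, basisVec]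
  obtain ⟨k, hk, hks⟩ := exists_isMollifier (-(a • ν)) (mul_pos hc ha)
  have hsmall : ∀ y ∈ tsupport k, ‖y‖ ≤ 2 * a := fun y hy => by
    have h1 := hks hy
    rw [mem_closedBall_iff_norm, sub_neg_eq_add] at h1
    calc ‖y‖ = ‖(y + a • ν) - a • ν‖ := by rw [add_sub_cancel_right]
      _ ≤ c * a + a := (norm_sub_le _ _).trans (by
          gcongr; rw [norm_smul, hν, mul_one, Real.norm_of_nonneg ha.le])
      _ ≤ 2 * a := by nlinarith
  refine ⟨k, hk, fun y hy => by simpa using (hsmall y hy).trans haδ, ?_⟩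
  rintro z ⟨hzΩ, hzx⟩ y hy
  have hzx' : dist z x < r / 2 := hzx
  have hyn := hsmall y hy
  have hw : dist (z - y) x < r := by
    have : dist (z - y) z = ‖y‖ := by rw [dist_eq_norm]; simp
    linarith [dist_triangle (z - y) z x]
  rw [hΩ _ hw]
  have hzΩ' := (hΩ z (by rw [Metric.mem_ball]; linarith)).1 hzΩ
  set y' := y + a • ν with hy'
  have hy'n : ‖y'‖ ≤ c * a := by
    have h1 := hks hy
    rwa [mem_closedBall_iff_norm, sub_neg_eq_add] at h1
  have eq : e (z - y) = e (z - y') + a • basisVec 2 := by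
    rw [show z - y = z - y' + a • ν by rw [hy']; abel, map_add, map_smul]
    simp [ν]
  have eh : horiz e (z - y) = horiz e (z - y') := by
    simp [horiz, eq, basisVec]
  have e2 : e (z - y) 2 = e z 2 - e y' 2 + a := by
    rw [eq]; simp [basisVec]
  have hdist : dist (horiz e (z - y)) (horiz e z) ≤ c * a := by
    rw [eh]
    refine (dist_horiz_le e _ _).trans ?_
    rw [dist_eq_norm]; simpa using hy'n
  have hγ := hl.dist_le_mul (horiz e (z - y)) ((dist_horiz_le e _ _).trans_lt hw)
    (horiz e z) ((dist_horiz_le e _ _).trans_lt (by linarith))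
  have hγ' : γ (horiz e (z - y)) - γ (horiz e z) ≤ K * (c * a) := by
    refine (le_abs_self _).trans ((Real.dist_eq _ _ ▸ hγ).trans ?_)
    gcongr
  have h3 : e y' 2 ≤ c * a :=
    (le_abs_self _).trans ((PiLp.norm_apply_le (e y') 2).trans (by rwa [e.norm_map]))
  rw [e2]
  nlinarith

/-- Off the frontier, Ω and the complement of its closure are disjoint open sets covering the ball,
and the ball is connected. -/
theorem ball_subset_of_disjoint_frontier {X : Type*} [NormedAddCommGroup X] [NormedSpace ℝ X]
    {Ω : Set X} (hΩ : IsOpen Ω) {x : X} (hx : x ∈ Ω) {r : ℝ}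
    (h : Disjoint (Metric.ball x r) (frontier Ω)) : Metric.ball x r ⊆ Ω := by
  rcases le_or_gt r 0 with hr | hr
  · simp [Metric.ball_eq_empty.2 hr]
  refine (convex_ball x r).isPreconnected.subset_left_of_subset_union (v := (closure Ω)ᶜ) hΩ
    isClosed_closure.isOpen_compl (disjoint_compl_right.mono_left subset_closure) ?_
    ⟨x, Metric.mem_ball_self hr, hx⟩
  intro y hy
  by_cases hyc : y ∈ closure Ω
  · left
    by_contra hn
    exact (Set.disjoint_left.1 h hy) ⟨hyc, by rwa [hΩ.interior_eq]⟩
  · exact Or.inr hyc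

/-- A finite smooth partition of unity on `Ω`, each member of which comes with arbitrarily
concentrated kernels whose translates by points of its support stay in `Ω`. -/
structure Localization (Ω : Set E3) (ι : Type) [Fintype ι] where
  χ : ι → E3 → ℝ
  smooth : ∀ i, ContDiff ℝ ∞ (χ i)
  C : ℝ≥0
  bound : ∀ i x, ‖χ i x‖ ≤ C
  bound_fderiv : ∀ i x, ‖fderiv ℝ (χ i) x‖ ≤ C
  sum_eq : ∀ x, ∑ i, χ i x = 1
  exists_mollifier : ∀ i, ∀ δ > 0, ∃ k, IsMollifier k ∧ tsupport k ⊆ Metric.closedBall 0 δ ∧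
    ∀ z ∈ Ω ∩ tsupport (χ i), ∀ y ∈ tsupport k, z - y ∈ Ω

/-- Finitely many boundary charts cover a closed neighbourhood of the compact frontier. The
remaining member of the partition is supported at distance at least `δ` from the frontier, so there
any small centred kernel works. Its support need not be compact, so its bounds are derived from
those of the others. -/
theorem exists_localization (hΩ : IsOpen Ω) (hc : IsCompact (frontier Ω)) {α : ℝ≥0}
    (h : HasC2HolderBoundary α Ω) :
    ∃ (ι : Type) (_ : Fintype ι), Nonempty (Localization Ω ι) := by
  choose! ρ hρ hk using fun x (hx : x ∈ frontier Ω) => exists_mollifier_chart h hx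
  obtain ⟨t, htf, ht⟩ := hc.elim_nhds_subcover (fun x => Metric.ball x (ρ x))
    fun x hx => Metric.ball_mem_nhds x (hρ x hx)
  have hUo : IsOpen (⋃ x ∈ t, Metric.ball x (ρ x)) :=
    isOpen_biUnion fun _ _ => Metric.isOpen_ball
  obtain ⟨δ, hδ, hthick⟩ := hc.exists_cthickening_subset_open hUo ht
  obtain ⟨f, hf⟩ := SmoothPartitionOfUnity.exists_isSubordinate (ι := Fin t.card)
    (modelWithCornersSelf ℝ E3) (s := Metric.cthickening δ (frontier Ω)) Metric.isClosed_cthickening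
    (fun i => Metric.ball (t.equivFin.symm i : E3) (ρ (t.equivFin.symm i)))
    (fun _ => Metric.isOpen_ball) (fun x hx => by
      obtain ⟨y, hy, hxy⟩ := Set.mem_iUnion₂.1 (hthick hx)
      exact Set.mem_iUnion.2 ⟨t.equivFin ⟨y, hy⟩, by simpa using hxy⟩)
  have hfs : ∀ i, ContDiff ℝ ∞ (f i) := fun i => (f i).contMDiff.contDiff
  have hfc : ∀ i, HasCompactSupport (f i) := fun i =>
    HasCompactSupport.of_support_subset_isCompact
      (isCompact_closedBall (t.equivFin.symm i : E3) (ρ (t.equivFin.symm i)))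
      ((subset_tsupport _).trans ((hf i).trans Metric.ball_subset_closedBall))
  let χ : Option (Fin t.card) → E3 → ℝ := fun o => o.elim (fun x => 1 - ∑ i, f i x) fun i => f i
  have hχs : ∀ o, ContDiff ℝ ∞ (χ o) := by
    rintro (_ | i)
    · exact contDiff_const.sub (ContDiff.sum fun i _ => hfs i)
    · exact hfs i
  have hb : ∀ o, ∃ C : ℝ, ∀ x, ‖χ o x‖ ≤ C ∧ ‖fderiv ℝ (χ o) x‖ ≤ C := by
    choose A hA using fun i => (hfc i).exists_bound_of_continuous (hfs i).continuous
    choose B hB using fun i => ((hfc i).fderiv ℝ).exists_bound_of_continuous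
      ((hfs i).continuous_fderiv (by simp))
    rintro (_ | i)
    · refine ⟨max (1 + ∑ i, A i) (∑ i, B i), fun x => ⟨?_, ?_⟩⟩
      · refine le_trans ?_ (le_max_left _ _)
        refine (norm_sub_le _ _).trans ?_
        rw [norm_one]
        gcongr
        exact norm_sum_le_of_le _ fun i _ => hA i x
      · refine le_trans ?_ (le_max_right _ _)
        have : fderiv ℝ (χ none) x = - ∑ i, fderiv ℝ (f i) x := by
          simp only [χ, Option.elim_none]
          rw [fderiv_const_sub, fderiv_fun_sum
            fun i _ => ((hfs i).differentiable (by simp)).differentiableAt]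
        rw [this, norm_neg]
        exact norm_sum_le_of_le _ fun i _ => hB i x
    · exact ⟨max (A i) (B i), fun x => ⟨(hA i x).trans (le_max_left _ _),
        (hB i x).trans (le_max_right _ _)⟩⟩
  choose C hC using hb
  have hC0 : ∀ o, 0 ≤ C o := fun o => (norm_nonneg _).trans (hC o 0).1
  have hCs : ∀ o, C o ≤ ∑ o, C o := fun o =>
    Finset.single_le_sum (fun o _ => hC0 o) (Finset.mem_univ o)
  refine ⟨Option (Fin t.card), inferInstance, ⟨⟨χ, hχs,
    ⟨∑ o, C o, Finset.sum_nonneg fun o _ => hC0 o⟩, fun o x => (hC o x).1.trans (hCs o),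
    fun o x => (hC o x).2.trans (hCs o), fun x => ?_, ?_⟩⟩⟩
  · rw [Fintype.sum_option]; simp [χ]
  · rintro (_ | i) ε hε
    · obtain ⟨k, hk, hks⟩ := exists_isMollifier 0 (lt_min hε (half_pos hδ))
      refine ⟨k, hk, hks.trans (Metric.closedBall_subset_closedBall (min_le_left _ _)), ?_⟩
      rintro z ⟨hzΩ, hz⟩ y hy
      have hz' : z ∉ Metric.thickening δ (frontier Ω) := fun hzt => by
        have hsub : Function.support (χ none) ⊆ (Metric.thickening δ (frontier Ω))ᶜ := by
          intro w hw hwt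
          have := f.sum_eq_one (Metric.thickening_subset_cthickening _ _ hwt)
          rw [finsum_eq_sum_of_fintype] at this
          exact hw (by simp [χ, this])
        exact closure_minimal hsub Metric.isOpen_thickening.isClosed_compl hz hzt
      refine ball_subset_of_disjoint_frontier hΩ hzΩ (r := δ) ?_ ?_
      · rw [Set.disjoint_left]
        intro w hw hwf
        exact hz' (Metric.mem_thickening_iff.2 ⟨w, hwf, by rwa [dist_comm]⟩)
      · have := hks hy
        rw [mem_closedBall_zero_iff] at this
        rw [mem_ball_iff_norm, sub_sub_cancel_left, norm_neg]
        linarith [min_le_right ε (δ / 2)]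
    · obtain ⟨k, hk1, hk2, hk3⟩ := hk _ (htf _ (t.equivFin.symm i).2) ε hε
      exact ⟨k, hk1, hk2, fun z hz => hk3 z ⟨hz.1, hf i hz.2⟩⟩

end Localization

section Density

variable {Ω : Set E3} {F : Type*} [NormedAddCommGroup F] [NormedSpace ℝ F]

theorem eLpNorm_finset_sum_le_card_mul {X ι F : Type*} [MeasurableSpace X]
    [NormedAddCommGroup F] {μ : Measure X}
    (s : Finset ι) {g : ι → X → F} {f : X → F} (hf : f =ᵐ[μ] fun x => ∑ i ∈ s, g i x)
    (hg : ∀ i ∈ s, AEStronglyMeasurable (g i) μ) {C : ℝ≥0∞} (hC : ∀ i ∈ s, eLpNorm (g i) 2 μ ≤ C) :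
    eLpNorm f 2 μ ≤ s.card * C := by
  rw [eLpNorm_congr_ae hf]
  have : (fun x => ∑ i ∈ s, g i x) = ∑ i ∈ s, g i := by ext; simp
  rw [this]
  refine (eLpNorm_sum_le hg (by norm_num)).trans ?_
  rw [← nsmul_eq_mul]
  exact Finset.sum_le_card_nsmul _ _ _ hC

/-- The approximant is ∑ χᵢ (kᵢ ∗ u). Its gradient error splits into ∑ χᵢ (kᵢ ∗ G - G) and ∑ ∇χᵢ ⊗
(kᵢ ∗ u - u), the second by ∑ ∇χᵢ = 0. Both are small in L² since the cutoffs and their derivatives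
are bounded. -/
theorem exists_smooth_near [CompleteSpace F] (hΩ : IsOpen Ω) {ι : Type} [Fintype ι]
    (L : Localization Ω ι) {u : E3 → F} (hu : MemH1 Ω u) {ε : ℝ≥0∞} (hε : 0 < ε) :
    ∃ φ : E3 → F, ContDiff ℝ ∞ φ ∧
      eLpNorm (φ - u) 2 (volume.restrict Ω) ≤ Fintype.card ι * (L.C * ε) ∧
      eLpNorm (fderiv ℝ φ - weakGrad Ω u) 2 (volume.restrict Ω)
        ≤ Fintype.card ι * (L.C * ε + L.C * ε) := by
  set G := weakGrad Ω u with hGdef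
  have hG := hu.hasWeakGrad
  have hGL := hu.memLp_weakGrad hΩ
  have hu2 := memLp_indicator_of_restrict hΩ hu.1
  have hG2 := memLp_indicator_of_restrict hΩ hGL
  have hul := locallyIntegrable_indicator hΩ hu.1
  have hGl := locallyIntegrable_indicator hΩ hGL
  obtain ⟨δ₁, hδ₁, h1⟩ := exists_delta_moll_sub_le hu2 hε
  obtain ⟨δ₂, hδ₂, h2⟩ := exists_delta_moll_sub_le hG2 hε
  choose k hk hks hkΩ using fun i => L.exists_mollifier i (min δ₁ δ₂) (lt_min hδ₁ hδ₂)
  have b1 := fun i => h1 (k i) (hk i)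
    ((hks i).trans (Metric.closedBall_subset_closedBall (min_le_left _ _)))
  have b2 := fun i => h2 (k i) (hk i)
    ((hks i).trans (Metric.closedBall_subset_closedBall (min_le_right _ _)))
  set U := fun i => moll (k i) (Ω.indicator u)
  set V := fun i => moll (k i) (Ω.indicator G)
  have hU : ∀ i, ContDiff ℝ ∞ (U i) := fun i => (hk i).contDiff_moll hul
  have hV : ∀ i, ContDiff ℝ ∞ (V i) := fun i => (hk i).contDiff_moll hGl
  have hUr : ∀ i, eLpNorm (U i - Ω.indicator u) 2 (volume.restrict Ω) ≤ ε := fun i =>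
    (eLpNorm_mono_measure _ Measure.restrict_le_self).trans (b1 i)
  have hVr : ∀ i, eLpNorm (V i - Ω.indicator G) 2 (volume.restrict Ω) ≤ ε := fun i =>
    (eLpNorm_mono_measure _ Measure.restrict_le_self).trans (b2 i)
  have hχ := L.smooth
  have hsm : ∀ i, AEStronglyMeasurable (U i - Ω.indicator u) (volume.restrict Ω) := fun i =>
    ((hU i).continuous.aestronglyMeasurable.sub hu2.1).restrict
  have hsm' : ∀ i, AEStronglyMeasurable (V i - Ω.indicator G) (volume.restrict Ω) := fun i =>
    ((hV i).continuous.aestronglyMeasurable.sub hG2.1).restrict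
  have a1 : ∀ i, AEStronglyMeasurable (fun x => L.χ i x • (U i - Ω.indicator u) x)
      (volume.restrict Ω) := fun i =>
    (hχ i).continuous.aestronglyMeasurable.smul (hsm i)
  have a2 : ∀ i, AEStronglyMeasurable (fun x => L.χ i x • (V i - Ω.indicator G) x)
      (volume.restrict Ω) := fun i =>
    (hχ i).continuous.aestronglyMeasurable.smul (hsm' i)
  have a3 : ∀ i, AEStronglyMeasurable
      (fun x => (fderiv ℝ (L.χ i) x).smulRight ((U i - Ω.indicator u) x))
      (volume.restrict Ω) := fun i =>
    (ContinuousLinearMap.smulRightL ℝ E3 F).aestronglyMeasurable_comp₂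
      ((hχ i).continuous_fderiv (by simp)).aestronglyMeasurable (hsm i)
  have c1 : ∀ i, eLpNorm (fun x => L.χ i x • (U i - Ω.indicator u) x) 2 (volume.restrict Ω)
      ≤ L.C * ε := fun i => by
    refine (eLpNorm_le_nnreal_smul_eLpNorm_of_ae_le_mul (c := L.C)
      (ae_of_all _ fun x => ?_) 2).trans
      ((ENNReal.smul_def _ _).le.trans (by rw [smul_eq_mul]; gcongr; exact hUr i))
    rw [nnnorm_smul]
    gcongr
    exact L.bound i x
  have c2 : ∀ i, eLpNorm (fun x => L.χ i x • (V i - Ω.indicator G) x) 2 (volume.restrict Ω)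
      ≤ L.C * ε := fun i => by
    refine (eLpNorm_le_nnreal_smul_eLpNorm_of_ae_le_mul (c := L.C)
      (ae_of_all _ fun x => ?_) 2).trans
      ((ENNReal.smul_def _ _).le.trans (by rw [smul_eq_mul]; gcongr; exact hVr i))
    rw [nnnorm_smul]
    gcongr
    exact L.bound i x
  have c3 : ∀ i, eLpNorm (fun x => (fderiv ℝ (L.χ i) x).smulRight ((U i - Ω.indicator u) x)) 2
      (volume.restrict Ω) ≤ L.C * ε := fun i => by
    refine (eLpNorm_le_nnreal_smul_eLpNorm_of_ae_le_mul (c := L.C) (g := U i - Ω.indicator u)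
      (ae_of_all _ fun x => ?_) 2).trans
      ((ENNReal.smul_def _ _).le.trans (by rw [smul_eq_mul]; gcongr; exact hUr i))
    rw [← NNReal.coe_le_coe, coe_nnnorm, ContinuousLinearMap.norm_smulRight_apply]
    push_cast
    gcongr
    exact L.bound_fderiv i x
  refine ⟨fun x => ∑ i, L.χ i x • U i x, ContDiff.sum fun i _ => (hχ i).smul (hU i), ?_, ?_⟩
  · refine eLpNorm_finset_sum_le_card_mul Finset.univ (ae_restrict_of_forall_mem
      hΩ.measurableSet fun x hx => ?_) (fun i _ => a1 i) fun i _ => c1 i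
    simp only [Pi.sub_apply, smul_sub, Finset.sum_sub_distrib, Set.indicator_of_mem hx]
    rw [← Finset.sum_smul, L.sum_eq, one_smul]
  · refine eLpNorm_finset_sum_le_card_mul Finset.univ
      (g := fun i x => L.χ i x • (V i - Ω.indicator G) x +
        (fderiv ℝ (L.χ i) x).smulRight ((U i - Ω.indicator u) x)) (ae_restrict_of_forall_mem
      hΩ.measurableSet fun x hx => ?_) (fun i _ => (a2 i).add (a3 i)) fun i _ =>
        (eLpNorm_add_le (a2 i) (a3 i) (by norm_num)).trans (add_le_add (c2 i) (c3 i))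
    have hd : ∀ i, DifferentiableAt ℝ (L.χ i) x := fun i => (hχ i).differentiable (by simp) x
    have hdU : ∀ i, DifferentiableAt ℝ (U i) x := fun i => (hU i).differentiable (by simp) x
    have hsum : ∑ i, fderiv ℝ (L.χ i) x = 0 := by
      rw [← fderiv_fun_sum fun i _ => hd i]
      simp only [L.sum_eq]
      simp
    have hfd : fderiv ℝ (fun x => ∑ i, L.χ i x • U i x) x =
        ∑ i, (L.χ i x • fderiv ℝ (U i) x + (fderiv ℝ (L.χ i) x).smulRight (U i x)) := by
      rw [fderiv_fun_sum fun i _ => (hd i).fun_smul (hdU i)]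
      exact Finset.sum_congr rfl fun i _ => fderiv_fun_smul (hd i) (hdU i)
    -- On the support of `χ i` the kernel stays in Ω and the derivative is the mollified weak
    -- gradient; off it both sides vanish.
    have hterm : ∀ i, L.χ i x • fderiv ℝ (U i) x = L.χ i x • V i x := fun i => by
      by_cases hxi : x ∈ tsupport (L.χ i)
      · rw [fderiv_moll_indicator hΩ (hk i) hG hul hGl fun y hy => hkΩ i x ⟨hx, hxi⟩ y hy]
      · rw [image_eq_zero_of_notMem_tsupport hxi, zero_smul, zero_smul]
    rw [Pi.sub_apply, hfd]
    simp only [hterm, Pi.sub_apply, smul_sub, Set.indicator_of_mem hx]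
    have e1 : ∑ i, L.χ i x • G x = G x := by rw [← Finset.sum_smul, L.sum_eq, one_smul]
    have e2 : ∑ i, (fderiv ℝ (L.χ i) x).smulRight (u x) = 0 := by
      ext v
      have := DFunLike.congr_fun hsum v
      simp only [sum_apply, ContinuousLinearMap.smulRight_apply] at this ⊢
      rw [← Finset.sum_smul, this]; simp
    have e3 : ∀ i, (fderiv ℝ (L.χ i) x).smulRight (U i x - u x) =
        (fderiv ℝ (L.χ i) x).smulRight (U i x) - (fderiv ℝ (L.χ i) x).smulRight (u x) := fun i => by
      ext v; simp [smul_sub]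
    simp only [e3, Finset.sum_add_distrib, Finset.sum_sub_distrib, e1, e2]
    abel

/-- Functions smooth up to the boundary are dense in `H¹(Ω)`. -/
theorem MemH1.exists_smooth_tendsto [CompleteSpace F] (hΩ : IsOpen Ω)
    (hc : IsCompact (frontier Ω)) {α : ℝ≥0} (h : HasC2HolderBoundary α Ω) {u : E3 → F}
    (hu : MemH1 Ω u) : ∃ φ : ℕ → E3 → F, (∀ k, ContDiff ℝ ∞ (φ k)) ∧
      Tendsto (fun k => eLpNorm (φ k - u) 2 (volume.restrict Ω)) atTop (𝓝 0) ∧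
      Tendsto (fun k => eLpNorm (fderiv ℝ (φ k) - weakGrad Ω u) 2 (volume.restrict Ω))
        atTop (𝓝 0) := by
  obtain ⟨ι, _, ⟨L⟩⟩ := exists_localization hΩ hc h
  choose φ h1 h2 h3 using fun k : ℕ =>
    exists_smooth_near hΩ L hu (ε := ((k : ℝ≥0∞) + 1)⁻¹) (by simp)
  have h0 : Tendsto (fun k : ℕ => ((k : ℝ≥0∞) + 1)⁻¹) atTop (𝓝 0) := by
    have := (tendsto_add_atTop_iff_nat 1).2 ENNReal.tendsto_inv_nat_nhds_zero
    simpa using this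
  have l1 : Tendsto (fun k : ℕ => (L.C : ℝ≥0∞) * ((k : ℝ≥0∞) + 1)⁻¹) atTop (𝓝 0) := by
    simpa using ENNReal.Tendsto.const_mul h0 (Or.inr (ENNReal.coe_ne_top (r := L.C)))
  have nt : ((Fintype.card ι : ℕ) : ℝ≥0∞) ≠ ⊤ := ENNReal.natCast_ne_top _
  refine ⟨φ, h1, tendsto_of_tendsto_of_tendsto_of_le_of_le tendsto_const_nhds ?_
    (fun _ => zero_le) h2, tendsto_of_tendsto_of_tendsto_of_le_of_le tendsto_const_nhds ?_
    (fun _ => zero_le) h3⟩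
  · simpa using ENNReal.Tendsto.const_mul l1 (Or.inr nt)
  · simpa using ENNReal.Tendsto.const_mul (l1.add l1) (Or.inr nt)

end Density

/-! ### The trace inequality -/

section Trace

variable {Ω : Set E3}

/-- The map `(s, t) ↦ (s, γ s + t)` written in the orthonormal frame `e`. -/
def graphShift (e : E3 ≃ₗᵢ[ℝ] E3) (γ : EuclideanSpace ℝ (Fin 2) → ℝ) (p : (Fin 2 → ℝ) × ℝ) : E3 :=
  e.symm !₂[p.1 0, p.1 1, γ (WithLp.toLp 2 p.1) + p.2]

/-- A shear has unit Jacobian: it is a skew product of the identity with vertical translations,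
followed by a reordering of coordinates and an isometry. -/
theorem measurePreserving_graphShift (e : E3 ≃ₗᵢ[ℝ] E3) {γ : EuclideanSpace ℝ (Fin 2) → ℝ}
    (hγ : Continuous γ) : MeasurePreserving (graphShift e γ) := by
  have h1 : MeasurePreserving
      (fun p : (Fin 2 → ℝ) × ℝ => (p.1, γ (WithLp.toLp 2 p.1) + p.2)) :=
    (MeasurePreserving.id (volume : Measure (Fin 2 → ℝ))).skew_product
      (g := fun s t => γ (WithLp.toLp 2 s) + t)
      (by
        have : Continuous fun p : (Fin 2 → ℝ) × ℝ => γ (WithLp.toLp 2 p.1) + p.2 :=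
          (hγ.comp ((PiLp.continuous_toLp 2 _).comp continuous_fst)).add continuous_snd
        exact this.measurable)
      (ae_of_all _ fun s => (measurePreserving_add_left volume _).map_eq)
  have h2 := (volume_preserving_piFinSuccAbove (fun _ : Fin 3 => ℝ) 2).symm
  have h3 := (PiLp.volume_preserving_toLp (Fin 3)).comp
    (h2.comp ((Measure.measurePreserving_swap (μ := (volume : Measure (Fin 2 → ℝ)))
      (ν := (volume : Measure ℝ))).comp h1))
  have h4 := e.symm.measurePreserving.comp h3
  convert h4 using 1
  ext p : 1
  simp only [graphShift, Function.comp]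
  congr 2
  ext i
  fin_cases i <;> rfl

theorem continuous_graphShift (e : E3 ≃ₗᵢ[ℝ] E3) {γ : EuclideanSpace ℝ (Fin 2) → ℝ}
    (hγ : Continuous γ) : Continuous (graphShift e γ) := by
  refine e.symm.continuous.comp ((PiLp.continuous_toLp 2 _).comp (continuous_pi fun i => ?_))
  have : Continuous fun p : (Fin 2 → ℝ) × ℝ => γ (WithLp.toLp 2 p.1) + p.2 :=
    (hγ.comp ((PiLp.continuous_toLp 2 _).comp continuous_fst)).add continuous_snd
  fin_cases i
  · change Continuous fun p : (Fin 2 → ℝ) × ℝ => p.1 0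
    fun_prop
  · change Continuous fun p : (Fin 2 → ℝ) × ℝ => p.1 1
    fun_prop
  · exact this

theorem horiz_graphShift (e : E3 ≃ₗᵢ[ℝ] E3) (γ : EuclideanSpace ℝ (Fin 2) → ℝ)
    (p : (Fin 2 → ℝ) × ℝ) : horiz e (graphShift e γ p) = WithLp.toLp 2 p.1 := by
  ext i; fin_cases i <;> simp [horiz, graphShift]

theorem graphShift_eq_add (e : E3 ≃ₗᵢ[ℝ] E3) (γ : EuclideanSpace ℝ (Fin 2) → ℝ)
    (s : Fin 2 → ℝ) (t : ℝ) :
    graphShift e γ (s, t) = graphShift e γ (s, 0) + t • e.symm (basisVec 2) := by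
  apply e.injective
  simp only [graphShift, map_add, map_smul, LinearIsometryEquiv.apply_symm_apply]
  ext i; fin_cases i <;> simp [basisVec]

/-- The parameter plane carries the sup distance, for which the Hausdorff 2-measure is Lebesgue
measure. The crude constant `2 * (1 + K)` accounts for the change to the Euclidean distance. -/
theorem lipschitzOnWith_graph (e : E3 ≃ₗᵢ[ℝ] E3) {γ : EuclideanSpace ℝ (Fin 2) → ℝ} {K : ℝ≥0}
    {A : Set (EuclideanSpace ℝ (Fin 2))} (hl : LipschitzOnWith K γ A) :
    LipschitzOnWith (2 * (1 + K)) (fun s => graphShift e γ (s, 0)) (WithLp.toLp 2 ⁻¹' A) := by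
  refine LipschitzOnWith.of_dist_le_mul fun s hs s' hs' => ?_
  simp only [graphShift, e.symm.dist_map]
  have h0 := dist_le_pi_dist s s' 0
  have h1 := dist_le_pi_dist s s' 1
  have hd : dist (WithLp.toLp 2 s : EuclideanSpace ℝ (Fin 2)) (WithLp.toLp 2 s') ≤
      2 * dist s s' := by
    rw [EuclideanSpace.dist_eq]
    refine Real.sqrt_le_iff.2 ⟨by positivity, ?_⟩
    simp only [Fin.sum_univ_two]
    nlinarith [dist_nonneg (x := s 0) (y := s' 0), dist_nonneg (x := s 1) (y := s' 1)]
  have h2 := hl.dist_le_mul _ hs _ hs'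
  rw [EuclideanSpace.dist_eq]
  refine Real.sqrt_le_iff.2 ⟨by positivity, ?_⟩
  simp only [Fin.sum_univ_three]
  simp only [add_zero]
  have h3 : dist (γ (WithLp.toLp 2 s)) (γ (WithLp.toLp 2 s')) ≤ 2 * K * dist s s' :=
    h2.trans (by nlinarith [K.2, mul_le_mul_of_nonneg_left hd K.2])
  push_cast
  have q0 := pow_le_pow_left₀ dist_nonneg h0 2
  have q1 := pow_le_pow_left₀ dist_nonneg h1 2
  have q3 := pow_le_pow_left₀ dist_nonneg h3 2
  have hK := K.2
  have : 0 ≤ (K : ℝ) * dist s s' ^ 2 := by positivity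
  nlinarith [sq_nonneg (dist s s')]

theorem frontier_chart_eq (hΩ : IsOpen Ω) {e : E3 ≃ₗᵢ[ℝ] E3} {γ : EuclideanSpace ℝ (Fin 2) → ℝ}
    (hγ : Continuous γ) {x : E3} {r : ℝ}
    (h : ∀ y ∈ Metric.ball x r, y ∈ Ω ↔ γ (horiz e y) < e y 2) {y : E3}
    (hy : y ∈ Metric.ball x r) (hyf : y ∈ frontier Ω) : γ (horiz e y) = e y 2 := by
  have hc : Continuous fun y => horiz e y := by
    refine (PiLp.continuous_toLp 2 _).comp (continuous_pi fun i => ?_)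
    fin_cases i
    · exact (PiLp.continuous_apply 2 _ 0).comp e.continuous
    · exact (PiLp.continuous_apply 2 _ 1).comp e.continuous
  have hc2 : Continuous fun y => e y 2 := (PiLp.continuous_apply 2 _ 2).comp e.continuous
  refine le_antisymm ?_ ?_
  · by_contra hn
    have hopen : IsOpen {z | e z 2 < γ (horiz e z)} := isOpen_lt hc2 (hγ.comp hc)
    obtain ⟨z, ⟨hz1, hz2⟩, hzΩ⟩ := mem_closure_iff.1 hyf.1 _ (hopen.inter Metric.isOpen_ball)
      ⟨not_le.1 hn, hy⟩
    exact lt_asymm ((h z hz2).1 hzΩ) hz1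
  · by_contra hn
    have : y ∈ Ω := (h y hy).2 (not_le.1 hn)
    exact hyf.2 (by rwa [hΩ.interior_eq])

section Bound

variable {F : Type*} [NormedAddCommGroup F] [InnerProductSpace ℝ F]

/-- The fundamental theorem of calculus for (1 - t/h) |φ(x + tν)|², which equals |φ(x)|² at t = 0
and vanishes at t = h. -/
theorem enorm_sq_le_lintegral_segment {φ : E3 → F} (hφ : ContDiff ℝ 1 φ) (x ν : E3) (hν : ‖ν‖ = 1)
    {h : ℝ} (hh : 0 < h) :
    ‖φ x‖ₑ ^ 2 ≤ ∫⁻ t in Set.Ioo 0 h, ENNReal.ofReal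
      (h⁻¹ * ‖φ (x + t • ν)‖ ^ 2 + 2 * (‖φ (x + t • ν)‖ * ‖fderiv ℝ φ (x + t • ν)‖)) := by
  have hl : ∀ t : ℝ, HasDerivAt (fun t : ℝ => x + t • ν) ν t := fun t => by
    simpa using! ((hasDerivAt_id t).smul_const ν).const_add x
  have hcl : Continuous fun t : ℝ => x + t • ν := by fun_prop
  have hd1 : ∀ t : ℝ, HasDerivAt (fun t : ℝ => φ (x + t • ν)) (fderiv ℝ φ (x + t • ν) ν) t :=
    fun t => ((hφ.differentiable one_ne_zero _).hasFDerivAt).comp_hasDerivAt t (hl t)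
  have hd2 : ∀ t : ℝ, HasDerivAt (fun t : ℝ => ‖φ (x + t • ν)‖ ^ 2)
      (2 * inner ℝ (φ (x + t • ν)) (fderiv ℝ φ (x + t • ν) ν)) t := fun t => (hd1 t).norm_sq
  have hd3 : ∀ t : ℝ, HasDerivAt (fun t : ℝ => (1 - h⁻¹ * t) * ‖φ (x + t • ν)‖ ^ 2)
      (-h⁻¹ * ‖φ (x + t • ν)‖ ^ 2 +
        (1 - h⁻¹ * t) * (2 * inner ℝ (φ (x + t • ν)) (fderiv ℝ φ (x + t • ν) ν))) t := fun t => by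
    have : HasDerivAt (fun t : ℝ => 1 - h⁻¹ * t) (-h⁻¹) t := by
      simpa using! ((hasDerivAt_id t).const_mul h⁻¹).const_sub 1
    exact this.mul (hd2 t)
  have hc1 : Continuous fun t : ℝ => φ (x + t • ν) := hφ.continuous.comp hcl
  have hc2 : Continuous fun t : ℝ => fderiv ℝ φ (x + t • ν) :=
    (hφ.continuous_fderiv one_ne_zero).comp hcl
  have hci : Continuous fun t : ℝ => inner ℝ (φ (x + t • ν)) (fderiv ℝ φ (x + t • ν) ν) :=
    hc1.inner (hc2.clm_apply continuous_const)
  have hftc := intervalIntegral.integral_eq_sub_of_hasDerivAt (a := 0) (b := h)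
    (fun t _ => hd3 t) (Continuous.intervalIntegrable (by fun_prop) _ _)
  have hcq : Continuous fun t : ℝ =>
      h⁻¹ * ‖φ (x + t • ν)‖ ^ 2 + 2 * (‖φ (x + t • ν)‖ * ‖fderiv ℝ φ (x + t • ν)‖) := by fun_prop
  have hq0 : ∀ t : ℝ, 0 ≤
      h⁻¹ * ‖φ (x + t • ν)‖ ^ 2 + 2 * (‖φ (x + t • ν)‖ * ‖fderiv ℝ φ (x + t • ν)‖) := fun t => by
    positivity
  have hmain : ‖φ x‖ ^ 2 ≤ ∫ t in (0 : ℝ)..h,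
      (h⁻¹ * ‖φ (x + t • ν)‖ ^ 2 + 2 * (‖φ (x + t • ν)‖ * ‖fderiv ℝ φ (x + t • ν)‖)) := by
    have e1 : ‖φ x‖ ^ 2 = - ∫ t in (0 : ℝ)..h, (-h⁻¹ * ‖φ (x + t • ν)‖ ^ 2 +
        (1 - h⁻¹ * t) * (2 * inner ℝ (φ (x + t • ν)) (fderiv ℝ φ (x + t • ν) ν))) := by
      rw [hftc]; simp [hh.ne']
    rw [e1, ← intervalIntegral.integral_neg]
    refine intervalIntegral.integral_mono_on hh.le
      (Continuous.intervalIntegrable (by fun_prop) _ _) (hcq.intervalIntegrable _ _) fun t ht => ?_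
    have h1 : |1 - h⁻¹ * t| ≤ 1 := by
      have : h⁻¹ * t ≤ 1 := by rw [inv_mul_le_iff₀ hh]; linarith [ht.2]
      have h0 : 0 ≤ h⁻¹ * t := mul_nonneg (inv_nonneg.2 hh.le) ht.1
      rw [abs_le]; constructor <;> linarith
    have h2 : |inner ℝ (φ (x + t • ν)) (fderiv ℝ φ (x + t • ν) ν)| ≤
        ‖φ (x + t • ν)‖ * ‖fderiv ℝ φ (x + t • ν)‖ := by
      refine (abs_real_inner_le_norm _ _).trans ?_
      gcongr
      simpa [hν] using (fderiv ℝ φ (x + t • ν)).le_opNorm ν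
    have h3 := mul_le_mul h1 h2 (abs_nonneg _) zero_le_one
    rw [← abs_mul] at h3
    have h4 := neg_abs_le ((1 - h⁻¹ * t) * inner ℝ (φ (x + t • ν)) (fderiv ℝ φ (x + t • ν) ν))
    nlinarith
  rw [← ofReal_integral_eq_lintegral_ofReal ((hcq.integrableOn_Icc (a := 0) (b := h)).mono_set
    Set.Ioo_subset_Icc_self) (ae_of_all _ hq0), ← integral_Ioc_eq_integral_Ioo,
    ← intervalIntegral.integral_of_le hh.le]
  calc ‖φ x‖ₑ ^ 2 = ENNReal.ofReal (‖φ x‖ ^ 2) := by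
        rw [ENNReal.ofReal_pow (norm_nonneg _), ofReal_norm]
    _ ≤ _ := ENNReal.ofReal_le_ofReal hmain

/-- The set `S` of boundary points admits a multiplicative trace estimate. -/
def TraceEstimate (F : Type*) [NormedAddCommGroup F] [InnerProductSpace ℝ F]
    (Ω S : Set E3) : Prop :=
  ∃ C : ℝ≥0, ∀ φ : E3 → F, ContDiff ℝ 1 φ →
    ∫⁻ x in S, ‖φ x‖ₑ ^ 2 ∂(Measure.hausdorffMeasure 2) ≤
      C * ∫⁻ x in Ω, (‖φ x‖ₑ ^ 2 + ‖φ x‖ₑ * ‖fderiv ℝ φ x‖ₑ)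

/-- Lipschitz maps enlarge Hausdorff measure by a bounded factor. This one-sided comparison replaces
the area formula. -/
theorem hausdorffMeasure_restrict_le {S : Set E3} {A : Set (Fin 2 → ℝ)} {T : (Fin 2 → ℝ) → E3}
    {K : ℝ≥0} (hT : Continuous T) (hl : LipschitzOnWith K T A) (hS : S ⊆ T '' A) :
    (Measure.hausdorffMeasure 2 : Measure E3).restrict S ≤
      (K ^ 2 : ℝ≥0∞) • (volume.restrict A).map T := by
  refine Measure.le_iff.2 fun B hB => ?_
  have hv : (Measure.hausdorffMeasure 2 : Measure (Fin 2 → ℝ)) = volume := by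
    have := hausdorffMeasure_pi_real (ι := Fin 2)
    simpa using this
  rw [Measure.restrict_apply hB, Measure.smul_apply, Measure.map_apply hT.measurable hB,
    Measure.restrict_apply (hT.measurable hB), smul_eq_mul]
  have hsub : B ∩ S ⊆ T '' (T ⁻¹' B ∩ A) := by
    rintro y ⟨hyB, hyS⟩
    obtain ⟨s, hs, rfl⟩ := hS hyS
    exact ⟨s, ⟨hyB, hs⟩, rfl⟩
  refine (measure_mono hsub).trans ?_
  have := (hl.mono Set.inter_subset_right).hausdorffMeasure_image_le (d := 2)
    (s := T ⁻¹' B ∩ A) (by norm_num)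
  rw [hv] at this
  simpa using this

/-- The segment estimate is integrated over the graph. The vertical segments fill a piece of Ω, and
the shear parametrising it preserves volume. -/
theorem traceEstimate_chart (hΩ : IsOpen Ω) {α : ℝ≥0} (hb : HasC2HolderBoundary α Ω) {x : E3}
    (hx : x ∈ frontier Ω) : ∃ ρ > 0, TraceEstimate F Ω (frontier Ω ∩ Metric.ball x ρ) := by
  obtain ⟨r, e, γ, K, hr, hγ, hl, hy⟩ := exists_lipschitz_chart hb hx
  -- Halving the radius keeps vertical shifts by less than `h` of points in the ball of radius `h`
  -- inside the chart ball.
  set h := r / 2 with hh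
  have hh0 : 0 < h := by positivity
  let T : (Fin 2 → ℝ) → E3 := fun s => graphShift e γ (s, 0)
  have hT : Continuous T := (continuous_graphShift e hγ).comp (by fun_prop)
  let A : Set (Fin 2 → ℝ) := T ⁻¹' Metric.ball x h
  have hA : MeasurableSet A := (Metric.isOpen_ball.preimage hT).measurableSet
  have hTl : LipschitzOnWith (2 * (1 + K)) T A := (lipschitzOnWith_graph e hl).mono fun s hs => by
    have h1 : dist (horiz e (T s)) (horiz e x) < h := (dist_horiz_le e _ _).trans_lt hs
    rw [horiz_graphShift] at h1
    exact h1.trans (by linarith)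
  have hST : frontier Ω ∩ Metric.ball x h ⊆ T '' A := by
    rintro y ⟨hyf, hyb⟩
    have hyr : y ∈ Metric.ball x r := Metric.ball_subset_ball (by linarith) hyb
    have heq := frontier_chart_eq hΩ hγ hy hyr hyf
    have hTy : T ![e y 0, e y 1] = y := by
      apply e.injective
      simp only [T, graphShift, LinearIsometryEquiv.apply_symm_apply]
      have h2 : (WithLp.toLp 2 ![e y 0, e y 1] : EuclideanSpace ℝ (Fin 2)) = horiz e y := rfl
      simp only [h2, heq]
      ext i; fin_cases i <;> simp
    exact ⟨_, by simpa only [A, Set.mem_preimage, hTy] using hyb, hTy⟩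
  have hmem : ∀ s ∈ A, ∀ t ∈ Set.Ioo 0 h, graphShift e γ (s, t) ∈ Ω := by
    intro s hs t ht
    have hd : dist (graphShift e γ (s, t)) (T s) < h := by
      rw [graphShift_eq_add, dist_eq_norm, add_sub_cancel_left, norm_smul,
        LinearIsometryEquiv.norm_map, Real.norm_of_nonneg ht.1.le]
      simpa [basisVec] using ht.2
    have hs' : dist (T s) x < h := hs
    rw [hy _ (by rw [Metric.mem_ball]; linarith [dist_triangle (graphShift e γ (s, t)) (T s) x]),
      horiz_graphShift]
    simp [graphShift, ht.1]
  have hν : ‖e.symm (basisVec 2)‖ = 1 := by simp [basisVec]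
  -- The square of the Lipschitz constant comes from the 2-measure of the graph; the maximum of 1/h
  -- and 2 bounds the coefficients of the segment estimate.
  refine ⟨h, hh0, (2 * (1 + K)) ^ 2 * (max h⁻¹.toNNReal 2), fun φ hφ => ?_⟩
  let q : E3 → ℝ≥0∞ := fun y =>
    ENNReal.ofReal (h⁻¹ * ‖φ y‖ ^ 2 + 2 * (‖φ y‖ * ‖fderiv ℝ φ y‖))
  have hφc := hφ.continuous
  have hφc' := hφ.continuous_fderiv one_ne_zero
  have hqm : Measurable q :=
    (Continuous.measurable (by fun_prop)).ennreal_ofReal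
  have hgm : Measurable (graphShift e γ) := (continuous_graphShift e hγ).measurable
  calc ∫⁻ y in frontier Ω ∩ Metric.ball x h, ‖φ y‖ₑ ^ 2 ∂(Measure.hausdorffMeasure 2)
      ≤ ∫⁻ y, ‖φ y‖ₑ ^ 2 ∂((((2 * (1 + K) : ℝ≥0) : ℝ≥0∞) ^ 2) • (volume.restrict A).map T) :=
        lintegral_mono' (hausdorffMeasure_restrict_le hT hTl hST) le_rfl
    _ = ((2 * (1 + K) : ℝ≥0) : ℝ≥0∞) ^ 2 * ∫⁻ s in A, ‖φ (T s)‖ₑ ^ 2 := by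
        rw [lintegral_smul_measure, lintegral_map (hφc.enorm.measurable.pow_const 2)
          hT.measurable, smul_eq_mul]
    _ ≤ ((2 * (1 + K) : ℝ≥0) : ℝ≥0∞) ^ 2 *
          ∫⁻ s in A, ∫⁻ t in Set.Ioo 0 h, q (graphShift e γ (s, t)) := by
        gcongr with s
        refine (enorm_sq_le_lintegral_segment hφ (T s) _ hν hh0).trans_eq ?_
        refine lintegral_congr fun t => ?_
        rw [graphShift_eq_add e γ s t]
    _ = ((2 * (1 + K) : ℝ≥0) : ℝ≥0∞) ^ 2 *
          ∫⁻ p in A ×ˢ Set.Ioo 0 h, q (graphShift e γ p) := by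
        congr 1
        rw [← lintegral_prod (f := fun p => q (graphShift e γ p)) (hqm.comp hgm).aemeasurable,
          Measure.prod_restrict]
        rfl
    _ ≤ ((2 * (1 + K) : ℝ≥0) : ℝ≥0∞) ^ 2 * ∫⁻ y in Ω, q y := by
        refine mul_le_mul' le_rfl ?_
        rw [← lintegral_indicator (hA.prod measurableSet_Ioo), ← lintegral_indicator
          hΩ.measurableSet, ← (measurePreserving_graphShift e hγ).lintegral_comp
            (hqm.indicator hΩ.measurableSet)]
        refine lintegral_mono fun p => ?_
        by_cases hp : p ∈ A ×ˢ Set.Ioo 0 h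
        · rw [Set.indicator_of_mem hp, Set.indicator_of_mem (hmem p.1 hp.1 p.2 hp.2)]
        · simp [hp]
    _ ≤ ((2 * (1 + K) : ℝ≥0) : ℝ≥0∞) ^ 2 * ∫⁻ y in Ω, ((max h⁻¹.toNNReal 2 : ℝ≥0) : ℝ≥0∞) *
          (‖φ y‖ₑ ^ 2 + ‖φ y‖ₑ * ‖fderiv ℝ φ y‖ₑ) := by
        gcongr with y
        simp only [q]
        rw [ENNReal.ofReal_add (by positivity) (by positivity), ENNReal.ofReal_mul (by positivity),
          ENNReal.ofReal_mul (by norm_num), ENNReal.ofReal_mul (norm_nonneg _),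
          ENNReal.ofReal_pow (norm_nonneg _), ofReal_norm, ofReal_norm, mul_add]
        gcongr
        · exact ENNReal.coe_le_coe.2 (le_max_left _ _)
        · rw [show ENNReal.ofReal 2 = ((2 : ℝ≥0) : ℝ≥0∞) by simp]
          exact ENNReal.coe_le_coe.2 (le_max_right _ _)
    _ = _ := by
        rw [lintegral_const_mul' _ _ ENNReal.coe_ne_top]
        push_cast
        rw [mul_assoc]

theorem traceEstimate_frontier (hΩ : IsOpen Ω) (hc : IsCompact (frontier Ω)) {α : ℝ≥0}
    (hb : HasC2HolderBoundary α Ω) : TraceEstimate F Ω (frontier Ω) := by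
  refine hc.induction_on (p := TraceEstimate F Ω) ⟨0, fun φ _ => by simp⟩ ?_ ?_ ?_
  · rintro s t hst ⟨C, hC⟩
    exact ⟨C, fun φ hφ => (lintegral_mono_set hst).trans (hC φ hφ)⟩
  · rintro s t ⟨C, hC⟩ ⟨C', hC'⟩
    refine ⟨C + C', fun φ hφ => (lintegral_union_le _ s t).trans ?_⟩
    rw [ENNReal.coe_add, add_mul]
    exact add_le_add (hC φ hφ) (hC' φ hφ)
  · intro x hx
    obtain ⟨ρ, hρ, h⟩ := traceEstimate_chart (F := F) hΩ hb hx
    exact ⟨_, Filter.inter_mem self_mem_nhdsWithin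
      (mem_nhdsWithin_of_mem_nhds (Metric.ball_mem_nhds x hρ)), h⟩

end Bound

end Trace

/-! ### Boundary traces of H¹ functions -/

section Trace

variable {Ω : Set E3} {F : Type*} [NormedAddCommGroup F]

theorem tendsto_eLpNorm_of_tendsto_sub {X : Type*} [MeasurableSpace X] {μ : Measure X}
    {f : ℕ → X → F} {g : X → F} (hf : ∀ k, AEStronglyMeasurable (f k) μ) (hg : MemLp g 2 μ)
    (h : Tendsto (fun k => eLpNorm (f k - g) 2 μ) atTop (𝓝 0)) :
    Tendsto (fun k => eLpNorm (f k) 2 μ) atTop (𝓝 (eLpNorm g 2 μ)) := by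
  have up : ∀ k, eLpNorm (f k) 2 μ ≤ eLpNorm g 2 μ + eLpNorm (f k - g) 2 μ := fun k => by
    have := eLpNorm_add_le hg.1 ((hf k).sub hg.1) (p := 2) (by norm_num)
    simpa using this
  have lo : ∀ k, eLpNorm g 2 μ - eLpNorm (f k - g) 2 μ ≤ eLpNorm (f k) 2 μ := fun k => by
    have := eLpNorm_sub_le (hf k) ((hf k).sub hg.1) (p := 2) (by norm_num)
    rw [tsub_le_iff_right]
    simpa using this
  have t1 := ENNReal.Tendsto.sub (tendsto_const_nhds (x := eLpNorm g 2 μ)) h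
    (Or.inl hg.2.ne)
  rw [tsub_zero] at t1
  have t2 := (tendsto_const_nhds (x := eLpNorm g 2 μ)).add h
  rw [add_zero] at t2
  exact tendsto_of_tendsto_of_tendsto_of_le_of_le t1 t2 lo up

theorem lintegral_enorm_mul_le {X E : Type*} [NormedAddCommGroup E] [MeasurableSpace X]
    {μ : Measure X} {f : X → F} {g : X → E} (hf : AEStronglyMeasurable f μ)
    (hg : AEStronglyMeasurable g μ) :
    ∫⁻ x, ‖f x‖ₑ * ‖g x‖ₑ ∂μ ≤ eLpNorm f 2 μ * eLpNorm g 2 μ := by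
  have := ENNReal.lintegral_mul_le_Lp_mul_Lq μ
    (show Real.HolderConjugate 2 2 from Real.HolderConjugate.two_two) hf.enorm hg.enorm
  rw [eLpNorm_eq_lintegral_rpow_enorm_toReal two_ne_zero ENNReal.ofNat_ne_top,
    eLpNorm_eq_lintegral_rpow_enorm_toReal two_ne_zero ENNReal.ofNat_ne_top]
  simpa using this

variable [InnerProductSpace ℝ F]

/-- The multiplicative form matters: the right side tends to zero when the L² norm does and the
gradients merely stay bounded. -/
theorem exists_trace_inequality (hΩ : IsOpen Ω) (hc : IsCompact (frontier Ω)) {α : ℝ≥0}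
    (hb : HasC2HolderBoundary α Ω) : ∃ C : ℝ≥0, ∀ φ : E3 → F, ContDiff ℝ 1 φ →
      eLpNorm φ 2 (surfaceMeasure Ω) ^ 2 ≤ C * (eLpNorm φ 2 (volume.restrict Ω) ^ 2 +
        eLpNorm φ 2 (volume.restrict Ω) * eLpNorm (fderiv ℝ φ) 2 (volume.restrict Ω)) := by
  obtain ⟨C, hC⟩ := traceEstimate_frontier (F := F) hΩ hc hb
  refine ⟨C, fun φ hφ => ?_⟩
  rw [eLpNorm_two_sq, eLpNorm_two_sq, surfaceMeasure]
  refine (hC φ hφ).trans ?_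
  rw [lintegral_add_left (hφ.continuous.enorm.measurable.pow_const 2)]
  gcongr
  exact lintegral_enorm_mul_le hφ.continuous.aestronglyMeasurable
    (hφ.continuous_fderiv one_ne_zero).aestronglyMeasurable

/-- The trace estimate applied to the constant function 1. -/
theorem isFiniteMeasure_surfaceMeasure (hΩ : IsOpen Ω) (hc : IsCompact (frontier Ω)) {α : ℝ≥0}
    (hb : HasC2HolderBoundary α Ω) (hV : volume Ω < ⊤) : IsFiniteMeasure (surfaceMeasure Ω) := by
  obtain ⟨C, hC⟩ := traceEstimate_frontier (F := ℝ) hΩ hc hb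
  have := hC (fun _ => 1) contDiff_const
  refine ⟨?_⟩
  simp only [enorm_one, one_pow, fderiv_fun_const, Pi.zero_apply, lintegral_const, one_mul,
    Measure.restrict_apply_univ] at this
  rw [surfaceMeasure, Measure.restrict_apply_univ]
  exact this.trans_lt (ENNReal.mul_lt_top ENNReal.coe_lt_top (ENNReal.mul_lt_top (by simp) hV))

/-- The trace is continuous, with a multiplicative estimate. -/
theorem exists_eLpNorm_trace_sub_le (hΩ : IsOpen Ω) (hc : IsCompact (frontier Ω)) {α : ℝ≥0}
    (hb : HasC2HolderBoundary α Ω) [CompleteSpace F] : ∃ C : ℝ≥0, ∀ u v g h : E3 → F,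
      HasTrace Ω u g → HasTrace Ω v h →
      eLpNorm (g - h) 2 (surfaceMeasure Ω) ^ 2 ≤ C * (eLpNorm (u - v) 2 (volume.restrict Ω) ^ 2 +
        eLpNorm (u - v) 2 (volume.restrict Ω) *
          eLpNorm (weakGrad Ω u - weakGrad Ω v) 2 (volume.restrict Ω)) := by
  obtain ⟨C, hC⟩ := exists_trace_inequality (F := F) hΩ hc hb
  refine ⟨C, ?_⟩
  rintro u v g h ⟨hu, hg, φ, h1, h2, h3, h4⟩ ⟨hv, hh, χ, k1, k2, k3, k4⟩
  have sub : ∀ {X E : Type _} [MeasurableSpace X] [NormedAddCommGroup E] {μ : Measure X}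
      {f f' : ℕ → X → E} {g g' : X → E}, (∀ k, AEStronglyMeasurable (f k) μ) →
      (∀ k, AEStronglyMeasurable (f' k) μ) → MemLp g 2 μ → MemLp g' 2 μ →
      Tendsto (fun k => eLpNorm (f k - g) 2 μ) atTop (𝓝 0) →
      Tendsto (fun k => eLpNorm (f' k - g') 2 μ) atTop (𝓝 0) →
      Tendsto (fun k => eLpNorm (f k - f' k) 2 μ) atTop (𝓝 (eLpNorm (g - g') 2 μ)) := by
    intro X E _ _ μ f f' g g' hf hf' hg hg' t t'
    refine tendsto_eLpNorm_of_tendsto_sub (fun k => (hf k).sub (hf' k)) (hg.sub hg') ?_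
    refine tendsto_of_tendsto_of_tendsto_of_le_of_le tendsto_const_nhds
      (by simpa using t.add t') (fun _ => zero_le) fun k => ?_
    have : f k - f' k - (g - g') = (f k - g) - (f' k - g') := by abel
    rw [this]
    exact eLpNorm_sub_le ((hf k).sub hg.1) ((hf' k).sub hg'.1) (by norm_num)
  have m1 : ∀ k (μ : Measure E3), AEStronglyMeasurable (φ k) μ := fun k μ =>
    (h1 k).continuous.aestronglyMeasurable
  have m2 : ∀ k (μ : Measure E3), AEStronglyMeasurable (χ k) μ := fun k μ =>
    (k1 k).continuous.aestronglyMeasurable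
  have m3 : ∀ k (μ : Measure E3), AEStronglyMeasurable (fderiv ℝ (φ k)) μ := fun k μ =>
    ((h1 k).continuous_fderiv (by simp)).aestronglyMeasurable
  have m4 : ∀ k (μ : Measure E3), AEStronglyMeasurable (fderiv ℝ (χ k)) μ := fun k μ =>
    ((k1 k).continuous_fderiv (by simp)).aestronglyMeasurable
  have s1 := sub (m1 · _) (m2 · _) hg hh h4 k4
  have s2 := sub (m1 · _) (m2 · _) hu.1 hv.1 h2 k2
  have s3 := sub (m3 · _) (m4 · _) (hu.memLp_weakGrad hΩ) (hv.memLp_weakGrad hΩ) h3 k3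
  have f2 := (hu.1.sub hv.1).2.ne
  have f3 := ((hu.memLp_weakGrad hΩ).sub (hv.memLp_weakGrad hΩ)).2.ne
  refine le_of_tendsto_of_tendsto' (ENNReal.Tendsto.pow s1 (n := 2))
    (ENNReal.Tendsto.const_mul ((ENNReal.Tendsto.pow s2 (n := 2)).add
      (ENNReal.Tendsto.mul s2 (Or.inr f3) s3 (Or.inr f2))) (Or.inr ENNReal.coe_ne_top)) fun k => ?_
  have := hC (φ k - χ k) (((h1 k).sub (k1 k)).of_le (by simp))
  have e : fderiv ℝ (φ k - χ k) = fderiv ℝ (φ k) - fderiv ℝ (χ k) := by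
    ext1 x
    rw [Pi.sub_apply]
    exact fderiv_sub ((h1 k).differentiable (by simp) x) ((k1 k).differentiable (by simp) x)
  rwa [e] at this

/-- By the trace inequality for differences, the restrictions of smooth approximants form a Cauchy
sequence in L²(∂Ω); its limit is the trace. -/
theorem MemH1.exists_hasTrace [CompleteSpace F] (hΩ : IsOpen Ω) (hc : IsCompact (frontier Ω))
    {α : ℝ≥0} (hb : HasC2HolderBoundary α Ω) (hV : volume Ω < ⊤) {u : E3 → F} (hu : MemH1 Ω u) :
    ∃ g, HasTrace Ω u g := by
  have := isFiniteMeasure_surfaceMeasure hΩ hc hb hV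
  obtain ⟨φ, h1, h2, h3⟩ := hu.exists_smooth_tendsto hΩ hc hb
  obtain ⟨C, hC⟩ := exists_trace_inequality (F := F) hΩ hc hb
  have hL : ∀ k, MemLp (φ k) 2 (surfaceMeasure Ω) := fun k => by
    obtain ⟨B, hB⟩ := hc.exists_bound_of_continuousOn (h1 k).continuous.continuousOn
    exact MemLp.of_bound (h1 k).continuous.aestronglyMeasurable B
      (ae_restrict_of_forall_mem hc.isClosed.measurableSet hB)
  have m1 : ∀ k (μ : Measure E3), AEStronglyMeasurable (φ k) μ := fun k μ =>
    (h1 k).continuous.aestronglyMeasurable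
  have m3 : ∀ k (μ : Measure E3), AEStronglyMeasurable (fderiv ℝ (φ k)) μ := fun k μ =>
    ((h1 k).continuous_fderiv (by simp)).aestronglyMeasurable
  have pair : ∀ {X E : Type _} [MeasurableSpace X] [NormedAddCommGroup E] {μ : Measure X}
      {f : ℕ → X → E} {g : X → E}, (∀ k, AEStronglyMeasurable (f k) μ) →
      MemLp g 2 μ → Tendsto (fun k => eLpNorm (f k - g) 2 μ) atTop (𝓝 0) →
      Tendsto (fun p : ℕ × ℕ => eLpNorm (f p.1 - f p.2) 2 μ) atTop (𝓝 0) := by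
    intro X E _ _ μ f g hf hg t
    rw [← prod_atTop_atTop_eq]
    refine tendsto_of_tendsto_of_tendsto_of_le_of_le tendsto_const_nhds
      (by simpa using (t.comp tendsto_fst).add (t.comp tendsto_snd)) (fun _ => zero_le)
      fun p => ?_
    have : f p.1 - f p.2 = (f p.1 - g) - (f p.2 - g) := by abel
    rw [this]
    exact eLpNorm_sub_le ((hf _).sub hg.1) ((hf _).sub hg.1) (by norm_num)
  have p1 := pair (m1 · _) hu.1 h2
  have p2 := pair (m3 · _) (hu.memLp_weakGrad hΩ) h3
  have hlim : Tendsto (fun p : ℕ × ℕ => eLpNorm (φ p.1 - φ p.2) 2 (surfaceMeasure Ω) ^ 2)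
      atTop (𝓝 0) := by
    refine tendsto_of_tendsto_of_tendsto_of_le_of_le tendsto_const_nhds
      (h := fun p : ℕ × ℕ => (C : ℝ≥0∞) * (eLpNorm (φ p.1 - φ p.2) 2 (volume.restrict Ω) ^ 2 +
        eLpNorm (φ p.1 - φ p.2) 2 (volume.restrict Ω) *
          eLpNorm (fderiv ℝ (φ p.1) - fderiv ℝ (φ p.2)) 2 (volume.restrict Ω))) ?_
      (fun _ => zero_le) fun p => ?_
    · have := ENNReal.Tendsto.const_mul ((ENNReal.Tendsto.pow p1 (n := 2)).add
        (ENNReal.Tendsto.mul p1 (Or.inr ENNReal.zero_ne_top) p2 (Or.inr ENNReal.zero_ne_top)))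
        (Or.inr (ENNReal.coe_ne_top (r := C)))
      simpa using this
    · have := hC (φ p.1 - φ p.2) (((h1 _).sub (h1 _)).of_le (by simp))
      have e : fderiv ℝ (φ p.1 - φ p.2) = fderiv ℝ (φ p.1) - fderiv ℝ (φ p.2) := by
        ext1 x
        rw [Pi.sub_apply]
        exact fderiv_sub ((h1 _).differentiable (by simp) x) ((h1 _).differentiable (by simp) x)
      rwa [e] at this
  have hlim' : Tendsto (fun p : ℕ × ℕ => eLpNorm (φ p.1 - φ p.2) 2 (surfaceMeasure Ω))
      atTop (𝓝 0) := by
    have := (ENNReal.continuous_rpow_const (y := (1 / 2 : ℝ))).tendsto 0 |>.comp hlim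
    simp only [ENNReal.zero_rpow_of_pos (by norm_num : (0 : ℝ) < 1 / 2)] at this
    refine this.congr fun p => ?_
    rw [Function.comp, ← ENNReal.rpow_natCast, ← ENNReal.rpow_mul]
    norm_num
  have hcs : CauchySeq fun k => (hL k).toLp (φ k) := by
    rw [Lp.cauchySeq_Lp_iff_cauchySeq_eLpNorm]
    refine hlim'.congr fun p => eLpNorm_congr_ae ?_
    exact ((hL _).coeFn_toLp.sub (hL _).coeFn_toLp).symm
  obtain ⟨g, hg⟩ := cauchySeq_tendsto_of_complete hcs
  refine ⟨g, hu, Lp.memLp g, φ, h1, h2, h3, ?_⟩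
  rw [Lp.tendsto_Lp_iff_tendsto_eLpNorm'] at hg
  refine hg.congr fun k => eLpNorm_congr_ae ?_
  exact (hL k).coeFn_toLp.sub EventuallyEq.rfl

end Trace

/-! ### The interior div-curl estimate -/

/-- The directional derivative. -/
def pd {F : Type*} [NormedAddCommGroup F] [NormedSpace ℝ F] (v : E3) (f : E3 → F) (x : E3) : F :=
  fderiv ℝ f x v

theorem eLpNorm_le_mul_of_norm_le {X E F : Type*} [MeasurableSpace X] [NormedAddCommGroup E]
    [NormedAddCommGroup F] {μ : Measure X} {f : X → E} {g : X → F} {C : ℝ≥0}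
    (h : ∀ᵐ x ∂μ, ‖f x‖ ≤ C * ‖g x‖) (p : ℝ≥0∞) : eLpNorm f p μ ≤ C * eLpNorm g p μ := by
  refine (eLpNorm_le_nnreal_smul_eLpNorm_of_ae_le_mul h p).trans_eq ?_
  rw [ENNReal.smul_def, smul_eq_mul]

section DivCurl

theorem pd_pd_comm {F : Type*} [NormedAddCommGroup F] [NormedSpace ℝ F] {f : E3 → F}
    (hf : ContDiff ℝ ∞ f) (v w x : E3) :
    pd v (pd w f) x = pd w (pd v f) x := by
  have hd : DifferentiableAt ℝ (fderiv ℝ f) x :=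
    (hf.fderiv_right (m := 1) (by norm_cast)).differentiable one_ne_zero x
  have key : ∀ a b : E3, pd a (pd b f) x = fderiv ℝ (fderiv ℝ f) x a b := fun a b => by
    change fderiv ℝ (fun y => fderiv ℝ f y b) x a = _
    rw [fderiv_clm_apply hd (differentiableAt_const b)]
    simp
  have hs : IsSymmSndFDerivAt ℝ f x :=
    hf.contDiffAt.isSymmSndFDerivAt (by simp; norm_cast)
  rw [key, key]
  exact hs v w

theorem contDiff_pd {F : Type*} [NormedAddCommGroup F] [NormedSpace ℝ F] {f : E3 → F}
    (hf : ContDiff ℝ ∞ f) (v : E3) : ContDiff ℝ ∞ (pd v f) :=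
  (hf.fderiv_right (m := ∞) (by simp)).clm_apply contDiff_const

theorem hasCompactSupport_pd {F : Type*} [NormedAddCommGroup F] [NormedSpace ℝ F] {f : E3 → F}
    (hf : HasCompactSupport f) (v : E3) : HasCompactSupport (pd v f) :=
  hf.fderiv_apply ℝ v

theorem integral_mul_pd {a b : E3 → ℝ} (ha : ContDiff ℝ ∞ a) (hb : ContDiff ℝ ∞ b)
    (ha' : HasCompactSupport a) (v : E3) : ∫ x, a x * pd v b x = - ∫ x, pd v a x * b x := by
  refine integral_mul_fderiv_eq_neg_fderiv_mul_of_integrable ?_ ?_ ?_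
    (fun x _ => ha.differentiable (by simp) x) (fun x _ => hb.differentiable (by simp) x)
  · exact ((contDiff_pd ha v).continuous.mul hb.continuous).integrable_of_hasCompactSupport
      (hasCompactSupport_pd ha' v).mul_right
  · exact (ha.continuous.mul (contDiff_pd hb v).continuous).integrable_of_hasCompactSupport
      ha'.mul_right
  · exact (ha.continuous.mul hb.continuous).integrable_of_hasCompactSupport ha'.mul_right

/-- Two integrations by parts and the symmetry of second derivatives. This is what makes tr (Df)² -
(div f)² a null Lagrangian. -/
theorem integral_pd_mul_pd_comm {a b : E3 → ℝ} (ha : ContDiff ℝ ∞ a) (hb : ContDiff ℝ ∞ b)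
    (ha' : HasCompactSupport a) (v w : E3) :
    ∫ x, pd v a x * pd w b x = ∫ x, pd w a x * pd v b x := by
  have h1 := integral_mul_pd ha (contDiff_pd hb w) ha' v
  have h2 := integral_mul_pd ha (contDiff_pd hb v) ha' w
  simp only [pd_pd_comm hb v w] at h1
  exact neg_injective (h1.symm.trans h2)

/-- The divergence as a continuous linear functional of the derivative. -/
def divL : (E3 →L[ℝ] E3) →L[ℝ] ℝ :=
  LinearMap.toContinuousLinearMap
    { toFun := divOf
      map_add' := fun A B => by simp [divOf, jacobian, Matrix.trace, Finset.sum_add_distrib]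
      map_smul' := fun c A => by simp [divOf, jacobian, Matrix.trace, Finset.mul_sum] }

/-- The curl as a continuous linear function of the derivative. -/
def curlL : (E3 →L[ℝ] E3) →L[ℝ] E3 :=
  LinearMap.toContinuousLinearMap
    { toFun := curlOf
      map_add' := fun A B => by
        ext i; fin_cases i <;> simp [curlOf, jacobian] <;> ring
      map_smul' := fun c A => by
        ext i; fin_cases i <;> simp [curlOf, jacobian] <;> ring }

@[simp] theorem divL_apply (A : E3 →L[ℝ] E3) : divL A = divOf A := rfl
@[simp] theorem curlL_apply (A : E3 →L[ℝ] E3) : curlL A = curlOf A := rfl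

@[simp] theorem divOf_zero : divOf 0 = 0 := map_zero divL
@[simp] theorem curlOf_zero : curlOf 0 = 0 := map_zero curlL

/-- The square of the Frobenius norm of a derivative. -/
def frobSq (A : E3 →L[ℝ] E3) : ℝ := ∑ i, ∑ j, jacobian A i j ^ 2

theorem continuous_frobSq : Continuous frobSq := by
  refine continuous_finsetSum _ fun i _ => continuous_finsetSum _ fun j _ => ?_
  exact (((EuclideanSpace.proj (𝕜 := ℝ) i : E3 →L[ℝ] ℝ).continuous.comp
    (ContinuousLinearMap.apply ℝ E3 (basisVec j)).continuous)).pow 2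

theorem frobSq_zero : frobSq 0 = 0 := by simp [frobSq, jacobian]

theorem frobSq_nonneg (A : E3 →L[ℝ] E3) : 0 ≤ frobSq A :=
  Finset.sum_nonneg fun _ _ => Finset.sum_nonneg fun _ _ => sq_nonneg _

theorem norm_sq_le_frobSq (A : E3 →L[ℝ] E3) : ‖A‖ ^ 2 ≤ frobSq A := by
  have h0 := frobSq_nonneg A
  have : ‖A‖ ≤ √(frobSq A) := by
    refine A.opNorm_le_bound (Real.sqrt_nonneg _) fun v => ?_
    have hv := clm_apply_eq_sum A v
    have hAi : ∀ i, (A v) i = ∑ j, jacobian A i j * v j := fun i => by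
      rw [hv]; simp [jacobian, Fin.sum_univ_three, mul_comm]
    rw [EuclideanSpace.norm_eq, EuclideanSpace.norm_eq, ← Real.sqrt_mul h0]
    refine Real.sqrt_le_sqrt ?_
    rw [frobSq, Finset.sum_mul]
    refine Finset.sum_le_sum fun i _ => ?_
    simp only [Real.norm_eq_abs, sq_abs]
    rw [hAi]
    exact Finset.sum_mul_sq_le_sq_mul_sq _ _ _
  calc ‖A‖ ^ 2 ≤ √(frobSq A) ^ 2 := by gcongr
    _ = frobSq A := Real.sq_sqrt h0

/-- Expanding |curl|² gives the squares of the off-diagonal entries minus twice their mirrored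
products. The identity underlies both the coercivity of the energy and the div-curl estimate. -/
theorem frobSq_eq (A : E3 →L[ℝ] E3) :
    frobSq A = (jacobian A * jacobian A).trace + ‖curlOf A‖ ^ 2 := by
  rw [EuclideanSpace.norm_sq_eq]
  simp [frobSq, curlOf, Matrix.trace, Matrix.mul_apply, Fin.sum_univ_three]
  ring

theorem jacobian_fderiv {f : E3 → E3} {x : E3} (hf : DifferentiableAt ℝ f x) (i j : Fin 3) :
    jacobian (fderiv ℝ f x) i j = pd (basisVec j) (fun y => f y i) x := by
  have h := ((EuclideanSpace.proj (𝕜 := ℝ) i : E3 →L[ℝ] ℝ).hasFDerivAt.comp x hf.hasFDerivAt).fderiv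
  change _ = fderiv ℝ ((EuclideanSpace.proj (𝕜 := ℝ) i : E3 →L[ℝ] ℝ) ∘ f) x _
  rw [h]; rfl

theorem contDiff_coord {f : E3 → E3} (hf : ContDiff ℝ ∞ f) (i : Fin 3) :
    ContDiff ℝ ∞ fun y => f y i :=
  (EuclideanSpace.proj (𝕜 := ℝ) i : E3 →L[ℝ] ℝ).contDiff.comp hf

theorem integrable_curl_sq_add_div_sq {f : E3 → E3} (hf : ContDiff ℝ ∞ f)
    (hc : HasCompactSupport f) :
    Integrable fun x => ‖curlOf (fderiv ℝ f x)‖ ^ 2 + divOf (fderiv ℝ f x) ^ 2 := by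
  have hcont : Continuous (fderiv ℝ f) := hf.continuous_fderiv (by simp)
  refine Continuous.integrable_of_hasCompactSupport
    (((curlL.continuous.comp hcont).norm.pow 2).add ((divL.continuous.comp hcont).pow 2)) ?_
  exact (hc.fderiv ℝ).comp_left (g := fun A => ‖curlOf A‖ ^ 2 + divOf A ^ 2) (by simp)

/-- By `frobSq_eq` the two integrands differ by the null Lagrangian tr (Df)² - (div f)², which
integrates to zero over a field of compact support. -/
theorem integral_frobSq {f : E3 → E3} (hf : ContDiff ℝ ∞ f) (hc : HasCompactSupport f) :
    ∫ x, frobSq (fderiv ℝ f x) = ∫ x, (‖curlOf (fderiv ℝ f x)‖ ^ 2 + divOf (fderiv ℝ f x) ^ 2) := by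
  have hci : ∀ i : Fin 3, HasCompactSupport fun y => f y i := fun i =>
    hc.comp_left (g := fun v : E3 => v i) rfl
  have hs := contDiff_coord hf
  have hint : ∀ i j k l : Fin 3, Integrable fun x =>
      pd (basisVec j) (fun y => f y i) x * pd (basisVec l) (fun y => f y k) x := fun i j k l =>
    ((contDiff_pd (hs i) _).continuous.mul
      (contDiff_pd (hs k) _).continuous).integrable_of_hasCompactSupport
      (hasCompactSupport_pd (hci i) _).mul_right
  have i1 := integrable_curl_sq_add_div_sq hf hc
  have key : ∀ x, frobSq (fderiv ℝ f x) =
      (‖curlOf (fderiv ℝ f x)‖ ^ 2 + divOf (fderiv ℝ f x) ^ 2) +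
      ∑ i, ∑ j, (pd (basisVec j) (fun y => f y i) x * pd (basisVec i) (fun y => f y j) x -
        pd (basisVec i) (fun y => f y i) x * pd (basisVec j) (fun y => f y j) x) := fun x => by
    have hd : DifferentiableAt ℝ f x := hf.differentiable (by simp) x
    rw [frobSq_eq]
    simp only [← jacobian_fderiv hd, divOf, Matrix.trace, Matrix.mul_apply, Fin.sum_univ_three,
      Matrix.diag]
    ring
  have i2 : ∀ i j : Fin 3, Integrable fun x =>
      pd (basisVec j) (fun y => f y i) x * pd (basisVec i) (fun y => f y j) x -
        pd (basisVec i) (fun y => f y i) x * pd (basisVec j) (fun y => f y j) x := fun i j =>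
    (hint _ _ _ _).sub (hint _ _ _ _)
  simp only [key]
  rw [integral_add i1 (integrable_finsetSum _ fun i _ => integrable_finsetSum _ fun j _ =>
    i2 i j), integral_finsetSum _ fun i _ => integrable_finsetSum _ fun j _ => i2 i j]
  rw [add_eq_left]
  refine Finset.sum_eq_zero fun i _ => ?_
  rw [integral_finsetSum _ fun j _ => i2 i j]
  refine Finset.sum_eq_zero fun j _ => ?_
  rw [integral_sub (hint _ _ _ _) (hint _ _ _ _), sub_eq_zero]
  exact integral_pd_mul_pd_comm (hs i) (hs j) (hci i) _ _

theorem lintegral_enorm_fderiv_sq_le {f : E3 → E3} (hf : ContDiff ℝ ∞ f)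
    (hc : HasCompactSupport f) :
    ∫⁻ x, ‖fderiv ℝ f x‖ₑ ^ 2 ≤ ENNReal.ofReal (∫ x, frobSq (fderiv ℝ f x)) := by
  have hi : Integrable fun x => frobSq (fderiv ℝ f x) :=
    (continuous_frobSq.comp (hf.continuous_fderiv (by simp))).integrable_of_hasCompactSupport
      ((hc.fderiv ℝ).comp_left frobSq_zero)
  rw [ofReal_integral_eq_lintegral_ofReal hi (ae_of_all _ fun x => frobSq_nonneg _)]
  refine lintegral_mono fun x => ?_
  rw [← ofReal_norm, ← ENNReal.ofReal_pow (norm_nonneg _)]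
  exact ENNReal.ofReal_le_ofReal (norm_sq_le_frobSq _)

theorem ofReal_integral_norm_sq_add_sq {X E : Type*} [MeasurableSpace X] [NormedAddCommGroup E]
    {μ : Measure X} {g : X → E} {h : X → ℝ} (hg : AEStronglyMeasurable g μ)
    (hi : Integrable (fun x => ‖g x‖ ^ 2 + h x ^ 2) μ) :
    ENNReal.ofReal (∫ x, (‖g x‖ ^ 2 + h x ^ 2) ∂μ) = eLpNorm g 2 μ ^ 2 + eLpNorm h 2 μ ^ 2 := by
  rw [eLpNorm_two_sq, eLpNorm_two_sq, ← lintegral_add_left' (hg.enorm.pow_const 2),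
    ofReal_integral_eq_lintegral_ofReal hi (ae_of_all _ fun x => by positivity)]
  refine lintegral_congr fun x => ?_
  rw [ENNReal.ofReal_add (by positivity) (by positivity), ENNReal.ofReal_pow (norm_nonneg _),
    ofReal_norm, ← ofReal_norm (h x), ← ENNReal.ofReal_pow (norm_nonneg (h x)),
    Real.norm_eq_abs, sq_abs]

theorem eLpNorm_fderiv_le {f : E3 → E3} (hf : ContDiff ℝ ∞ f) (hc : HasCompactSupport f) :
    eLpNorm (fderiv ℝ f) 2 ≤ eLpNorm (fun x => curlOf (fderiv ℝ f x)) 2 +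
      eLpNorm (fun x => divOf (fderiv ℝ f x)) 2 := by
  have c1 : Continuous fun x => curlOf (fderiv ℝ f x) :=
    curlL.continuous.comp (hf.continuous_fderiv (by simp))
  have hi := integrable_curl_sq_add_div_sq hf hc
  have h1 := lintegral_enorm_fderiv_sq_le hf hc
  rw [← eLpNorm_two_sq, integral_frobSq hf hc,
    ofReal_integral_norm_sq_add_sq c1.aestronglyMeasurable hi] at h1
  refine (ENNReal.pow_le_pow_left_iff two_ne_zero).1 (h1.trans ?_)
  generalize eLpNorm (fun x => curlOf (fderiv ℝ f x)) 2 volume = a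
  generalize eLpNorm (fun x => divOf (fderiv ℝ f x)) 2 volume = b
  rw [add_sq]
  exact add_le_add_left (le_add_of_nonneg_right zero_le) _

/-- Interior estimate of the gradient by divergence and curl. -/
theorem exists_div_curl_estimate {Ω : Set E3} (hΩ : IsOpen Ω) (hfc : IsCompact (frontier Ω))
    {α : ℝ≥0} (hb : HasC2HolderBoundary α Ω) {η : E3 → ℝ} (hη : ContDiff ℝ ∞ η)
    (hηc : HasCompactSupport η) (hηΩ : tsupport η ⊆ Ω) :
    ∃ C : ℝ≥0, ∀ w : E3 → E3, MemH1 Ω w →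
      eLpNorm (fun x => η x • weakGrad Ω w x) 2 (volume.restrict Ω) ≤
        C * (eLpNorm (fun x => curlOf (weakGrad Ω w x)) 2 (volume.restrict Ω) +
          eLpNorm (fun x => divOf (weakGrad Ω w x)) 2 (volume.restrict Ω) +
          eLpNorm w 2 (volume.restrict Ω)) := by
  obtain ⟨a, ha⟩ := hηc.exists_bound_of_continuous hη.continuous
  obtain ⟨b, hb'⟩ := (hηc.fderiv ℝ).exists_bound_of_continuous (hη.continuous_fderiv (by simp))
  have ha0 : 0 ≤ a := (norm_nonneg _).trans (ha 0)
  have hb0 : 0 ≤ b := (norm_nonneg _).trans (hb' 0)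
  lift a to ℝ≥0 using ha0
  lift b to ℝ≥0 using hb0
  set c : ℝ≥0 := ‖curlL‖₊
  set d : ℝ≥0 := ‖divL‖₊
  set μ := (volume : Measure E3).restrict Ω with hμ
  -- The constant `a` bounds η. The three multiples of `b`, the bound for ∇η, come from the
  -- product-rule term ∇η ⊗ φ: in the curl, in the divergence, and when it is subtracted from the
  -- gradient of ηφ.
  set C : ℝ≥0 := a + (c * b + d * b + b) with hC
  have hdη : ∀ x ∉ Ω, fderiv ℝ η x = 0 := fun x hx =>
    image_eq_zero_of_notMem_tsupport fun h => hx (hηΩ (tsupport_fderiv_subset ℝ h))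
  have smooth : ∀ φ : E3 → E3, ContDiff ℝ ∞ φ →
      eLpNorm (fun x => η x • fderiv ℝ φ x) 2 μ ≤
        C * (eLpNorm (fun x => curlOf (fderiv ℝ φ x)) 2 μ +
          eLpNorm (fun x => divOf (fderiv ℝ φ x)) 2 μ + eLpNorm φ 2 μ) := fun φ hφ => by
    have hφ' : Continuous (fderiv ℝ φ) := hφ.continuous_fderiv (by simp)
    have hη' : Continuous (fderiv ℝ η) := hη.continuous_fderiv (by simp)
    set f : E3 → E3 := fun x => η x • φ x with hf
    set S : E3 → E3 →L[ℝ] E3 := fun x => (fderiv ℝ η x).smulRight (φ x) with hS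
    have hSn : ∀ x, ‖S x‖ ≤ b * ‖φ x‖ := fun x => by
      rw [hS, ContinuousLinearMap.norm_smulRight_apply]
      gcongr; exact hb' x
    have hfs : ContDiff ℝ ∞ f := hη.smul hφ
    have hfcs : HasCompactSupport f := hηc.smul_right
    have hSc : Continuous S :=
      (ContinuousLinearMap.smulRightL ℝ E3 E3).continuous₂.comp₂ hη' hφ.continuous
    have hfd : ∀ x, fderiv ℝ f x = η x • fderiv ℝ φ x + S x := fun x =>
      fderiv_fun_smul (hη.differentiable (by simp) x) (hφ.differentiable (by simp) x)
    have hfd0 : ∀ x ∉ Ω, fderiv ℝ f x = 0 := fun x hx => by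
      rw [hfd, hS]
      simp only [hdη x hx, image_eq_zero_of_notMem_tsupport fun h => hx (hηΩ h)]
      ext; simp
    have restr : ∀ {E : Type} [NormedAddCommGroup E] (g : (E3 →L[ℝ] E3) → E), g 0 = 0 →
        eLpNorm (fun x => g (fderiv ℝ f x)) 2 volume = eLpNorm (fun x => g (fderiv ℝ f x)) 2 μ := by
      intro E _ g hg
      rw [hμ, ← eLpNorm_indicator_eq_eLpNorm_restrict hΩ.measurableSet]
      congr 1
      ext1 x
      by_cases hx : x ∈ Ω
      · simp [hx]
      · simp [hx, hfd0 x hx, hg]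
    have main := eLpNorm_fderiv_le hfs hfcs
    rw [restr curlOf curlOf_zero, restr divOf divOf_zero,
      show fderiv ℝ f = fun x => id (fderiv ℝ f x) from rfl, restr id rfl] at main
    simp only [id] at main
    have n1 : eLpNorm (fun x => curlOf (fderiv ℝ f x)) 2 μ ≤
        a * eLpNorm (fun x => curlOf (fderiv ℝ φ x)) 2 μ + (c * b : ℝ≥0) * eLpNorm φ 2 μ := by
      have e : (fun x => curlOf (fderiv ℝ f x)) =
          (fun x => η x • curlOf (fderiv ℝ φ x)) + fun x => curlOf (S x) := by
        ext1 x
        rw [hfd, ← curlL_apply, map_add, map_smul]; rfl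
      rw [e]
      refine (eLpNorm_add_le
        (hη.continuous.smul (curlL.continuous.comp hφ')).aestronglyMeasurable
        (curlL.continuous.comp hSc).aestronglyMeasurable (by norm_num)).trans (add_le_add ?_ ?_)
      · refine eLpNorm_le_mul_of_norm_le (ae_of_all _ fun x => ?_) 2
        change ‖η x • curlOf (fderiv ℝ φ x)‖ ≤ _
        rw [norm_smul]; gcongr; exact ha x
      · refine eLpNorm_le_mul_of_norm_le (ae_of_all _ fun x => ?_) 2
        refine (curlL.le_opNorm (S x)).trans ?_
        push_cast
        rw [mul_assoc]
        exact mul_le_mul_of_nonneg_left (hSn x) (norm_nonneg _)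
    have n2 : eLpNorm (fun x => divOf (fderiv ℝ f x)) 2 μ ≤
        a * eLpNorm (fun x => divOf (fderiv ℝ φ x)) 2 μ + (d * b : ℝ≥0) * eLpNorm φ 2 μ := by
      have e : (fun x => divOf (fderiv ℝ f x)) =
          (fun x => η x • divOf (fderiv ℝ φ x)) + fun x => divOf (S x) := by
        ext1 x
        rw [hfd, ← divL_apply, map_add, map_smul]; rfl
      rw [e]
      refine (eLpNorm_add_le
        (hη.continuous.smul (divL.continuous.comp hφ')).aestronglyMeasurable
        (divL.continuous.comp hSc).aestronglyMeasurable (by norm_num)).trans (add_le_add ?_ ?_)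
      · refine eLpNorm_le_mul_of_norm_le (ae_of_all _ fun x => ?_) 2
        change ‖η x • divOf (fderiv ℝ φ x)‖ ≤ _
        rw [norm_smul]; gcongr; exact ha x
      · refine eLpNorm_le_mul_of_norm_le (ae_of_all _ fun x => ?_) 2
        refine (divL.le_opNorm (S x)).trans ?_
        push_cast
        rw [mul_assoc]
        exact mul_le_mul_of_nonneg_left (hSn x) (norm_nonneg _)
    have n3 : eLpNorm S 2 μ ≤ b * eLpNorm φ 2 μ :=
      eLpNorm_le_mul_of_norm_le (ae_of_all _ hSn) 2
    have e : (fun x => η x • fderiv ℝ φ x) = (fun x => fderiv ℝ f x) - S := by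
      ext1 x; rw [Pi.sub_apply, hfd]; simp
    rw [e]
    refine (eLpNorm_sub_le (hfs.continuous_fderiv (by simp)).aestronglyMeasurable
      hSc.aestronglyMeasurable (by norm_num)).trans ?_
    refine (add_le_add (main.trans (add_le_add n1 n2)) n3).trans ?_
    generalize eLpNorm (fun x => curlOf (fderiv ℝ φ x)) 2 μ = x
    generalize eLpNorm (fun x => divOf (fderiv ℝ φ x)) 2 μ = y
    generalize eLpNorm φ 2 μ = z
    rw [hC]
    push_cast
    calc _ = (a : ℝ≥0∞) * x + a * y + (c * b + d * b + b) * z := by ring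
      _ ≤ (a + (c * b + d * b + b)) * x + (a + (c * b + d * b + b)) * y +
          (a + (c * b + d * b + b)) * z := by
        exact add_le_add (add_le_add (mul_le_mul' (le_add_of_nonneg_right zero_le) le_rfl)
          (mul_le_mul' (le_add_of_nonneg_right zero_le) le_rfl))
          (mul_le_mul' (le_add_of_nonneg_left zero_le) le_rfl)
      _ = _ := by ring
  -- Every term of the smooth estimate is continuous for H¹ convergence, so density extends the
  -- estimate to all of H¹.
  refine ⟨C, fun w hw => ?_⟩
  obtain ⟨φ, h1, h2, h3⟩ := hw.exists_smooth_tendsto hΩ hfc hb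
  set G := weakGrad Ω w
  have hG : MemLp G 2 μ := hw.memLp_weakGrad hΩ
  have m3 : ∀ k, AEStronglyMeasurable (fderiv ℝ (φ k)) μ := fun k =>
    ((h1 k).continuous_fderiv (by simp)).aestronglyMeasurable
  have lim : ∀ {E : Type} [NormedAddCommGroup E] [NormedSpace ℝ E]
      (L : (E3 →L[ℝ] E3) →L[ℝ] E),
      Tendsto (fun k => eLpNorm (fun x => L (fderiv ℝ (φ k) x)) 2 μ) atTop
        (𝓝 (eLpNorm (fun x => L (G x)) 2 μ)) := by
    intro E _ _ L
    refine tendsto_eLpNorm_of_tendsto_sub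
      (fun k => L.continuous.comp_aestronglyMeasurable (m3 k)) (L.comp_memLp' hG) ?_
    refine tendsto_of_tendsto_of_tendsto_of_le_of_le tendsto_const_nhds
      (h := fun k => (‖L‖₊ : ℝ≥0∞) * eLpNorm (fderiv ℝ (φ k) - G) 2 μ) ?_ (fun _ => zero_le)
      fun k => ?_
    · simpa using ENNReal.Tendsto.const_mul h3 (Or.inr (ENNReal.coe_ne_top (r := ‖L‖₊)))
    · refine eLpNorm_le_mul_of_norm_le (ae_of_all _ fun x => ?_) 2
      rw [Pi.sub_apply, ← map_sub]
      exact L.le_opNorm _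
  have l4 : Tendsto (fun k => eLpNorm (fun x => η x • fderiv ℝ (φ k) x) 2 μ) atTop
        (𝓝 (eLpNorm (fun x => η x • G x) 2 μ)) := by
    have hηm : AEStronglyMeasurable η μ := hη.continuous.aestronglyMeasurable
    refine tendsto_eLpNorm_of_tendsto_sub (fun k => hηm.smul (m3 k))
      ⟨hηm.smul hG.1, ?_⟩ ?_
    · refine (eLpNorm_le_mul_of_norm_le (C := a) (g := G) (ae_of_all _ fun x => ?_) 2).trans_lt
        (ENNReal.mul_lt_top ENNReal.coe_lt_top hG.2)
      rw [norm_smul]; gcongr; exact ha x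
    refine tendsto_of_tendsto_of_tendsto_of_le_of_le tendsto_const_nhds
      (h := fun k => (a : ℝ≥0∞) * eLpNorm (fderiv ℝ (φ k) - G) 2 μ) ?_ (fun _ => zero_le)
      fun k => ?_
    · simpa using ENNReal.Tendsto.const_mul h3 (Or.inr (ENNReal.coe_ne_top (r := a)))
    · refine eLpNorm_le_mul_of_norm_le (ae_of_all _ fun x => ?_) 2
      calc _ = ‖η x • (fderiv ℝ (φ k) x - G x)‖ := by rw [smul_sub]; rfl
        _ = ‖η x‖ * ‖(fderiv ℝ (φ k) - G) x‖ := norm_smul _ _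
        _ ≤ _ := by gcongr; exact ha x
  have lw := tendsto_eLpNorm_of_tendsto_sub
    (fun k => (h1 k).continuous.aestronglyMeasurable) hw.1 h2
  exact le_of_tendsto_of_tendsto' l4 (ENNReal.Tendsto.const_mul
    (((lim curlL).add (lim divL)).add lw) (Or.inr ENNReal.coe_ne_top)) fun k => smooth _ (h1 k)

end DivCurl

/-! ### Weak compactness in `L²` -/

section WeakCompactness

/-- Sequential Banach–Alaoglu in the dual of a separable space, carried back by the Riesz
isomorphism. -/
theorem exists_weak_subseq_hilbert {H : Type*} [NormedAddCommGroup H] [InnerProductSpace ℝ H]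
    [CompleteSpace H] [TopologicalSpace.SeparableSpace H] (x : ℕ → H) {B : ℝ}
    (hB : ∀ k, ‖x k‖ ≤ B) : ∃ (y : H) (σ : ℕ → ℕ), StrictMono σ ∧
      ∀ h, Tendsto (fun k => inner ℝ (x (σ k)) h) atTop (𝓝 (inner ℝ y h)) := by
  obtain ⟨z, -, σ, hσ, hz⟩ := WeakDual.isSeqCompact_closedBall ℝ H (0 : StrongDual ℝ H) B
    (x := fun k => StrongDual.toWeakDual (InnerProductSpace.toDual ℝ H (x k))) (fun k => by
      simpa using hB k)
  refine ⟨(InnerProductSpace.toDual ℝ H).symm (WeakDual.toStrongDual z), σ, hσ, fun h => ?_⟩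
  rw [InnerProductSpace.toDual_symm_apply]
  exact tendsto_iff_forall_eval_tendsto_topDualPairing.1 hz h

variable {X : Type*} [MeasurableSpace X] {μ : Measure X}
  {E : Type*} [NormedAddCommGroup E] [NormedSpace ℝ E]

/-- Weak convergence in `L²`, tested with products of scalar functions and linear functionals. -/
def WeakTendsto (μ : Measure X) (f : ℕ → X → E) (g : X → E) : Prop :=
  ∀ (L : E →L[ℝ] ℝ) (h : X → ℝ), MemLp h 2 μ →
    Tendsto (fun k => ∫ x, h x * L (f k x) ∂μ) atTop (𝓝 (∫ x, h x * L (g x) ∂μ))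

theorem WeakTendsto.comp {f : ℕ → X → E} {g : X → E} (h : WeakTendsto μ f g) {σ : ℕ → ℕ}
    (hσ : StrictMono σ) : WeakTendsto μ (fun k => f (σ k)) g := fun L w hw =>
  (h L w hw).comp hσ.tendsto_atTop

/-- The operator norm on matrices is not Hilbertian, so the values are transported to a Euclidean
space of the same dimension. Countable generation of the σ-algebra makes L² separable. -/
theorem exists_weakTendsto_subseq [FiniteDimensional ℝ E] [IsFiniteMeasure μ]
    [MeasurableSpace.CountablyGenerated X] {f : ℕ → X → E} (hf : ∀ k, MemLp (f k) 2 μ) {B : ℝ≥0}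
    (hB : ∀ k, eLpNorm (f k) 2 μ ≤ B) : ∃ (g : X → E) (σ : ℕ → ℕ), StrictMono σ ∧ MemLp g 2 μ ∧
      WeakTendsto μ (fun k => f (σ k)) g := by
  have : Fact ((2 : ℝ≥0∞) ≠ ⊤) := ⟨by simp⟩
  let T := toEuclidean (E := E)
  let T' : E →L[ℝ] EuclideanSpace ℝ (Fin (Module.finrank ℝ E)) := T
  have hT : ∀ k, MemLp (fun x => T (f k x)) 2 μ := fun k =>
    T'.comp_memLp' (hf k)
  obtain ⟨y, σ, hσ, hy⟩ := exists_weak_subseq_hilbert (fun k => (hT k).toLp _)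
    (B := ‖T'‖₊ * B) (fun k => by
      rw [Lp.norm_toLp]
      refine ENNReal.toReal_le_of_le_ofReal (by positivity) ?_
      rw [ENNReal.ofReal_mul (by positivity), ENNReal.ofReal_coe_nnreal, ENNReal.ofReal_coe_nnreal]
      refine (eLpNorm_le_mul_of_norm_le (f := fun x => T (f k x)) (g := f k) (C := ‖T'‖₊)
        (ae_of_all _ fun x => T'.le_opNorm (f k x)) 2).trans ?_
      gcongr
      exact hB k)
  let S : EuclideanSpace ℝ (Fin (Module.finrank ℝ E)) →L[ℝ] E := T.symm
  refine ⟨fun x => T.symm (y x), σ, hσ, S.comp_memLp' (Lp.memLp y), ?_⟩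
  intro L h hh
  let w := (InnerProductSpace.toDual ℝ (EuclideanSpace ℝ (Fin (Module.finrank ℝ E)))).symm
    (L.comp S)
  have hw : ∀ v, inner ℝ v w = L (T.symm v) := fun v => by
    rw [real_inner_comm, InnerProductSpace.toDual_symm_apply]; rfl
  have hhw : MemLp (fun x => h x • w) 2 μ := by
    refine MemLp.of_le_mul (c := ‖w‖) hh (hh.1.smul_const w) (ae_of_all _ fun x => ?_)
    rw [norm_smul, mul_comm]
  have := hy (hhw.toLp _)
  have e : ∀ z : Lp (EuclideanSpace ℝ (Fin (Module.finrank ℝ E))) 2 μ,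
      inner ℝ z (hhw.toLp _) = ∫ x, h x * L (T.symm (z x)) ∂μ := fun z => by
    rw [L2.inner_def]
    refine integral_congr_ae (hhw.coeFn_toLp.mono fun x hx => ?_)
    simp only [hx]
    rw [inner_smul_right, hw]
  simp only [e] at this
  refine this.congr fun k => integral_congr_ae ((hT (σ k)).coeFn_toLp.mono fun x hx => ?_)
  simp only [hx]
  simp

theorem MemLp.integrable_mul_clm {g : X → E} {h : X → ℝ} (hh : MemLp h 2 μ) (hg : MemLp g 2 μ)
    (L : E →L[ℝ] ℝ) : Integrable (fun x => h x * L (g x)) μ :=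
  hh.integrable_mul (L.comp_memLp' hg)

/-- Testing each component against the limit component itself: ∫ gᵢ² is the limit of ∫ gᵢ (f_k)ᵢ,
which is zero by Cauchy–Schwarz. -/
theorem WeakTendsto.ae_eq_zero {f : ℕ → X → E3} {g : X → E3} (h : WeakTendsto μ f g)
    (hf : ∀ k, MemLp (f k) 2 μ) (hg : MemLp g 2 μ)
    (h0 : Tendsto (fun k => eLpNorm (f k) 2 μ) atTop (𝓝 0)) : g =ᵐ[μ] 0 := by
  have key : ∀ i : Fin 3, ∀ᵐ x ∂μ, g x i = 0 := fun i => by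
    let L : E3 →L[ℝ] ℝ := EuclideanSpace.proj i
    have hL : MemLp (fun x => L (g x)) 2 μ := L.comp_memLp' hg
    have h1 := h L _ hL
    have h2 : Tendsto (fun k => ∫ x, L (g x) * L (f k x) ∂μ) atTop (𝓝 0) := by
      rw [tendsto_zero_iff_norm_tendsto_zero]
      have h3 : Tendsto (fun k => (eLpNorm (fun x => L (g x)) 2 μ *
          (‖L‖₊ * eLpNorm (f k) 2 μ)).toReal) atTop (𝓝 0) := by
        have := ENNReal.Tendsto.const_mul (ENNReal.Tendsto.const_mul h0
          (Or.inr (ENNReal.coe_ne_top (r := ‖L‖₊)))) (Or.inr hL.2.ne)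
        rw [mul_zero, mul_zero] at this
        exact (ENNReal.tendsto_toReal ENNReal.zero_ne_top).comp this
      refine squeeze_zero (fun _ => norm_nonneg _) (fun k => ?_) h3
      rw [← toReal_enorm]
      refine ENNReal.toReal_mono (ENNReal.mul_ne_top hL.2.ne
        (ENNReal.mul_ne_top ENNReal.coe_ne_top (hf k).2.ne)) ?_
      refine (enorm_integral_le_lintegral_enorm _).trans ?_
      simp only [enorm_mul]
      refine (lintegral_enorm_mul_le hL.1 (L.comp_memLp' (hf k)).1).trans ?_
      gcongr
      exact eLpNorm_le_mul_of_norm_le (ae_of_all _ fun x => L.le_opNorm _) 2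
    have h4 := tendsto_nhds_unique h1 h2
    rw [integral_eq_zero_iff_of_nonneg (fun x => mul_self_nonneg _)
      (hL.integrable_mul hL)] at h4
    exact h4.mono fun x hx => mul_self_eq_zero.1 hx
  filter_upwards [ae_all_iff.2 key] with x hx
  ext i
  exact hx i

/-- A test function and its derivative are themselves L² weights, so both sides of the weak gradient
identity pass to the limit. -/
theorem HasWeakGrad.of_weakTendsto {Ω : Set E3} (hV : volume Ω < ⊤)
    {f : ℕ → E3 → E3} {G : ℕ → E3 → E3 →L[ℝ] E3} {f₀ : E3 → E3} {G₀ : E3 → E3 →L[ℝ] E3}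
    (h : ∀ k, HasWeakGrad Ω (f k) (G k)) (hf : ∀ k, MemLp (f k) 2 (volume.restrict Ω))
    (hG : ∀ k, MemLp (G k) 2 (volume.restrict Ω))
    (hf₀ : MemLp f₀ 2 (volume.restrict Ω)) (hG₀ : MemLp G₀ 2 (volume.restrict Ω))
    (tf : WeakTendsto (volume.restrict Ω) f f₀) (tG : WeakTendsto (volume.restrict Ω) G G₀) :
    HasWeakGrad Ω f₀ G₀ := by
  have : IsFiniteMeasure ((volume : Measure E3).restrict Ω) := ⟨by simpa using hV⟩
  have i1 : ∀ {u : E3 → E3}, MemLp u 2 (volume.restrict Ω) → IntegrableOn u Ω := fun h =>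
    h.integrable (by norm_num)
  have i2 : ∀ {u : E3 → E3 →L[ℝ] E3}, MemLp u 2 (volume.restrict Ω) → IntegrableOn u Ω :=
    fun h => h.integrable (by norm_num)
  refine ⟨(i1 hf₀).locallyIntegrableOn, (i2 hG₀).locallyIntegrableOn, fun φ h1 h2 h3 v => ?_⟩
  have m1 : MemLp φ 2 (volume.restrict Ω) :=
    (h1.continuous.memLp_of_hasCompactSupport h2).restrict Ω
  have m2 : MemLp (fun x => fderiv ℝ φ x v) 2 (volume.restrict Ω) :=
    ((contDiff_pd h1 v).continuous.memLp_of_hasCompactSupport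
      (hasCompactSupport_pd h2 v)).restrict Ω
  have s1 : ∀ {u : E3 → E3}, MemLp u 2 (volume.restrict Ω) →
      IntegrableOn (fun x => fderiv ℝ φ x v • u x) Ω := fun hu =>
    memLp_one_iff_integrable.1 (hu.smul m2)
  have s2 : ∀ {u : E3 → E3 →L[ℝ] E3}, MemLp u 2 (volume.restrict Ω) →
      IntegrableOn (fun x => φ x • u x v) Ω := fun hu =>
    memLp_one_iff_integrable.1 (((ContinuousLinearMap.apply ℝ E3 v).comp_memLp' hu).smul m1)
  refine PiLp.ext fun i => ?_
  let L : E3 →L[ℝ] ℝ := EuclideanSpace.proj i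
  change L (∫ x in Ω, fderiv ℝ φ x v • f₀ x) = L (- ∫ x in Ω, φ x • G₀ x v)
  have e1 : ∀ {u : E3 → E3}, MemLp u 2 (volume.restrict Ω) →
      L (∫ x in Ω, fderiv ℝ φ x v • u x) = ∫ x in Ω, fderiv ℝ φ x v * L (u x) := fun hu => by
    rw [← L.integral_comp_comm (s1 hu)]; simp only [map_smul, smul_eq_mul]
  have e2 : ∀ {u : E3 → E3 →L[ℝ] E3}, MemLp u 2 (volume.restrict Ω) →
      L (- ∫ x in Ω, φ x • u x v) =
        - ∫ x in Ω, φ x * (L.comp (ContinuousLinearMap.apply ℝ E3 v)) (u x) := fun hu => by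
    rw [map_neg, ← L.integral_comp_comm (s2 hu)]; simp only [map_smul, smul_eq_mul]; rfl
  rw [e1 hf₀, e2 hG₀]
  refine tendsto_nhds_unique (tf L _ m2) (((tG (L.comp (ContinuousLinearMap.apply ℝ E3 v)) _
    m1).neg).congr fun k => ?_)
  rw [← e1 (hf k), ← e2 (hG k), (h k).2.2 φ h1 h2 h3 v]

end WeakCompactness

/-! ### Local compactness of bounded sequences in H¹ -/

section Rellich

variable {Ω : Set E3}

/-- The difference is the integral of the derivative along the segment from x to x - y; Jensen and
Tonelli give the bound, since all these segments stay in Ω. -/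
theorem lintegral_translate_sub_sq_le_of_contDiff {F : Type*} [NormedAddCommGroup F]
    [NormedSpace ℝ F] [CompleteSpace F] (hΩ : IsOpen Ω) {φ : E3 → F} (hφ : ContDiff ℝ 1 φ)
    {D : Set E3} (hD : MeasurableSet D) {y : E3} {δ : ℝ} (hy : ‖y‖ ≤ δ)
    (hDΩ : ∀ x ∈ D, Metric.closedBall x δ ⊆ Ω) :
    ∫⁻ x in D, ‖φ (x - y) - φ x‖ₑ ^ 2 ≤ ‖y‖ₑ ^ 2 * ∫⁻ x in Ω, ‖fderiv ℝ φ x‖ₑ ^ 2 := by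
  have hc := hφ.continuous_fderiv one_ne_zero
  have pt : ∀ x, ‖φ (x - y) - φ x‖ₑ ^ 2 ≤
      ‖y‖ₑ ^ 2 * ∫⁻ t in Set.Ioc (0 : ℝ) 1, ‖fderiv ℝ φ (x - t • y)‖ₑ ^ 2 := fun x => by
    have hl : ∀ t : ℝ, HasDerivAt (fun t : ℝ => x - t • y) (-y) t := fun t => by
      simpa using! ((hasDerivAt_id t).smul_const y).const_sub x
    have hd : ∀ t : ℝ, HasDerivAt (fun t : ℝ => φ (x - t • y)) (fderiv ℝ φ (x - t • y) (-y)) t :=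
      fun t => ((hφ.differentiable one_ne_zero _).hasFDerivAt).comp_hasDerivAt t (hl t)
    have hcd : Continuous fun t : ℝ => fderiv ℝ φ (x - t • y) := hc.comp (by fun_prop)
    have hftc := intervalIntegral.integral_eq_sub_of_hasDerivAt (a := 0) (b := 1)
      (fun t _ => hd t) (Continuous.intervalIntegrable (by fun_prop) _ _)
    rw [one_smul, zero_smul, sub_zero, intervalIntegral.integral_of_le zero_le_one] at hftc
    rw [← hftc]
    have b1 : ‖∫ t in Set.Ioc (0 : ℝ) 1, fderiv ℝ φ (x - t • y) (-y)‖ₑ ≤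
        ‖y‖ₑ * ∫⁻ t in Set.Ioc (0 : ℝ) 1, 1 * ‖fderiv ℝ φ (x - t • y)‖ₑ := by
      refine (enorm_integral_le_lintegral_enorm _).trans ?_
      rw [← lintegral_const_mul' _ _ enorm_ne_top]
      refine lintegral_mono fun t => ?_
      rw [one_mul, mul_comm, ← enorm_neg y]
      exact ContinuousLinearMap.le_opENorm _ _
    refine (pow_le_pow_left₀ zero_le b1 2).trans ?_
    rw [mul_pow]
    gcongr
    refine (sq_lintegral_le measurable_const (by simp) hcd.enorm.measurable.aemeasurable).trans ?_
    simp
  have hm : Measurable fun p : E3 × ℝ => ‖fderiv ℝ φ (p.1 - p.2 • y)‖ₑ ^ 2 :=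
    ((hc.comp
      (by fun_prop : Continuous fun p : E3 × ℝ => p.1 - p.2 • y)).enorm.measurable).pow_const 2
  calc ∫⁻ x in D, ‖φ (x - y) - φ x‖ₑ ^ 2
      ≤ ∫⁻ x in D, ‖y‖ₑ ^ 2 * ∫⁻ t in Set.Ioc (0 : ℝ) 1, ‖fderiv ℝ φ (x - t • y)‖ₑ ^ 2 :=
        lintegral_mono pt
    _ = ‖y‖ₑ ^ 2 * ∫⁻ t in Set.Ioc (0 : ℝ) 1, ∫⁻ x in D, ‖fderiv ℝ φ (x - t • y)‖ₑ ^ 2 := by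
        rw [lintegral_const_mul' _ _ (by simp), lintegral_lintegral_swap hm.aemeasurable]
    _ ≤ ‖y‖ₑ ^ 2 * ∫⁻ _ in Set.Ioc (0 : ℝ) 1, ∫⁻ x in Ω, ‖fderiv ℝ φ x‖ₑ ^ 2 := by
        refine mul_le_mul' le_rfl ?_
        refine setLIntegral_mono measurable_const fun t ht => ?_
        rw [← lintegral_indicator hD, ← lintegral_indicator hΩ.measurableSet,
          ← lintegral_sub_right_eq_self (Ω.indicator fun x => ‖fderiv ℝ φ x‖ₑ ^ 2) (t • y)]
        refine lintegral_mono fun x => ?_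
        by_cases hx : x ∈ D
        · have : x - t • y ∈ Ω := hDΩ x hx (by
            rw [mem_closedBall_iff_norm, sub_sub_cancel_left, norm_neg, norm_smul,
              Real.norm_of_nonneg ht.1.le]
            nlinarith [norm_nonneg y, ht.2])
          rw [Set.indicator_of_mem hx, Set.indicator_of_mem this]
        · simp [hx]
    _ = _ := by simp

theorem MemH1.lintegral_translate_sub_sq_le {F : Type*} [NormedAddCommGroup F]
    [NormedSpace ℝ F] [CompleteSpace F] (hΩ : IsOpen Ω) (hfc : IsCompact (frontier Ω)) {α : ℝ≥0}
    (hb : HasC2HolderBoundary α Ω) {u : E3 → F} (hu : MemH1 Ω u)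
    {D : Set E3} (hD : MeasurableSet D) {y : E3} {δ : ℝ} (hy : ‖y‖ ≤ δ)
    (hDΩ : ∀ x ∈ D, Metric.closedBall x δ ⊆ Ω) :
    ∫⁻ x in D, ‖Ω.indicator u (x - y) - Ω.indicator u x‖ₑ ^ 2 ≤
      (‖y‖ₑ * eLpNorm (weakGrad Ω u) 2 (volume.restrict Ω)) ^ 2 := by
  obtain ⟨φ, h1, h2, h3⟩ := hu.exists_smooth_tendsto hΩ hfc hb
  set U := Ω.indicator u with hU
  have hUL : MemLp U 2 := memLp_indicator_of_restrict hΩ hu.1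
  have hDs : D ⊆ Ω := fun x hx => hDΩ x hx
    (Metric.mem_closedBall_self ((norm_nonneg y).trans hy))
  have mp : MeasurePreserving (fun x : E3 => x - y) := measurePreserving_sub_right volume y
  have hUy : MemLp (fun x => U (x - y)) 2 := hUL.comp_measurePreserving mp
  have m : ∀ k (ν : Measure E3), AEStronglyMeasurable (φ k) ν := fun k ν =>
    (h1 k).continuous.aestronglyMeasurable
  have m' : ∀ k (ν : Measure E3), AEStronglyMeasurable (fun x => φ k (x - y)) ν := fun k ν =>
    ((h1 k).continuous.comp (by fun_prop)).aestronglyMeasurable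
  have hmi : ∀ k, AEStronglyMeasurable (Ω.indicator (φ k - u)) volume := fun k =>
    (aestronglyMeasurable_indicator_iff hΩ.measurableSet).2 ((m k _).sub hu.1.1)
  have t1 : Tendsto (fun k => eLpNorm (fun x => φ k (x - y) - φ k x) 2 (volume.restrict D)) atTop
      (𝓝 (eLpNorm (fun x => U (x - y) - U x) 2 (volume.restrict D))) := by
    refine tendsto_eLpNorm_of_tendsto_sub (fun k => (m' k _).sub (m k _))
      ((hUy.sub hUL).restrict D) ?_
    refine tendsto_of_tendsto_of_tendsto_of_le_of_le tendsto_const_nhds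
      (by simpa using h2.add h2) (fun _ => zero_le) fun k => ?_
    have e : ((fun x => φ k (x - y) - φ k x) - fun x => U (x - y) - U x) =
        (fun x => φ k (x - y) - U (x - y)) - fun x => φ k x - U x := by
      ext x; simp only [Pi.sub_apply]; abel
    rw [e]
    refine (eLpNorm_sub_le ((m' k _).sub hUy.1.restrict) ((m k _).sub hUL.1.restrict)
      (by norm_num)).trans (add_le_add ?_ ?_)
    · calc eLpNorm (fun x => φ k (x - y) - U (x - y)) 2 (volume.restrict D)
          = eLpNorm (D.indicator fun x => φ k (x - y) - U (x - y)) 2 volume :=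
            (eLpNorm_indicator_eq_eLpNorm_restrict hD).symm
        _ ≤ eLpNorm (Ω.indicator (φ k - u) ∘ fun x => x - y) 2 volume := by
            refine eLpNorm_mono fun x => ?_
            by_cases hx : x ∈ D
            · have hxy : x - y ∈ Ω := hDΩ x hx (by
                rw [mem_closedBall_iff_norm, sub_sub_cancel_left, norm_neg]; exact hy)
              simp [hx, hxy, hU]
            · simp [hx]
        _ = eLpNorm (Ω.indicator (φ k - u)) 2 volume :=
            eLpNorm_comp_measurePreserving (hmi k) mp
        _ = eLpNorm (φ k - u) 2 (volume.restrict Ω) :=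
            eLpNorm_indicator_eq_eLpNorm_restrict hΩ.measurableSet
    · calc eLpNorm (fun x => φ k x - U x) 2 (volume.restrict D)
          = eLpNorm (φ k - u) 2 (volume.restrict D) := by
            refine eLpNorm_congr_ae (ae_restrict_of_forall_mem hD fun x hx => ?_)
            simp [hU, hDs hx]
        _ ≤ _ := eLpNorm_mono_measure _ (Measure.restrict_mono hDs le_rfl)
  have t2 := tendsto_eLpNorm_of_tendsto_sub (fun k =>
    ((h1 k).continuous_fderiv (by simp)).aestronglyMeasurable) (hu.memLp_weakGrad hΩ) h3
  have t3 := ENNReal.Tendsto.const_mul t2 (Or.inr (enorm_ne_top (x := y)))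
  rw [← eLpNorm_two_sq]
  refine pow_le_pow_left₀ zero_le (le_of_tendsto_of_tendsto' t1 t3 fun k => ?_) 2
  refine (ENNReal.pow_le_pow_left_iff two_ne_zero).1 ?_
  rw [mul_pow, eLpNorm_two_sq, eLpNorm_two_sq]
  exact lintegral_translate_sub_sq_le_of_contDiff hΩ ((h1 k).of_le (by simp)) hD hy hDΩ

theorem MemH1.eLpNorm_moll_sub_le {F : Type*} [NormedAddCommGroup F]
    [NormedSpace ℝ F] [CompleteSpace F] (hΩ : IsOpen Ω) (hfc : IsCompact (frontier Ω)) {α : ℝ≥0}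
    (hb : HasC2HolderBoundary α Ω) {u : E3 → F} (hu : MemH1 Ω u) {k : E3 → ℝ} (hk : IsMollifier k)
    {D : Set E3} (hD : MeasurableSet D) {δ : ℝ} (hks : tsupport k ⊆ Metric.closedBall 0 δ)
    (hDΩ : ∀ x ∈ D, Metric.closedBall x δ ⊆ Ω) :
    eLpNorm (moll k (Ω.indicator u) - Ω.indicator u) 2 (volume.restrict D) ≤
      ENNReal.ofReal δ * eLpNorm (weakGrad Ω u) 2 (volume.restrict Ω) := by
  refine (ENNReal.pow_le_pow_left_iff two_ne_zero).1 ?_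
  rw [eLpNorm_two_sq]
  refine lintegral_moll_sub_sq_le_of_forall hk (locallyIntegrable_indicator hΩ hu.1) D
    fun y hy => ?_
  have hyδ : ‖y‖ ≤ δ := by simpa using hks hy
  refine (hu.lintegral_translate_sub_sq_le hΩ hfc hb hD hyδ hDΩ).trans ?_
  gcongr
  rw [← ofReal_norm]
  exact ENNReal.ofReal_le_ofReal hyδ

theorem norm_moll_indicator_le (hΩ : IsOpen Ω) {k : E3 → ℝ} (hk : IsMollifier k)
    {F : Type*} [NormedAddCommGroup F] [NormedSpace ℝ F] {u : E3 → F}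
    (hu1 : ∀ᵐ x ∂(volume.restrict Ω), ‖u x‖ ≤ 1) (x : E3) : ‖moll k (Ω.indicator u) x‖ ≤ 1 := by
  rw [moll_apply_swap]
  have h1 : ∀ᵐ z, ‖k (x - z) • Ω.indicator u z‖ ≤ k (x - z) := by
    rw [ae_restrict_iff' hΩ.measurableSet] at hu1
    filter_upwards [hu1] with z hz
    rw [norm_smul, Real.norm_of_nonneg (hk.nonneg _)]
    by_cases hzΩ : z ∈ Ω
    · rw [Set.indicator_of_mem hzΩ]
      exact mul_le_of_le_one_right (hk.nonneg _) (hz hzΩ)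
    · simp [hzΩ, hk.nonneg]
  refine (norm_integral_le_of_norm_le (hk.integrable.comp_sub_left x) h1).trans_eq ?_
  rw [integral_sub_left_eq_self k volume x, hk.integral_eq]

/-- The value of a mollification at a point is an L² pairing with a fixed kernel, hence continuous
for weak convergence. -/
theorem tendsto_moll_of_weakTendsto (hΩ : IsOpen Ω) {k : E3 → ℝ} (hk : IsMollifier k)
    {u : ℕ → E3 → E3} {u₀ : E3 → E3} (hu : ∀ j, MemLp (u j) 2 (volume.restrict Ω))
    (hu₀ : MemLp u₀ 2 (volume.restrict Ω)) (hw : WeakTendsto (volume.restrict Ω) u u₀) (x : E3) :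
    Tendsto (fun j => moll k (Ω.indicator (u j)) x) atTop (𝓝 (moll k (Ω.indicator u₀) x)) := by
  have hkx : MemLp (fun z => k (x - z)) 2 (volume.restrict Ω) :=
    ((hk.continuous.comp (by fun_prop)).memLp_of_hasCompactSupport
      (hk.compact.comp_homeomorph (Homeomorph.subLeft x))).restrict Ω
  have e : ∀ {v : E3 → E3}, MemLp v 2 (volume.restrict Ω) → ∀ i,
      moll k (Ω.indicator v) x i =
        ∫ z in Ω, k (x - z) * (EuclideanSpace.proj (𝕜 := ℝ) i : E3 →L[ℝ] ℝ) (v z) := by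
    intro v hv i
    have hi : IntegrableOn (fun z => k (x - z) • v z) Ω :=
      memLp_one_iff_integrable.1 (hv.smul hkx)
    have e1 : moll k (Ω.indicator v) x = ∫ z in Ω, k (x - z) • v z := by
      rw [moll_apply_swap, ← integral_indicator hΩ.measurableSet]
      congr 1 with z
      by_cases hz : z ∈ Ω <;> simp [hz]
    rw [e1]
    change (EuclideanSpace.proj (𝕜 := ℝ) i : E3 →L[ℝ] ℝ) (∫ z in Ω, k (x - z) • v z) = _
    rw [← ContinuousLinearMap.integral_comp_comm _ hi]
    simp only [map_smul, smul_eq_mul]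
  have h2 : Tendsto (fun j => WithLp.ofLp (moll k (Ω.indicator (u j)) x)) atTop
      (𝓝 (WithLp.ofLp (moll k (Ω.indicator u₀) x))) := by
    rw [tendsto_pi_nhds]
    intro i
    rw [e hu₀ i]
    exact (hw _ _ hkx).congr fun j => (e (hu j) i).symm
  exact ((PiLp.continuous_toLp 2 _).tendsto _).comp h2

/-- Local compactness of the embedding of `H¹` into `L²`. -/
theorem tendsto_eLpNorm_sub_of_weakTendsto (hΩ : IsOpen Ω) (hfc : IsCompact (frontier Ω))
    {α : ℝ≥0} (hb : HasC2HolderBoundary α Ω) {u : ℕ → E3 → E3} {u₀ : E3 → E3}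
    (hu : ∀ k, MemH1 Ω (u k)) (hu₀ : MemH1 Ω u₀)
    (hu1 : ∀ k, ∀ᵐ x ∂(volume.restrict Ω), ‖u k x‖ ≤ 1)
    {B : ℝ≥0} (hB : ∀ k, eLpNorm (weakGrad Ω (u k)) 2 (volume.restrict Ω) ≤ B)
    (hw : WeakTendsto (volume.restrict Ω) u u₀) {D : Set E3} (hD : IsCompact D) (hDΩ : D ⊆ Ω) :
    Tendsto (fun k => eLpNorm (u k - u₀) 2 (volume.restrict D)) atTop (𝓝 0) := by
  rw [ENNReal.tendsto_nhds_zero]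
  intro ε hε
  obtain ⟨δ₀, hδ₀, hthick⟩ := hD.exists_cthickening_subset_open hΩ hDΩ
  obtain ⟨B', hB'1, hB'2⟩ : ∃ B' : ℝ≥0, (B : ℝ≥0∞) ≤ B' ∧
      eLpNorm (weakGrad Ω u₀) 2 (volume.restrict Ω) ≤ B' := by
    refine ⟨max B (eLpNorm (weakGrad Ω u₀) 2 (volume.restrict Ω)).toNNReal,
      ENNReal.coe_le_coe.2 (le_max_left _ _), ?_⟩
    conv_lhs => rw [← ENNReal.coe_toNNReal (hu₀.memLp_weakGrad hΩ).2.ne]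
    exact ENNReal.coe_le_coe.2 (le_max_right _ _)
  have hε3 : 0 < ε / 3 := ENNReal.div_pos hε.ne' (by norm_num)
  have hlim : Tendsto (fun δ : ℝ => ENNReal.ofReal δ * B') (𝓝[>] 0) (𝓝 0) := by
    have h1 : Tendsto (fun δ : ℝ => ENNReal.ofReal δ) (𝓝[>] 0) (𝓝 0) := by
      have := ENNReal.continuous_ofReal.tendsto 0
      rw [ENNReal.ofReal_zero] at this
      exact this.mono_left nhdsWithin_le_nhds
    simpa using ENNReal.Tendsto.mul_const h1 (Or.inr (ENNReal.coe_ne_top (r := B')))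
  -- This radius makes the mollification error, at most δ times the gradient norm, smaller than ε/3
  -- for the limit and for the whole sequence at once.
  obtain ⟨δ, hδ1, hδ2, hδ3⟩ := ((hlim.eventually (ge_mem_nhds hε3)).and
    (Ioo_mem_nhdsGT hδ₀)).exists
  have hball : ∀ x ∈ D, Metric.closedBall x δ ⊆ Ω := fun x hx =>
    (Metric.closedBall_subset_closedBall hδ3.le).trans
      ((Metric.closedBall_subset_cthickening hx δ₀).trans hthick)
  obtain ⟨k, hk, hks⟩ := exists_isMollifier 0 hδ2
  have hloc : ∀ {v : E3 → E3}, MemH1 Ω v → LocallyIntegrable (Ω.indicator v) := fun hv =>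
    locallyIntegrable_indicator hΩ hv.1
  have hest : ∀ {v : E3 → E3}, MemH1 Ω v →
      eLpNorm (weakGrad Ω v) 2 (volume.restrict Ω) ≤ B' →
      eLpNorm (moll k (Ω.indicator v) - Ω.indicator v) 2 (volume.restrict D) ≤ ε / 3 :=
    fun hv hvB => (hv.eLpNorm_moll_sub_le hΩ hfc hb hk hD.measurableSet hks hball).trans
      ((mul_le_mul' le_rfl hvB).trans hδ1)
  have hcont : ∀ {v : E3 → E3}, MemH1 Ω v → Continuous (moll k (Ω.indicator v)) := fun hv =>
    (hk.contDiff_moll (hloc hv)).continuous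
  obtain ⟨A, hA⟩ := hD.exists_bound_of_continuousOn (hcont hu₀).continuousOn
  -- With the kernel now fixed, pointwise convergence and a uniform bound on the compact set `D`
  -- give L² convergence by dominated convergence.
  have hmid : Tendsto (fun j => eLpNorm (moll k (Ω.indicator (u j)) - moll k (Ω.indicator u₀)) 2
      (volume.restrict D)) atTop (𝓝 0) := by
    have h2 : Tendsto (fun j => ∫⁻ x in D,
        ‖(moll k (Ω.indicator (u j)) - moll k (Ω.indicator u₀)) x‖ₑ ^ 2) atTop
        (𝓝 (∫⁻ _ in D, 0)) := by
      refine tendsto_lintegral_of_dominated_convergence (fun _ => ENNReal.ofReal ((1 + A) ^ 2))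
        (fun j => ((hcont (hu j)).sub (hcont hu₀)).enorm.measurable.pow_const 2)
        (fun j => ae_restrict_of_forall_mem hD.measurableSet fun x hx => ?_) ?_
        (ae_of_all _ fun x => ?_)
      · dsimp only
        rw [← ofReal_norm, ← ENNReal.ofReal_pow (norm_nonneg _)]
        refine ENNReal.ofReal_le_ofReal (pow_le_pow_left₀ (norm_nonneg _) ?_ 2)
        exact (norm_sub_le _ _).trans
          (add_le_add (norm_moll_indicator_le hΩ hk (hu1 j) x) (hA x hx))
      · rw [lintegral_const]
        exact ENNReal.mul_ne_top ENNReal.ofReal_ne_top (by simpa using hD.measure_lt_top.ne)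
      · have := (tendsto_moll_of_weakTendsto hΩ hk (fun j => (hu j).1) hu₀.1 hw x).sub_const
          (moll k (Ω.indicator u₀) x)
        rw [sub_self] at this
        have h3 := ENNReal.Tendsto.pow (n := 2) (continuous_enorm.tendsto _ |>.comp this)
        simpa using h3
    rw [lintegral_zero] at h2
    have := (ENNReal.continuous_rpow_const (y := (1 / 2 : ℝ))).tendsto 0 |>.comp h2
    rw [ENNReal.zero_rpow_of_pos (by norm_num : (0 : ℝ) < 1 / 2)] at this
    refine this.congr fun p => ?_
    rw [Function.comp, ← eLpNorm_two_sq, ← ENNReal.rpow_natCast, ← ENNReal.rpow_mul]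
    norm_num
  filter_upwards [ENNReal.tendsto_nhds_zero.1 hmid _ hε3] with j hj
  have hDi : eLpNorm (u j - u₀) 2 (volume.restrict D) =
      eLpNorm (Ω.indicator (u j) - Ω.indicator u₀) 2 (volume.restrict D) := by
    refine eLpNorm_congr_ae (ae_restrict_of_forall_mem hD.measurableSet fun x hx => ?_)
    simp [hDΩ hx]
  have e : Ω.indicator (u j) - Ω.indicator u₀ =
      (moll k (Ω.indicator (u j)) - moll k (Ω.indicator u₀)) -
      (moll k (Ω.indicator (u j)) - Ω.indicator (u j)) +
      (moll k (Ω.indicator u₀) - Ω.indicator u₀) := by abel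
  have ms : ∀ {v : E3 → E3}, MemH1 Ω v →
      AEStronglyMeasurable (moll k (Ω.indicator v) - Ω.indicator v) (volume.restrict D) :=
    fun hv => (hcont hv).aestronglyMeasurable.sub (hloc hv).aestronglyMeasurable.restrict
  have mc : AEStronglyMeasurable (moll k (Ω.indicator (u j)) - moll k (Ω.indicator u₀))
      (volume.restrict D) := ((hcont (hu j)).sub (hcont hu₀)).aestronglyMeasurable
  rw [hDi, e]
  calc _ ≤ ε / 3 + ε / 3 + ε / 3 :=
        (eLpNorm_add_le (mc.sub (ms (hu j))) (ms hu₀) (by norm_num)).trans (add_le_add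
          ((eLpNorm_sub_le mc (ms (hu j)) (by norm_num)).trans
            (add_le_add hj (hest (hu j) ((hB j).trans hB'1)))) (hest hu₀ hB'2))
    _ = ε := ENNReal.add_thirds ε

end Rellich

variable {Ω : Set E3}

theorem eLpNorm_two_sq_eq_ofReal {X E : Type*} [MeasurableSpace X] {μ : Measure X}
    [NormedAddCommGroup E] {f : X → E} (hf : MemLp f 2 μ) :
    eLpNorm f 2 μ ^ 2 = ENNReal.ofReal (∫ x, ‖f x‖ ^ 2 ∂μ) := by
  rw [eLpNorm_two_sq, ofReal_integral_eq_lintegral_ofReal hf.norm.integrable_sq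
    (Eventually.of_forall fun x => by positivity)]
  refine lintegral_congr fun x => ?_
  rw [ENNReal.ofReal_pow (norm_nonneg _), ofReal_norm]

/-! ### Pointwise identities -/

theorem continuous_cross : Continuous fun p : E3 × E3 => cross p.1 p.2 := by
  have : ∀ p : E3 × E3, cross p.1 p.2 = !₂[p.1 1 * p.2 2 - p.1 2 * p.2 1,
      p.1 2 * p.2 0 - p.1 0 * p.2 2, p.1 0 * p.2 1 - p.1 1 * p.2 0] := fun p => by
    rw [cross, crossProduct]; rfl
  simp_rw [this]
  refine (PiLp.continuous_toLp 2 _).comp (continuous_pi fun i => ?_)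
  fin_cases i <;> simp <;> fun_prop

theorem norm_cross_sq (a b : E3) :
    ‖cross a b‖ ^ 2 = ‖a‖ ^ 2 * ‖b‖ ^ 2 - (inner ℝ a b) ^ 2 := by
  simp only [EuclideanSpace.norm_sq_eq, PiLp.inner_apply, Fin.sum_univ_three, cross, crossProduct,
    Real.norm_eq_abs, sq_abs, RCLike.inner_apply, conj_trivial]
  simp
  ring

/-- Splitting along the unit vector `b` and its complement. For a = curl n and b = n, the twist and
bend terms with unit constants add up to |curl n + t n|². -/
theorem norm_sq_add_smul (a : E3) {b : E3} (hb : ‖b‖ = 1) (t : ℝ) :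
    ‖a + t • b‖ ^ 2 = (inner ℝ a b + t) ^ 2 + ‖cross a b‖ ^ 2 := by
  rw [norm_cross_sq, norm_add_sq_real, norm_smul, hb, inner_smul_right, Real.norm_eq_abs, mul_one,
    sq_abs]
  ring

theorem norm_cross_le (a : E3) {b : E3} (hb : ‖b‖ = 1) : ‖cross a b‖ ≤ ‖a‖ := by
  refine le_of_sq_le_sq ?_ (norm_nonneg _)
  rw [norm_cross_sq, hb]
  nlinarith [sq_nonneg (inner ℝ a b)]

/-- Pointwise coercivity of the Oseen–Frank density. -/
theorem coercive_density {K₁ K₂ K₃ l e : ℝ} (hl : 0 ≤ l) (h1 : e ≤ K₁) (h2 : e ≤ K₂) (h3 : e ≤ K₃)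
    (A : E3 →L[ℝ] E3) {v : E3} (hv : ‖v‖ = 1) (t : ℝ) :
    l * ‖A‖ ^ 2 + (e - 2 * l) * (1 * divOf A ^ 2 + 1 * (inner ℝ (curlOf A) v + t) ^ 2
      + 1 * ‖cross (curlOf A) v‖ ^ 2) ≤
    (K₁ * divOf A ^ 2 + K₂ * (inner ℝ (curlOf A) v + t) ^ 2 + K₃ * ‖cross (curlOf A) v‖ ^ 2)
      + l * ((jacobian A * jacobian A).trace - divOf A ^ 2) + 2 * l * t ^ 2 := by
  have e1 := norm_sq_le_frobSq A
  rw [frobSq_eq] at e1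
  have e2 := norm_sq_add_smul (curlOf A) hv 0
  rw [zero_smul, add_zero, add_zero] at e2
  have e3 := mul_le_mul_of_nonneg_left (e1.trans_eq (by rw [e2])) hl
  set d := divOf A
  set b := inner ℝ (curlOf A) v
  set c := ‖cross (curlOf A) v‖
  have q1 := mul_le_mul_of_nonneg_right h1 (sq_nonneg d)
  have q2 := mul_le_mul_of_nonneg_right h2 (sq_nonneg (b + t))
  have q3 := mul_le_mul_of_nonneg_right h3 (sq_nonneg c)
  have q4 := mul_nonneg hl (sq_nonneg d)
  have q5 := mul_nonneg hl (sq_nonneg c)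
  -- The remainder is l times (b + 2t)², because 2(b + t)² + 2t² - b² = (b + 2t)²; this is where the
  -- term 2lt² is spent.
  have q6 := mul_nonneg hl (sq_nonneg (b + 2 * t))
  nlinarith

/-! ### Integrability and coercivity -/

section Integrability

variable {u : E3 → E3} (hΩ : IsOpen Ω) (hu : MemH1Sphere Ω u)

include hΩ hu

theorem MemH1Sphere.memLp_curl : MemLp (fun x => curlOf (weakGrad Ω u x)) 2 (volume.restrict Ω) :=
  curlL.comp_memLp' (hu.1.memLp_weakGrad hΩ)

theorem MemH1Sphere.memLp_div : MemLp (fun x => divOf (weakGrad Ω u x)) 2 (volume.restrict Ω) :=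
  divL.comp_memLp' (hu.1.memLp_weakGrad hΩ)

end Integrability

/-- A unit field in L² exists only on a set of finite volume. This supplies the finiteness that the
hypotheses on the domain do not state. -/
theorem MemH1Sphere.volume_lt_top {u : E3 → E3} (hu : MemH1Sphere Ω u) : volume Ω < ⊤ := by
  have h := hu.1.1.2
  have : eLpNorm u 2 (volume.restrict Ω) = eLpNorm (fun _ : E3 => (1 : ℝ)) 2 (volume.restrict Ω) :=
    eLpNorm_congr_norm_ae (by filter_upwards [hu.2] with x hx; simp [hx])
  rw [this, eLpNorm_const_lt_top_iff (by norm_num) (by norm_num)] at h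
  simpa using h

theorem MemLp.inner_of_norm_one {X : Type*} [MeasurableSpace X] {μ : Measure X} {a b : X → E3}
    (ha : MemLp a 2 μ) (hb : AEStronglyMeasurable b μ) (h1 : ∀ᵐ x ∂μ, ‖b x‖ = 1) :
    MemLp (fun x => inner ℝ (a x) (b x)) 2 μ :=
  ha.of_le (ha.1.inner hb) (by
    filter_upwards [h1] with x hx
    exact (norm_inner_le_norm _ _).trans_eq (by rw [hx, mul_one]))

theorem MemLp.cross_of_norm_one {X : Type*} [MeasurableSpace X] {μ : Measure X} {a b : X → E3}
    (ha : MemLp a 2 μ) (hb : AEStronglyMeasurable b μ) (h1 : ∀ᵐ x ∂μ, ‖b x‖ = 1) :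
    MemLp (fun x => cross (a x) (b x)) 2 μ :=
  ha.of_le (continuous_cross.comp_aestronglyMeasurable (ha.1.prodMk hb)) (by
    filter_upwards [h1] with x hx
    exact norm_cross_le _ hx)

theorem integrable_sum_sq {X E : Type*} [MeasurableSpace X] {μ : Measure X} [IsFiniteMeasure μ]
    [NormedAddCommGroup E] {a b : X → ℝ} {c : X → E} (ha : MemLp a 2 μ) (hb : MemLp b 2 μ)
    (hc : MemLp c 2 μ) (t K₁ K₂ K₃ : ℝ) :
    Integrable (fun x => K₁ * a x ^ 2 + K₂ * (b x + t) ^ 2 + K₃ * ‖c x‖ ^ 2) μ := by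
  have m3 : MemLp (fun x => b x + t) 2 μ := hb.add (memLp_const t)
  exact ((ha.integrable_sq.const_mul K₁).add (m3.integrable_sq.const_mul K₂)).add
    (hc.norm.integrable_sq.const_mul K₃)

theorem MemH1Sphere.integrable_density {u : E3 → E3} (hΩ : IsOpen Ω) (hu : MemH1Sphere Ω u)
    (t K₁ K₂ K₃ : ℝ) : IntegrableOn (fun x => K₁ * divOf (weakGrad Ω u x) ^ 2
      + K₂ * (inner ℝ (curlOf (weakGrad Ω u x)) (u x) + t) ^ 2
      + K₃ * ‖cross (curlOf (weakGrad Ω u x)) (u x)‖ ^ 2) Ω := by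
  have : IsFiniteMeasure ((volume : Measure E3).restrict Ω) := ⟨by simpa using hu.volume_lt_top⟩
  have hc := hu.memLp_curl hΩ
  have m1 := MemLp.inner_of_norm_one hc hu.1.1.1 hu.2
  have m2 := MemLp.cross_of_norm_one hc hu.1.1.1 hu.2
  exact integrable_sum_sq (hu.memLp_div hΩ) m1 m2 t K₁ K₂ K₃

theorem MemH1Sphere.integrable_null {u : E3 → E3} (hΩ : IsOpen Ω) (hu : MemH1Sphere Ω u) :
    IntegrableOn (fun x => (jacobian (weakGrad Ω u x) * jacobian (weakGrad Ω u x)).trace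
      - divOf (weakGrad Ω u x) ^ 2) Ω := by
  have hG := hu.1.memLp_weakGrad hΩ
  have h1 : IntegrableOn (fun x => frobSq (weakGrad Ω u x)) Ω := by
    unfold frobSq
    refine integrable_finsetSum _ fun i _ => integrable_finsetSum _ fun j _ => ?_
    have : MemLp (fun x => jacobian (weakGrad Ω u x) i j) 2 (volume.restrict Ω) :=
      ((EuclideanSpace.proj (𝕜 := ℝ) i : E3 →L[ℝ] ℝ).comp
        (ContinuousLinearMap.apply ℝ E3 (basisVec j))).comp_memLp' hG
    exact this.integrable_sq
  have h2 := (h1.sub (hu.memLp_curl hΩ).norm.integrable_sq).sub (hu.memLp_div hΩ).integrable_sq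
  refine h2.congr (Eventually.of_forall fun x => ?_)
  simp [frobSq_eq]

theorem MemH1Sphere.coercive {u : E3 → E3} (hΩ : IsOpen Ω) (hu : MemH1Sphere Ω u)
    {K₁ K₂ K₃ K₄ e : ℝ} (hl : 0 ≤ K₂ + K₄) (h1 : e ≤ K₁) (h2 : e ≤ K₂) (h3 : e ≤ K₃) (t : ℝ) :
    (K₂ + K₄) * (∫ x in Ω, ‖weakGrad Ω u x‖ ^ 2)
      + (e - 2 * (K₂ + K₄)) * energyOFPlus Ω t 1 1 1 u ≤
    energyOFPlus Ω t K₁ K₂ K₃ u + energyNull Ω K₂ K₄ u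
      + 2 * (K₂ + K₄) * t ^ 2 * volume.real Ω := by
  have : IsFiniteMeasure ((volume : Measure E3).restrict Ω) := ⟨by simpa using hu.volume_lt_top⟩
  have i1 := (hu.1.memLp_weakGrad hΩ).norm.integrable_sq.const_mul (K₂ + K₄)
  have i2 := (hu.integrable_density hΩ t 1 1 1).const_mul (e - 2 * (K₂ + K₄))
  have i3 := hu.integrable_density hΩ t K₁ K₂ K₃
  have i4 := (hu.integrable_null hΩ).const_mul (K₂ + K₄)
  have i5 : Integrable (fun _ : E3 => 2 * (K₂ + K₄) * t ^ 2) (volume.restrict Ω) :=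
    integrable_const _
  have key := integral_mono_ae (i1.add i2) ((i3.add i4).add i5) (by
    filter_upwards [hu.2] with x hx
    exact coercive_density hl h1 h2 h3 (weakGrad Ω u x) hx t)
  rw [integral_add' i1 i2, integral_add' (i3.add i4) i5, integral_add' i3 i4,
    integral_const_mul, integral_const_mul, integral_const_mul, integral_const] at key
  simp only [MeasurableSet.univ, measureReal_restrict_apply, Set.univ_inter, smul_eq_mul] at key
  unfold energyOFPlus energyNull
  linarith

/-- Completing the square: -κ²s² + κ²s⁴/2 = κ²(1 - s²)²/2 - κ²/2, and the gradient term is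
nonnegative. -/
theorem energyGL_ge (hV : volume Ω < ⊤) (κ q : ℝ) (ψ : E3 → ℂ) (n : E3 → E3) :
    -(κ ^ 2 / 2 * volume.real Ω) ≤ energyGL Ω κ q ψ n := by
  have : IsFiniteMeasure ((volume : Measure E3).restrict Ω) := ⟨by simpa using hV⟩
  unfold energyGL
  by_cases h : Integrable (fun x => (∑ j : Fin 3,
      ‖weakGrad Ω ψ x (basisVec j) - Complex.I * (q : ℂ) * (n x j : ℂ) * ψ x‖ ^ 2)
    - κ ^ 2 * ‖ψ x‖ ^ 2 + κ ^ 2 / 2 * ‖ψ x‖ ^ 4) (volume.restrict Ω)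
  · have := integral_mono (μ := volume.restrict Ω) (f := fun _ : E3 => -(κ ^ 2 / 2))
      (integrable_const _) h (fun x => by
      have h1 : 0 ≤ ∑ j : Fin 3,
        ‖weakGrad Ω ψ x (basisVec j) - Complex.I * (q : ℂ) * (n x j : ℂ) * ψ x‖ ^ 2 := by positivity
      have h2 : 0 ≤ κ ^ 2 / 2 * (1 - ‖ψ x‖ ^ 2) ^ 2 := by positivity
      simp only
      nlinarith)
    refine le_trans (le_of_eq ?_) this
    simp [mul_comm]
  -- The integral of a non-integrable function is 0 by convention, which also satisfies the bound.
  · rw [integral_undef h]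
    have : 0 ≤ κ ^ 2 / 2 * volume.real Ω := by positivity
    linarith

theorem weakGrad_zero (hΩ : IsOpen Ω) {F : Type*} [NormedAddCommGroup F] [NormedSpace ℝ F]
    [CompleteSpace F] : weakGrad Ω (0 : E3 → F) =ᵐ[volume.restrict Ω] 0 := by
  have := hasWeakGrad_fderiv (Ω := Ω) (f := (0 : E3 → F)) contDiff_const
  have h := this.weakGrad_ae_eq hΩ
  filter_upwards [h] with x hx
  rw [hx]; simp

theorem memH1_zero {F : Type*} [NormedAddCommGroup F] [NormedSpace ℝ F] [CompleteSpace F] :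
    MemH1 Ω (0 : E3 → F) := by
  refine ⟨MemLp.zero (ε := F), fderiv ℝ (0 : E3 → F), hasWeakGrad_fderiv contDiff_const, ?_⟩
  have : fderiv ℝ (0 : E3 → F) = 0 := by ext x; simp
  rw [this]; exact MemLp.zero (ε := E3 →L[ℝ] F)

theorem energyGL_zero (hΩ : IsOpen Ω) (κ q : ℝ) (n : E3 → E3) : energyGL Ω κ q 0 n = 0 := by
  unfold energyGL
  rw [integral_congr_ae (g := fun _ => (0 : ℝ)), integral_zero]
  filter_upwards [weakGrad_zero (F := ℂ) hΩ] with x hx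
  simp [hx]

/-! ### The helix -/

theorem norm_helix (t : ℝ) (x : E3) : ‖helix t x‖ = 1 := by
  have : ‖helix t x‖ ^ 2 = 1 := by
    rw [EuclideanSpace.norm_sq_eq, Fin.sum_univ_three]
    simp [helix]
  nlinarith [norm_nonneg (helix t x)]

theorem contDiff_helix (t : ℝ) : ContDiff ℝ ∞ (helix t) := by
  rw [contDiff_euclidean]
  have h : ContDiff ℝ ∞ fun x : E3 => t * x 2 :=
    contDiff_const.mul (EuclideanSpace.proj (𝕜 := ℝ) (2 : Fin 3) : E3 →L[ℝ] ℝ).contDiff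
  intro i
  fin_cases i
  · exact Real.contDiff_cos.comp h
  · exact Real.contDiff_sin.comp h
  · exact contDiff_const

theorem jacobian_helix (t : ℝ) (x : E3) : jacobian (fderiv ℝ (helix t) x) =
    !![0, 0, -t * Real.sin (t * x 2); 0, 0, t * Real.cos (t * x 2); 0, 0, 0] := by
  have h : HasFDerivAt (fun x : E3 => t * x 2)
      (t • (EuclideanSpace.proj (𝕜 := ℝ) (2 : Fin 3) : E3 →L[ℝ] ℝ)) x :=
    (EuclideanSpace.proj (𝕜 := ℝ) (2 : Fin 3) : E3 →L[ℝ] ℝ).hasFDerivAt.const_mul t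
  have h0 := h.cos.fderiv
  have h1 := h.sin.fderiv
  ext i j
  rw [jacobian_fderiv ((contDiff_helix t).differentiable (by simp) x), pd]
  fin_cases i
  · change fderiv ℝ (fun x : E3 => Real.cos (t * x 2)) x _ = _
    rw [h0]
    fin_cases j <;> simp [basisVec, mul_comm]
  · change fderiv ℝ (fun x : E3 => Real.sin (t * x 2)) x _ = _
    rw [h1]
    fin_cases j <;> simp [basisVec, mul_comm]
  · change fderiv ℝ (fun x : E3 => (0 : ℝ)) x _ = _
    fin_cases j <;> simp

theorem divOf_helix (t : ℝ) (x : E3) : divOf (fderiv ℝ (helix t) x) = 0 := by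
  rw [divOf, jacobian_helix]; simp [Matrix.trace_fin_three]

theorem curlOf_helix (t : ℝ) (x : E3) : curlOf (fderiv ℝ (helix t) x) = -(t • helix t x) := by
  rw [curlOf, jacobian_helix]
  ext i
  fin_cases i <;> simp [helix]

theorem trace_helix (t : ℝ) (x : E3) :
    (jacobian (fderiv ℝ (helix t) x) * jacobian (fderiv ℝ (helix t) x)).trace = 0 := by
  rw [jacobian_helix]; simp [Matrix.trace_fin_three]

theorem memH1Sphere_helix (hV : volume Ω < ⊤) (t : ℝ) : MemH1Sphere Ω (helix t) := by
  have : IsFiniteMeasure ((volume : Measure E3).restrict Ω) := ⟨by simpa using hV⟩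
  have hc := contDiff_helix t
  refine ⟨⟨?_, fderiv ℝ (helix t), hasWeakGrad_fderiv (hc.of_le (by simp)), ?_⟩,
    Eventually.of_forall fun x => norm_helix t x⟩
  · exact MemLp.of_bound hc.continuous.aestronglyMeasurable 1
      (Eventually.of_forall fun x => (norm_helix t x).le)
  · refine MemLp.of_bound (hc.continuous_fderiv (by simp)).aestronglyMeasurable |t|
      (Eventually.of_forall fun x => ?_)
    refine le_of_sq_le_sq ?_ (abs_nonneg _)
    refine (norm_sq_le_frobSq _).trans_eq ?_
    rw [frobSq_eq, trace_helix, curlOf_helix, norm_neg, norm_smul, norm_helix]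
    simp

theorem energyOFPlus_eq_zero {u : E3 → E3} (h1 : ∀ᵐ x ∂(volume.restrict Ω), ‖u x‖ = 1) {t : ℝ}
    (hd : ∀ᵐ x ∂(volume.restrict Ω), divOf (weakGrad Ω u x) = 0)
    (hc : ∀ᵐ x ∂(volume.restrict Ω), curlOf (weakGrad Ω u x) = -(t • u x)) (K₁ K₂ K₃ : ℝ) :
    energyOFPlus Ω t K₁ K₂ K₃ u = 0 := by
  unfold energyOFPlus
  rw [integral_congr_ae (g := fun _ => (0 : ℝ)), integral_zero]
  filter_upwards [h1, hd, hc] with x h1 h2 h3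
  have := norm_sq_add_smul (curlOf (weakGrad Ω u x)) h1 t
  rw [h3, neg_add_cancel, norm_zero] at this
  rw [h2, h3]
  have a := sq_nonneg (inner ℝ (-(t • u x)) (u x) + t)
  have b := sq_nonneg ‖cross (-(t • u x)) (u x)‖
  have a' : (inner ℝ (-(t • u x)) (u x) + t) ^ 2 = 0 := by linarith
  have b' : ‖cross (-(t • u x)) (u x)‖ ^ 2 = 0 := by linarith
  rw [a', b']; ring

/-! ### Comparison of minimizers with the helix -/

theorem energyLdG_helix (hΩ : IsOpen Ω) (P : Params) : energyLdG Ω P 0 (helix P.τ) = 0 := by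
  have hw := (hasWeakGrad_fderiv (Ω := Ω) ((contDiff_helix P.τ).of_le (by simp))).weakGrad_ae_eq hΩ
  have h1 : energyOFPlus Ω P.τ P.K₁ P.K₂ P.K₃ (helix P.τ) = 0 := by
    refine energyOFPlus_eq_zero (Eventually.of_forall fun x => norm_helix _ x) ?_ ?_ _ _ _
    · filter_upwards [hw] with x hx; rw [hx, divOf_helix]
    · filter_upwards [hw] with x hx; rw [hx, curlOf_helix]
  have h2 : energyNull Ω P.K₂ P.K₄ (helix P.τ) = 0 := by
    unfold energyNull
    rw [integral_congr_ae (g := fun _ => (0 : ℝ)), integral_zero, mul_zero]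
    filter_upwards [hw] with x hx
    rw [hx, divOf_helix, trace_helix]; simp
  rw [energyLdG, energyGL_zero hΩ, h1, h2]; simp

theorem energyOFPlus_nonneg {t K₁ K₂ K₃ : ℝ} (h1 : 0 ≤ K₁) (h2 : 0 ≤ K₂) (h3 : 0 ≤ K₃)
    (u : E3 → E3) : 0 ≤ energyOFPlus Ω t K₁ K₂ K₃ u :=
  integral_nonneg fun x => by positivity

/-- The competitor is ψ = 0 with the helix of the same twist, of energy zero. The lower bound for
the Ginzburg–Landau part and integrated coercivity then bound the gradient and the Oseen–Frank
energy simultaneously. -/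
theorem IsMinimizerLdG.energy_bound (hΩ : IsOpen Ω) {P : Params} {ψ : E3 → ℂ} {n : E3 → E3}
    (h : IsMinimizerLdG Ω P ψ n) {e : ℝ} (hl : 0 ≤ P.K₂ + P.K₄)
    (he : e ≤ min P.K₁ (min P.K₂ P.K₃)) :
    (P.K₂ + P.K₄) * (∫ x in Ω, ‖weakGrad Ω n x‖ ^ 2)
      + (e - 2 * (P.K₂ + P.K₄)) * energyOFPlus Ω P.τ 1 1 1 n ≤
    (P.κ ^ 2 / 2 + 2 * (P.K₂ + P.K₄) * P.τ ^ 2) * volume.real Ω := by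
  obtain ⟨-, hn, hmin⟩ := h
  have hV := hn.volume_lt_top
  have h0 := hmin 0 (helix P.τ) memH1_zero (memH1Sphere_helix hV _)
  rw [energyLdG_helix hΩ, energyLdG] at h0
  have h1 := energyGL_ge hV P.κ P.q ψ n
  simp only [le_min_iff] at he
  have h2 := hn.coercive hΩ hl he.1 he.2.1 he.2.2 P.τ
  linarith

/-- The Oseen–Frank energy controls the divergence and `curl u + t u`. -/
theorem MemH1Sphere.eLpNorm_div_curl_sq_le {u : E3 → E3} (hΩ : IsOpen Ω) (hu : MemH1Sphere Ω u)
    (t : ℝ) :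
    eLpNorm (fun x => divOf (weakGrad Ω u x)) 2 (volume.restrict Ω) ^ 2 ≤
      ENNReal.ofReal (energyOFPlus Ω t 1 1 1 u) ∧
    eLpNorm (fun x => curlOf (weakGrad Ω u x) + t • u x) 2 (volume.restrict Ω) ^ 2 ≤
      ENNReal.ofReal (energyOFPlus Ω t 1 1 1 u) := by
  have i1 := hu.integrable_density hΩ t 1 1 1
  have m : MemLp (fun x => curlOf (weakGrad Ω u x) + t • u x) 2 (volume.restrict Ω) :=
    (hu.memLp_curl hΩ).add (hu.1.1.const_smul t)
  rw [eLpNorm_two_sq_eq_ofReal (hu.memLp_div hΩ), eLpNorm_two_sq_eq_ofReal m]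
  refine ⟨ENNReal.ofReal_le_ofReal (integral_mono_ae (hu.memLp_div hΩ).norm.integrable_sq i1 ?_),
    ENNReal.ofReal_le_ofReal (integral_mono_ae m.norm.integrable_sq i1 ?_)⟩
  · refine Eventually.of_forall fun x => ?_
    simp only [Real.norm_eq_abs, sq_abs, one_mul]
    nlinarith [sq_nonneg (inner ℝ (curlOf (weakGrad Ω u x)) (u x) + t),
      sq_nonneg ‖cross (curlOf (weakGrad Ω u x)) (u x)‖]
  · filter_upwards [hu.2] with x hx
    rw [norm_sq_add_smul _ hx]
    nlinarith [sq_nonneg (divOf (weakGrad Ω u x))]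

/-! ### A mean value formula for the Helmholtz equation -/

section MeanValue

variable {Z : Type*} [NormedAddCommGroup Z] [NormedSpace ℝ Z] [FiniteDimensional ℝ Z]
  [MeasurableSpace Z] [BorelSpace Z] {μ : Measure Z} [μ.IsAddHaarMeasure]

/-- The average of a harmonic function against a radial weight `k`. That the weight is radial is
expressed by a potential `H` with `∂ₐ H = - zₐ k`. -/
theorem integral_mul_eq_of_laplacian_eq_zero {ι : Type*} [Fintype ι] (e : ι → Z)
    (c : ι → Z →L[ℝ] ℝ) (hec : ∀ z, z = ∑ a, c a z • e a) {k H V : Z → ℝ} (hk : Continuous k)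
    (hkc : HasCompactSupport k) (hH : ContDiff ℝ 1 H) (hHc : HasCompactSupport H)
    (hHk : ∀ z a, fderiv ℝ H z (e a) = -(c a z * k z)) (hV : ContDiff ℝ ∞ V)
    (hL : ∀ z, H z ≠ 0 → ∀ t ∈ Set.Icc (0 : ℝ) 1,
      ∑ a, fderiv ℝ (fun y => fderiv ℝ V y (e a)) (t • z) (e a) = 0) :
    ∫ z, k z * V z ∂μ = (∫ z, k z ∂μ) * V 0 := by
  have hDV : ContDiff ℝ ∞ (fderiv ℝ V) := hV.fderiv_right (by simp)
  have hDVc := hDV.continuous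
  have hWs : ∀ a, ContDiff ℝ ∞ fun y => fderiv ℝ V y (e a) := fun a =>
    hDV.clm_apply contDiff_const
  -- Since z k(z) = -∇H(z), this integral equals t ∫ H(z) (ΔV)(tz) after integration by parts, and
  -- ΔV vanishes along the rays that meet the support of `H`.
  have inner0 : ∀ t ∈ Set.Icc (0 : ℝ) 1, ∫ z, k z * fderiv ℝ V (t • z) z ∂μ = 0 := by
    intro t ht
    have hW : ∀ a, ContDiff ℝ ∞ fun z => fderiv ℝ V (t • z) (e a) := fun a =>
      (hWs a).comp (contDiff_const.smul contDiff_id)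
    have hWd : ∀ a z, fderiv ℝ (fun z => fderiv ℝ V (t • z) (e a)) z (e a) =
        t * fderiv ℝ (fun y => fderiv ℝ V y (e a)) (t • z) (e a) := fun a z => by
      have h1 : HasFDerivAt (fun z : Z => t • z) (t • ContinuousLinearMap.id ℝ Z) z :=
        (hasFDerivAt_id z).const_smul t
      have h2 := ((hWs a).differentiable (by simp) (t • z)).hasFDerivAt.comp z h1
      have h3 := h2.fderiv
      change fderiv ℝ ((fun y => fderiv ℝ V y (e a)) ∘ fun z => t • z) z (e a) = _
      rw [h3]; simp
    have e1 : ∀ z, k z * fderiv ℝ V (t • z) z =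
        ∑ a, -(fderiv ℝ H z (e a) * fderiv ℝ V (t • z) (e a)) := fun z => by
      conv_lhs => rw [show fderiv ℝ V (t • z) z = ∑ a, c a z * fderiv ℝ V (t • z) (e a) by
        conv_lhs => rw [hec z]
        simp only [map_sum, map_smul, smul_eq_mul]
        rw [← hec z]]
      rw [Finset.mul_sum]
      refine Finset.sum_congr rfl fun a _ => ?_
      rw [hHk]; ring
    have cH : Continuous (fderiv ℝ H) := hH.continuous_fderiv one_ne_zero
    have i1 : ∀ a, Integrable (fun z => fderiv ℝ H z (e a) * fderiv ℝ V (t • z) (e a)) μ :=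
      fun a => ((cH.clm_apply continuous_const).mul (hW a).continuous)
        |>.integrable_of_hasCompactSupport (hHc.fderiv_apply ℝ (e a)).mul_right
    have i2 : ∀ a, Integrable (fun z => H z *
        fderiv ℝ (fun z => fderiv ℝ V (t • z) (e a)) z (e a)) μ := fun a =>
      (hH.continuous.mul (((hW a).continuous_fderiv (by simp)).clm_apply continuous_const))
        |>.integrable_of_hasCompactSupport hHc.mul_right
    have i3 : ∀ a, Integrable (fun z => H z * fderiv ℝ V (t • z) (e a)) μ := fun a =>
      (hH.continuous.mul (hW a).continuous).integrable_of_hasCompactSupport hHc.mul_right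
    simp_rw [e1]
    have i1' : ∀ a, Integrable (fun z => -(fderiv ℝ H z (e a) * fderiv ℝ V (t • z) (e a))) μ :=
      fun a => (i1 a).neg
    rw [integral_finsetSum _ fun a _ => i1' a]
    have e2 : ∀ a, ∫ z, -(fderiv ℝ H z (e a) * fderiv ℝ V (t • z) (e a)) ∂μ =
        ∫ z, H z * fderiv ℝ (fun z => fderiv ℝ V (t • z) (e a)) z (e a) ∂μ := fun a => by
      rw [integral_neg, integral_mul_fderiv_eq_neg_fderiv_mul_of_integrable (i1 a) (i2 a) (i3 a)
        (fun z _ => hH.differentiable one_ne_zero z)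
        (fun z _ => (hW a).differentiable (by simp) z)]
    rw [Finset.sum_congr rfl fun a _ => e2 a, ← integral_finsetSum _ fun a _ => i2 a]
    refine integral_eq_zero_of_ae (Eventually.of_forall fun z => ?_)
    by_cases hz : H z = 0
    · simp [hz]
    · simp only [hWd, ← Finset.mul_sum, Pi.zero_apply]
      rw [hL z hz t ht]; simp
  have ftc : ∀ z, V z - V 0 = ∫ t in Set.Ioc (0 : ℝ) 1, fderiv ℝ V (t • z) z := fun z => by
    have hl : ∀ t : ℝ, HasDerivAt (fun t : ℝ => t • z) z t := fun t => by
      simpa using! (hasDerivAt_id t).smul_const z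
    have hd : ∀ t : ℝ, HasDerivAt (fun t : ℝ => V (t • z)) (fderiv ℝ V (t • z) z) t :=
      fun t => ((hV.differentiable (by simp) _).hasFDerivAt).comp_hasDerivAt t (hl t)
    rw [← intervalIntegral.integral_of_le zero_le_one,
      intervalIntegral.integral_eq_sub_of_hasDerivAt (fun t _ => hd t)]
    · simp
    · exact ((hDVc.comp (continuous_id.smul continuous_const)).clm_apply
        continuous_const).intervalIntegrable _ _
  have ik : Integrable k μ := hk.integrable_of_hasCompactSupport hkc
  have ikV : Integrable (fun z => k z * V z) μ :=
    (hk.mul hV.continuous).integrable_of_hasCompactSupport hkc.mul_right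
  have hF : Continuous fun p : Z × ℝ => k p.1 * fderiv ℝ V (p.2 • p.1) p.1 :=
    (hk.comp continuous_fst).mul
      ((hDVc.comp (continuous_snd.smul continuous_fst)).clm_apply continuous_fst)
  have iF : Integrable (Function.uncurry fun (z : Z) (t : ℝ) => k z * fderiv ℝ V (t • z) z)
      (μ.prod (volume.restrict (Set.Ioc (0 : ℝ) 1))) := by
    have h1 : IntegrableOn (fun p : Z × ℝ => k p.1 * fderiv ℝ V (p.2 • p.1) p.1)
        (tsupport k ×ˢ Set.Ioc (0 : ℝ) 1) (μ.prod volume) :=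
      (hF.continuousOn.integrableOn_compact (hkc.isCompact.prod isCompact_Icc)).mono_set
        (Set.prod_mono le_rfl Set.Ioc_subset_Icc_self)
    have h2 : IntegrableOn (fun p : Z × ℝ => k p.1 * fderiv ℝ V (p.2 • p.1) p.1)
        (Set.univ ×ˢ Set.Ioc (0 : ℝ) 1) (μ.prod volume) := by
      refine h1.of_forall_sdiff_eq_zero (MeasurableSet.univ.prod measurableSet_Ioc) fun p hp => ?_
      have : p.1 ∉ tsupport k := fun h => hp.2 ⟨h, hp.1.2⟩
      rw [image_eq_zero_of_notMem_tsupport this, zero_mul]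
    rw [IntegrableOn, ← Measure.prod_restrict, Measure.restrict_univ] at h2
    exact h2
  -- V(z) - V(0) is the integral of the radial derivative over t in (0, 1]; exchanging the integrals
  -- leaves one that vanishes for every t.
  have main : ∫ z, k z * (V z - V 0) ∂μ = 0 := by
    simp_rw [ftc, ← integral_const_mul]
    rw [integral_integral_swap iF, setIntegral_congr_fun measurableSet_Ioc
      (fun t ht => inner0 t (Set.Ioc_subset_Icc_self ht)), integral_zero]
  simp_rw [mul_sub] at main
  rw [integral_sub ikV (ik.mul_const _), integral_mul_const, sub_eq_zero] at main
  exact main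

end MeanValue

/-- The profiles are evaluated at |z|². From g' = -h/2 it follows that ∂ₐ g(|z|²) = -zₐ h(|z|²),
which is the potential required by the mean value formula. -/
theorem exists_radial_profile {R : ℝ} (hR : 0 < R) : ∃ h g : ℝ → ℝ, ContDiff ℝ ∞ h ∧
    (∀ r, 0 ≤ h r) ∧ 0 < h 0 ∧ (∀ r, R ≤ r → h r = 0) ∧ (∀ r, R ≤ r → g r = 0) ∧
    ContDiff ℝ 1 g ∧ ∀ r, HasDerivAt g (-(h r / 2)) r := by
  let f : ContDiffBump (0 : ℝ) := ⟨R / 2, R, by positivity, by linarith⟩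
  have hz : ∀ r, R ≤ r → f r = 0 := fun r hr => f.zero_of_le_dist (by
    simpa using hr.trans (le_abs_self r))
  have hc : Continuous f := f.continuous
  have hd : ∀ r, HasDerivAt (fun r => -(1 / 2) * ∫ x in R..r, f x) (-(f r / 2)) r := fun r => by
    have := (intervalIntegral.integral_hasDerivAt_right (hc.intervalIntegrable R r)
      (hc.stronglyMeasurableAtFilter _ _) hc.continuousAt).const_mul (-(1 / 2))
    have e : -(f r / 2) = -(1 / 2) * f r := by ring
    rw [e]; exact this
  refine ⟨f, fun r => -(1 / 2) * ∫ x in R..r, f x, f.contDiff, fun _ => f.nonneg, ?_, hz,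
    fun r hr => ?_, ?_, hd⟩
  · rw [f.one_of_mem_closedBall (Metric.mem_closedBall_self f.rIn_pos.le)]
    exact one_pos
  · change -(1 / 2) * ∫ x in R..r, f x = 0
    rw [intervalIntegral.integral_zero_ae, mul_zero]
    refine Eventually.of_forall fun x hx => hz x ?_
    rw [Set.uIoc_of_le hr] at hx
    exact hx.1.le
  · rw [contDiff_one_iff_deriv]
    refine ⟨fun r => (hd r).differentiableAt, ?_⟩
    rw [show deriv (fun r => -(1 / 2) * ∫ x in R..r, f x) = fun r => -(f r / 2) from
      funext fun r => (hd r).deriv]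
    exact (hc.div_const 2).neg

theorem fderiv_mul_prod {a : E3 → ℝ} {b : ℝ → ℝ} (ha : Differentiable ℝ a)
    (hb : Differentiable ℝ b) (x : E3) (z : E3 × ℝ) (w : E3 × ℝ) :
    fderiv ℝ (fun z : E3 × ℝ => a (x - z.1) * b z.2) z w =
      -(pd w.1 a (x - z.1)) * b z.2 + a (x - z.1) * (w.2 * deriv b z.2) := by
  have h1 : HasFDerivAt (fun z : E3 × ℝ => x - z.1) (-(ContinuousLinearMap.fst ℝ E3 ℝ)) z :=
    (ContinuousLinearMap.fst ℝ E3 ℝ).hasFDerivAt.const_sub x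
  have h2 := (ha (x - z.1)).hasFDerivAt.comp z h1
  have h3 : HasFDerivAt (fun z : E3 × ℝ => z.2) (ContinuousLinearMap.snd ℝ E3 ℝ) z :=
    (ContinuousLinearMap.snd ℝ E3 ℝ).hasFDerivAt
  have h4 := (hb z.2).hasDerivAt.comp_hasFDerivAt z h3
  have h5 := (h2.mul h4).fderiv
  change fderiv ℝ ((a ∘ fun z : E3 × ℝ => x - z.1) * (b ∘ fun z : E3 × ℝ => z.2)) z w = _
  rw [h5]
  simp [pd]
  ring

theorem contDiff_mul_prod {a : E3 → ℝ} {b : ℝ → ℝ} (ha : ContDiff ℝ ∞ a)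
    (hb : ContDiff ℝ ∞ b) (x : E3) : ContDiff ℝ ∞ (fun z : E3 × ℝ => a (x - z.1) * b z.2) :=
  (ha.comp (contDiff_const.sub contDiff_fst)).mul (hb.comp contDiff_snd)

/-- Basis vectors of `ℝ³ × ℝ`. -/
def prodBasis : Option (Fin 3) → E3 × ℝ
  | some i => (basisVec i, 0)
  | none => (0, 1)

/-- Coordinates on `ℝ³ × ℝ`. -/
def prodCoord : Option (Fin 3) → E3 × ℝ →L[ℝ] ℝ
  | some i => (EuclideanSpace.proj (𝕜 := ℝ) i : E3 →L[ℝ] ℝ).comp (ContinuousLinearMap.fst ℝ E3 ℝ)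
  | none => ContinuousLinearMap.snd ℝ E3 ℝ

theorem prodBasis_sum (z : E3 × ℝ) : z = ∑ a, prodCoord a z • prodBasis a := by
  have h := clm_apply_eq_sum (ContinuousLinearMap.id ℝ E3) z.1
  rw [Fintype.sum_option]
  simp only [prodCoord, prodBasis]
  ext1
  · simp [Prod.fst_sum]
    simpa [Fin.sum_univ_three] using h
  · simp [Prod.snd_sum]

/-- The factor cosh(τs) contributes +τ² and cancels the -τ² of the Helmholtz equation, so the
extension to ℝ³ × ℝ is harmonic. -/
theorem helmholtz_extension {u : E3 → ℝ} (hu : ContDiff ℝ ∞ u) (τ : ℝ) (x : E3) (z : E3 × ℝ)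
    (h : ∑ i, pd (basisVec i) (pd (basisVec i) u) (x - z.1) = -(τ ^ 2 * u (x - z.1))) :
    ∑ a, fderiv ℝ (fun y => fderiv ℝ (fun z : E3 × ℝ => u (x - z.1) * Real.cosh (τ * z.2)) y
      (prodBasis a)) z (prodBasis a) = 0 := by
  have hm : ContDiff ℝ ∞ fun s : ℝ => τ * s := contDiff_const.mul contDiff_id
  have hb : ContDiff ℝ ∞ fun s => Real.cosh (τ * s) := Real.contDiff_cosh.comp hm
  have hb2 : ContDiff ℝ ∞ fun s => τ * Real.sinh (τ * s) :=
    contDiff_const.mul (Real.contDiff_sinh.comp hm)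
  have hm' : ∀ s, HasDerivAt (fun s : ℝ => τ * s) τ s := fun s => by
    simpa using (hasDerivAt_id s).const_mul τ
  have hbd : deriv (fun s => Real.cosh (τ * s)) = fun s => τ * Real.sinh (τ * s) :=
    funext fun s => by rw [(hm' s).cosh.deriv, mul_comm]
  have hbd2 : deriv (fun s => τ * Real.sinh (τ * s)) = fun s => τ * (τ * Real.cosh (τ * s)) :=
    funext fun s => by rw [((hm' s).sinh.const_mul τ).deriv]; ring
  have hud := hu.differentiable (by simp)
  have hd : ∀ {b : ℝ → ℝ}, ContDiff ℝ ∞ b → Differentiable ℝ b :=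
    fun h => h.differentiable (by simp)
  have e1 : ∀ i, (fun y => fderiv ℝ (fun z : E3 × ℝ => u (x - z.1) * Real.cosh (τ * z.2)) y
      (prodBasis (some i))) =
      fun z : E3 × ℝ => (-pd (basisVec i) u) (x - z.1) * Real.cosh (τ * z.2) := fun i =>
    funext fun y => by rw [fderiv_mul_prod hud (hd hb)]; simp [prodBasis]
  have e2 : (fun y => fderiv ℝ (fun z : E3 × ℝ => u (x - z.1) * Real.cosh (τ * z.2)) y
      (prodBasis none)) = fun z : E3 × ℝ => u (x - z.1) * (τ * Real.sinh (τ * z.2)) :=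
    funext fun y => by rw [fderiv_mul_prod hud (hd hb), hbd]; simp [prodBasis, pd]
  have e3 : ∀ i y, pd (basisVec i) (-pd (basisVec i) u) y =
      -pd (basisVec i) (pd (basisVec i) u) y :=
    fun i y => by rw [pd, fderiv_neg]; rfl
  rw [Fintype.sum_option, e2, fderiv_mul_prod hud (hd hb2), hbd2]
  simp_rw [e1]
  have e4 : ∀ i, fderiv ℝ (fun z : E3 × ℝ => (-pd (basisVec i) u) (x - z.1) *
      Real.cosh (τ * z.2)) z (prodBasis (some i)) =
      pd (basisVec i) (pd (basisVec i) u) (x - z.1) * Real.cosh (τ * z.2) := fun i => by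
    have hn : ContDiff ℝ ∞ (-pd (basisVec i) u) := (contDiff_pd hu _).neg
    rw [fderiv_mul_prod (hn.differentiable (by simp)) (hd hb)]
    simp [prodBasis, e3]
  simp_rw [e4]
  rw [← Finset.sum_mul, h]
  simp [prodBasis, pd]
  ring

/-- The integral is a convolution in `s` evaluated at 0, with smooth parameter `y`. Outside the ball
of radius `max R 1` one has s² > R, so the supports in `s` are uniformly compact. -/
theorem contDiff_integral_radial {h : ℝ → ℝ} (hh : ContDiff ℝ ∞ h) {R : ℝ}
    (hz : ∀ r, R ≤ r → h r = 0) {b : ℝ → ℝ} (hb : Continuous b) :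
    ContDiff ℝ ∞ fun y : E3 => ∫ s, h (‖y‖ ^ 2 + s ^ 2) * b s := by
  have hg : ContDiffOn ℝ ∞ (↿fun (y : E3) (s : ℝ) => h (‖y‖ ^ 2 + s ^ 2))
      (Set.univ ×ˢ Set.univ) := by
    refine ContDiff.contDiffOn ?_
    exact hh.comp ((contDiff_fst.norm_sq ℝ).add (contDiff_snd.pow 2))
  have key := contDiffOn_convolution_right_with_param_comp (μ := volume) (𝕜 := ℝ)
    (ContinuousLinearMap.lsmul ℝ ℝ)
    (v := fun _ : E3 => (0 : ℝ)) contDiffOn_const isOpen_univ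
    (isCompact_closedBall (0 : ℝ) (max R 1)) (f := b)
    (g := fun (y : E3) (s : ℝ) => h (‖y‖ ^ 2 + s ^ 2)) (fun y s _ hs => hz _ ?_)
    hb.locallyIntegrable hg
  · rw [contDiffOn_univ] at key
    convert key using 2 with y
    simp only [convolution, ContinuousLinearMap.lsmul_apply, smul_eq_mul, zero_sub, even_two,
      Even.neg_pow]
    exact integral_congr_ae (Eventually.of_forall fun s => mul_comm _ _)
  · rw [mem_closedBall_zero_iff, not_le, Real.norm_eq_abs, max_lt_iff] at hs
    nlinarith [sq_abs s, sq_nonneg ‖y‖, abs_nonneg s]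

/-- The harmonic extension obeys a mean value formula with a radial weight in ℝ⁴. Integrating weight
times cosh(τs) over the extra variable leaves a smooth kernel on ℝ³ that reproduces Helmholtz
solutions up to a nonzero factor. -/
theorem exists_mean_value_mollifier (τ : ℝ) {R : ℝ} (hR : 0 < R) : ∃ k, IsMollifier k ∧
    tsupport k ⊆ Metric.closedBall 0 R ∧ ∃ l : ℝ, l ≠ 0 ∧ ∀ u : E3 → ℝ, ContDiff ℝ ∞ u → ∀ x,
      (∀ y ∈ Metric.closedBall x R,
        ∑ i, pd (basisVec i) (pd (basisVec i) u) y = -(τ ^ 2 * u y)) →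
      moll k u x = l * u x := by
  obtain ⟨h, g, hh, h0, h0', hz, gz, hg, hgd⟩ := exists_radial_profile (pow_pos hR 2)
  let N : E3 × ℝ → ℝ := fun z => ‖z.1‖ ^ 2 + z.2 ^ 2
  have hN : ContDiff ℝ ∞ N := (contDiff_fst.norm_sq ℝ).add (contDiff_snd.pow 2)
  have hNR : ∀ z : E3 × ℝ, z ∉ Metric.closedBall (0 : E3) R ×ˢ Metric.closedBall (0 : ℝ) R →
      R ^ 2 ≤ N z := fun z hz => by
    rw [Set.mem_prod, mem_closedBall_zero_iff, mem_closedBall_zero_iff, not_and_or, not_le,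
      not_le, Real.norm_eq_abs] at hz
    rcases hz with hz | hz
    · have := pow_le_pow_left₀ hR.le hz.le 2
      exact this.trans (le_add_of_nonneg_right (sq_nonneg _))
    · have := pow_le_pow_left₀ hR.le hz.le 2
      rw [sq_abs] at this
      exact this.trans (le_add_of_nonneg_left (sq_nonneg _))
  have hcpt : IsCompact (Metric.closedBall (0 : E3) R ×ˢ Metric.closedBall (0 : ℝ) R) :=
    (isCompact_closedBall _ _).prod (isCompact_closedBall _ _)
  have hKc : HasCompactSupport fun z => h (N z) :=
    HasCompactSupport.intro hcpt fun z hz' => hz _ (hNR z hz')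
  have hHc : HasCompactSupport fun z => g (N z) :=
    HasCompactSupport.intro hcpt fun z hz' => gz _ (hNR z hz')
  have hKcont : Continuous fun z => h (N z) := hh.continuous.comp hN.continuous
  have hHk : ∀ z a, fderiv ℝ (fun z => g (N z)) z (prodBasis a) = -(prodCoord a z * h (N z)) := by
    intro z a
    have d1 : HasFDerivAt N (2 • (innerSL ℝ z.1).comp (ContinuousLinearMap.fst ℝ E3 ℝ)
        + (2 * z.2) • ContinuousLinearMap.snd ℝ E3 ℝ) z := by
      have a1 := (ContinuousLinearMap.fst ℝ E3 ℝ).hasFDerivAt (x := z) |>.norm_sq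
      have a2 := (ContinuousLinearMap.snd ℝ E3 ℝ).hasFDerivAt (x := z) |>.pow 2
      simpa using! a1.add a2
    have d2 := ((hgd (N z)).comp_hasFDerivAt z d1).fderiv
    change fderiv ℝ (g ∘ N) z _ = _
    rw [d2]
    cases a with
    | none => simp [prodBasis, prodCoord]; ring
    | some i => simp [prodBasis, prodCoord, basisVec, EuclideanSpace.inner_single_right]; ring
  let ρ : E3 → ℝ := fun y => ∫ s, h (‖y‖ ^ 2 + s ^ 2) * Real.cosh (τ * s)
  have hcosh : Continuous fun s => Real.cosh (τ * s) := by fun_prop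
  have hρ : ContDiff ℝ ∞ ρ := contDiff_integral_radial hh hz hcosh
  have hρz : ∀ y ∉ Metric.closedBall (0 : E3) R, ρ y = 0 := fun y hy => by
    refine integral_eq_zero_of_ae (Eventually.of_forall fun s => ?_)
    have := hz _ (hNR (y, s) fun h' => hy h'.1)
    simp only [N] at this
    simp [this]
  have hρc : HasCompactSupport ρ := HasCompactSupport.intro (isCompact_closedBall _ _) hρz
  have hρ0 : ∀ y, 0 ≤ ρ y := fun y =>
    integral_nonneg fun s => mul_nonneg (h0 _) (Real.cosh_pos _).le
  have hρ00 : 0 < ρ 0 := by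
    refine Continuous.integral_pos_of_hasCompactSupport_nonneg_nonzero (x := 0) ?_ ?_ ?_ ?_
    · exact (hh.continuous.comp (by fun_prop)).mul hcosh
    · refine HasCompactSupport.intro (isCompact_closedBall (0 : ℝ) R) fun s hs => ?_
      have := hz _ (hNR ((0 : E3), s) fun h' => hs h'.2)
      simp only [N] at this
      simp only [this, zero_mul]
    · exact fun s => mul_nonneg (h0 _) (Real.cosh_pos _).le
    · simpa using h0'.ne'
  have hρi : 0 < ∫ y, ρ y := hρ.continuous.integral_pos_of_hasCompactSupport_nonneg_nonzero
    hρc hρ0 hρ00.ne'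
  have hKi : 0 < ∫ z, h (N z) := hKcont.integral_pos_of_hasCompactSupport_nonneg_nonzero hKc
    (fun z => h0 _) (x := 0) (by simpa [N] using h0'.ne')
  set m := ∫ y, ρ y with hm
  have hρs : tsupport ρ ⊆ Metric.closedBall 0 R :=
    closure_minimal (fun y hy => by_contra fun h' => hy (hρz y h')) Metric.isClosed_closedBall
  -- Dividing by the mass of `ρ` normalises the kernel. The factor `l` is the mass of the weight in
  -- ℝ⁴ without cosh over the mass with it.
  refine ⟨fun y => m⁻¹ * ρ y, ⟨contDiff_const.mul hρ, hρc.mul_left, fun y =>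
    mul_nonneg (inv_nonneg.2 hρi.le) (hρ0 y), ?_⟩, ?_, m⁻¹ * ∫ z, h (N z), ?_, ?_⟩
  · rw [integral_const_mul, ← hm, inv_mul_cancel₀ hρi.ne']
  · exact (tsupport_mul_subset_right (f := fun _ => m⁻¹) (g := ρ)).trans hρs
  · exact mul_ne_zero (inv_ne_zero hρi.ne') hKi.ne'
  · intro u hu x hx
    have hV : ContDiff ℝ ∞ fun z : E3 × ℝ => u (x - z.1) * Real.cosh (τ * z.2) :=
      contDiff_mul_prod hu (Real.contDiff_cosh.comp (contDiff_const.mul contDiff_id)) x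
    have key := integral_mul_eq_of_laplacian_eq_zero
      (μ := (volume : Measure E3).prod (volume : Measure ℝ))
      prodBasis prodCoord prodBasis_sum hKcont hKc
      (hg.comp (hN.of_le (by simp))) hHc hHk hV (fun z hz' t ht => by
        refine helmholtz_extension hu τ x (t • z) (hx _ ?_)
        have hz1 : z.1 ∈ Metric.closedBall (0 : E3) R := by
          by_contra h'
          exact hz' (gz _ (hNR z fun h'' => h' h''.1))
        rw [mem_closedBall_zero_iff] at hz1
        rw [mem_closedBall_iff_norm]
        simp only [Prod.smul_fst, sub_sub_cancel_left, norm_neg, norm_smul, Real.norm_eq_abs,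
          abs_of_nonneg ht.1]
        nlinarith [ht.1, ht.2, norm_nonneg z.1])
    have hint : Integrable (fun z : E3 × ℝ => h (N z) * (u (x - z.1) * Real.cosh (τ * z.2)))
        (volume.prod volume) :=
      (hKcont.mul hV.continuous).integrable_of_hasCompactSupport hKc.mul_right
    rw [integral_prod _ hint] at key
    rw [moll_apply]
    calc ∫ y, (m⁻¹ * ρ y) • u (x - y) = m⁻¹ * ∫ y, ρ y * u (x - y) := by
          rw [← integral_const_mul]
          exact integral_congr_ae (Eventually.of_forall fun y => by simp [mul_assoc])
      _ = m⁻¹ * ∫ y, ∫ s, h (N (y, s)) * (u (x - y) * Real.cosh (τ * s)) := by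
          congr 1
          refine integral_congr_ae (Eventually.of_forall fun y => ?_)
          simp only [ρ, N]
          rw [← integral_mul_const]
          exact integral_congr_ae (Eventually.of_forall fun s => by ring)
      _ = _ := by
          rw [key]
          simp [Measure.volume_eq_prod, mul_assoc]

/-! ### Regularity of weak solutions of `curl n = - τ n`, `div n = 0` -/

theorem pd_congr_of_eqOn {F : Type*} [NormedAddCommGroup F] [NormedSpace ℝ F] {U : Set E3}
    (hU : IsOpen U) {f g : E3 → F} (h : ∀ x ∈ U, f x = g x) {x : E3} (hx : x ∈ U) (v : E3) :
    pd v f x = pd v g x := by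
  have : f =ᶠ[𝓝 x] g := by filter_upwards [hU.mem_nhds hx] with y hy using h y hy
  rw [pd, this.fderiv_eq, pd]

/-- The vector field `u` satisfies `div u = 0` and `curl u = - τ u` at the point `x`. -/
def IsBeltramiAt (τ : ℝ) (u : E3 → E3) (x : E3) : Prop :=
  divOf (fderiv ℝ u x) = 0 ∧ curlOf (fderiv ℝ u x) = -(τ • u x)

theorem IsBeltramiAt.pd_eq {τ : ℝ} {u : E3 → E3} {x : E3} (h : IsBeltramiAt τ u x)
    (hu : ContDiff ℝ ∞ u) :
    pd (basisVec 0) (fun y => u y 0) x + pd (basisVec 1) (fun y => u y 1) x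
      + pd (basisVec 2) (fun y => u y 2) x = 0 ∧
    pd (basisVec 1) (fun y => u y 2) x - pd (basisVec 2) (fun y => u y 1) x = -(τ * u x 0) ∧
    pd (basisVec 2) (fun y => u y 0) x - pd (basisVec 0) (fun y => u y 2) x = -(τ * u x 1) ∧
    pd (basisVec 0) (fun y => u y 1) x - pd (basisVec 1) (fun y => u y 0) x = -(τ * u x 2) := by
  have hd : DifferentiableAt ℝ u x := hu.differentiable (by simp) x
  obtain ⟨h1, h2⟩ := h
  simp only [← jacobian_fderiv hd]
  refine ⟨?_, ?_, ?_, ?_⟩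
  · rw [← h1, divOf, Matrix.trace_fin_three]
  · simpa [curlOf] using congrArg (fun w : E3 => w 0) h2
  · simpa [curlOf] using congrArg (fun w : E3 => w 1) h2
  · simpa [curlOf] using congrArg (fun w : E3 => w 2) h2

theorem pd_add {f g : E3 → ℝ} (hf : ContDiff ℝ ∞ f) (hg : ContDiff ℝ ∞ g) (v x : E3) :
    pd v (fun y => f y + g y) x = pd v f x + pd v g x := by
  rw [pd, fderiv_fun_add (hf.differentiable (by simp) x) (hg.differentiable (by simp) x)]; rfl

theorem pd_sub {f g : E3 → ℝ} (hf : ContDiff ℝ ∞ f) (hg : ContDiff ℝ ∞ g) (v x : E3) :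
    pd v (fun y => f y - g y) x = pd v f x - pd v g x := by
  rw [pd, fderiv_fun_sub (hf.differentiable (by simp) x) (hg.differentiable (by simp) x)]; rfl

theorem pd_const (c : ℝ) (v x : E3) : pd v (fun _ => c) x = 0 := by
  simp [pd]

theorem pd_neg_const_mul {f : E3 → ℝ} (hf : ContDiff ℝ ∞ f) (c : ℝ) (v x : E3) :
    pd v (fun y => -(c * f y)) x = -(c * pd v f x) := by
  rw [pd, fderiv_fun_neg, fderiv_const_mul (hf.differentiable (by simp) x)]; rfl

/-- Δu = ∇ div u - curl curl u, and applying curl u = -τu twice gives curl curl u = τ²u. The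
equations are differentiated, so they are needed on an open set. -/
theorem laplacian_of_isBeltrami {τ : ℝ} {u : E3 → E3} (hu : ContDiff ℝ ∞ u) {U : Set E3}
    (hU : IsOpen U) (h : ∀ x ∈ U, IsBeltramiAt τ u x) {x : E3} (hx : x ∈ U) (i : Fin 3) :
    ∑ j, pd (basisVec j) (pd (basisVec j) fun y => u y i) x = -(τ ^ 2 * u x i) := by
  have hc := contDiff_coord hu
  have hp : ∀ i j, ContDiff ℝ ∞ (pd (basisVec j) fun y => u y i) := fun i j =>
    contDiff_pd (hc i) _
  have h0 := fun v => pd_congr_of_eqOn hU (fun y hy => ((h y hy).pd_eq hu).1) hx v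
  have h1 := fun v => pd_congr_of_eqOn hU (fun y hy => ((h y hy).pd_eq hu).2.1) hx v
  have h2 := fun v => pd_congr_of_eqOn hU (fun y hy => ((h y hy).pd_eq hu).2.2.1) hx v
  have h3 := fun v => pd_congr_of_eqOn hU (fun y hy => ((h y hy).pd_eq hu).2.2.2) hx v
  simp only [pd_sub (hp _ _) (hp _ _), pd_neg_const_mul (hc _), pd_const,
    pd_add (hp _ _) (hp _ _), pd_add ((hp _ _).add (hp _ _)) (hp _ _)] at h0 h1 h2 h3
  have hs := fun (i : Fin 3) (v w : E3) => pd_pd_comm (hc i) v w x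
  obtain ⟨-, k1, k2, k3⟩ := (h x hx).pd_eq hu
  have s01 := fun i => hs i (basisVec 0) (basisVec 1)
  have s02 := fun i => hs i (basisVec 0) (basisVec 2)
  have s12 := fun i => hs i (basisVec 1) (basisVec 2)
  rw [Fin.sum_univ_three]
  fin_cases i <;> simp only [Fin.zero_eta, Fin.mk_one, Fin.reduceFinMk]
  · linear_combination h0 (basisVec 0) - h3 (basisVec 1) + h2 (basisVec 2) - s01 1 - s02 2 + τ * k1
  · linear_combination h0 (basisVec 1) + h3 (basisVec 0) - h1 (basisVec 2) + s01 0 - s12 2 + τ * k2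
  · linear_combination h0 (basisVec 2) - h2 (basisVec 0) + h1 (basisVec 1) + s02 0 + s12 1 + τ * k3

theorem clm_moll {F F' : Type*} [NormedAddCommGroup F] [NormedSpace ℝ F] [CompleteSpace F]
    [NormedAddCommGroup F'] [NormedSpace ℝ F'] [CompleteSpace F'] {k : E3 → ℝ}
    (hk : IsMollifier k) {f : E3 → F} (hf : LocallyIntegrable f) (L : F →L[ℝ] F') (x : E3) :
    L (moll k f x) = moll k (fun y => L (f y)) x := by
  rw [moll_apply, moll_apply, ← L.integral_comp_comm (hk.integrable_smul hf x)]
  simp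

theorem moll_congr_ae {F : Type*} [NormedAddCommGroup F] [NormedSpace ℝ F] {k : E3 → ℝ}
    {f g : E3 → F} (h : f =ᵐ[volume] g) (x : E3) : moll k f x = moll k g x := by
  rw [moll_apply_swap, moll_apply_swap]
  exact integral_congr_ae (by filter_upwards [h] with z hz; rw [hz])

theorem isBeltramiAt_moll (hΩ : IsOpen Ω) {k : E3 → ℝ} (hk : IsMollifier k) {τ : ℝ}
    {u : E3 → E3} {G : E3 → E3 →L[ℝ] E3} (h : HasWeakGrad Ω u G)
    (hu : MemLp u 2 (volume.restrict Ω)) (hG : MemLp G 2 (volume.restrict Ω))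
    (hd : ∀ᵐ x ∂(volume.restrict Ω), divOf (G x) = 0)
    (hc : ∀ᵐ x ∂(volume.restrict Ω), curlOf (G x) = -(τ • u x)) {x : E3}
    (hx : ∀ y ∈ tsupport k, x - y ∈ Ω) : IsBeltramiAt τ (moll k (Ω.indicator u)) x := by
  have lu := locallyIntegrable_indicator hΩ hu
  have lG := locallyIntegrable_indicator hΩ hG
  rw [ae_restrict_iff' hΩ.measurableSet] at hd hc
  rw [IsBeltramiAt, fderiv_moll_indicator hΩ hk h lu lG hx, ← divL_apply, ← curlL_apply,
    clm_moll hk lG, clm_moll hk lG]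
  constructor
  · rw [moll_congr_ae (g := fun _ => 0)]
    · simp [moll_apply]
    · filter_upwards [hd] with z hz
      by_cases hzΩ : z ∈ Ω
      · simpa [hzΩ] using hz hzΩ
      · simp [hzΩ]
  · rw [moll_congr_ae (g := fun y => -(τ • Ω.indicator u y))]
    · rw [moll_apply, moll_apply, ← integral_smul, ← integral_neg]
      refine integral_congr_ae (Eventually.of_forall fun y => ?_)
      simp only [smul_neg]
      rw [smul_comm]
    · filter_upwards [hc] with z hz
      by_cases hzΩ : z ∈ Ω
      · simpa [hzΩ] using hz hzΩ
      · simp [hzΩ]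

theorem enorm_moll_le {F : Type*} [NormedAddCommGroup F] [NormedSpace ℝ F] {k : E3 → ℝ}
    (hk : IsMollifier k) {f : E3 → F} (hf : AEStronglyMeasurable f) (x : E3) :
    ‖moll k f x‖ₑ ≤ eLpNorm (fun z => k (x - z)) 2 volume * eLpNorm f 2 volume := by
  rw [moll_apply_swap]
  refine (enorm_integral_le_lintegral_enorm _).trans ?_
  simp_rw [enorm_smul]
  exact lintegral_enorm_mul_le (hk.continuous.comp (by fun_prop)).aestronglyMeasurable hf

theorem IsMollifier.memLp_sub {k : E3 → ℝ} (hk : IsMollifier k) (x : E3) :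
    MemLp (fun z => k (x - z)) 2 volume :=
  (hk.continuous.comp (by fun_prop)).memLp_of_hasCompactSupport
    (hk.compact.comp_homeomorph (Homeomorph.subLeft x))

/-- The mollified functions at scales decreasing to zero. -/
theorem exists_mollifier_seq {F : Type*} [NormedAddCommGroup F] [NormedSpace ℝ F]
    [CompleteSpace F] {f : E3 → F} (hf : MemLp f 2) {r : ℝ} (hr : 0 < r) :
    ∃ k : ℕ → E3 → ℝ, (∀ j, IsMollifier (k j) ∧ tsupport (k j) ⊆ Metric.closedBall 0 r) ∧
      Tendsto (fun j => eLpNorm (moll (k j) f - f) 2) atTop (𝓝 0) := by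
  have : ∀ j : ℕ, ∃ k, (IsMollifier k ∧ tsupport k ⊆ Metric.closedBall 0 r) ∧
      eLpNorm (moll k f - f) 2 ≤ ENNReal.ofReal (1 / ((j : ℝ) + 1)) := fun j => by
    obtain ⟨δ, hδ, h⟩ := exists_delta_moll_sub_le hf
      (ENNReal.ofReal_pos.2 (Nat.one_div_pos_of_nat (α := ℝ) (n := j)))
    obtain ⟨k, hk, hks⟩ := exists_isMollifier 0 (lt_min hδ hr)
    exact ⟨k, ⟨hk, hks.trans (Metric.closedBall_subset_closedBall (min_le_right _ _))⟩,
      h k hk (hks.trans (Metric.closedBall_subset_closedBall (min_le_left _ _)))⟩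
  choose k h1 h2 using this
  refine ⟨k, h1, tendsto_of_tendsto_of_tendsto_of_le_of_le tendsto_const_nhds ?_
    (fun _ => zero_le) h2⟩
  have := ENNReal.tendsto_ofReal (tendsto_one_div_add_atTop_nhds_zero_nat (𝕜 := ℝ))
  rwa [ENNReal.ofReal_zero] at this

/-- Mollifications of `u` solve the same equations, hence are reproduced by the mean value kernel
`k`. In the limit u = l⁻¹ (k ∗ u) almost everywhere, and the right side is smooth. -/
theorem exists_local_smooth_representative (hΩ : IsOpen Ω) {τ : ℝ}
    {u : E3 → E3} {G : E3 → E3 →L[ℝ] E3} (h : HasWeakGrad Ω u G)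
    (hu : MemLp u 2 (volume.restrict Ω)) (hG : MemLp G 2 (volume.restrict Ω))
    (hd : ∀ᵐ x ∂(volume.restrict Ω), divOf (G x) = 0)
    (hc : ∀ᵐ x ∂(volume.restrict Ω), curlOf (G x) = -(τ • u x)) {x₀ : E3} (hx₀ : x₀ ∈ Ω) :
    ∃ r > 0, ∃ v : E3 → E3, ContDiff ℝ ∞ v ∧ Metric.ball x₀ r ⊆ Ω ∧
      v =ᵐ[volume.restrict (Metric.ball x₀ r)] u ∧
      ∀ x ∈ Metric.ball x₀ r, IsBeltramiAt τ v x := by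
  obtain ⟨R, hR, hRΩ⟩ := Metric.isOpen_iff.1 hΩ x₀ hx₀
  -- Three quarters are used: one for the ball of the conclusion, one for the mean value kernel, one
  -- for the mollification.
  have hr : 0 < R / 4 := by positivity
  obtain ⟨k, hk, hks, l, hl, hkl⟩ := exists_mean_value_mollifier τ hr
  have hf := memLp_indicator_of_restrict hΩ hu
  have lf := locallyIntegrable_indicator hΩ hu
  obtain ⟨κ, hκ, hκt⟩ := exists_mollifier_seq hf hr
  set f := Ω.indicator u with hfdef
  have hsub : Metric.ball x₀ (R / 4) ⊆ Ω :=
    (Metric.ball_subset_ball (by linarith)).trans hRΩ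
  have hbel : ∀ {k' : E3 → ℝ}, IsMollifier k' → tsupport k' ⊆ Metric.closedBall 0 (R / 4) →
      ∀ x ∈ Metric.ball x₀ (3 * (R / 4)), IsBeltramiAt τ (moll k' f) x := fun hk' hs x hx => by
    refine isBeltramiAt_moll hΩ hk' h hu hG hd hc fun y hy => hRΩ ?_
    have h1 := mem_closedBall_zero_iff.1 (hs hy)
    rw [mem_ball_iff_norm] at hx ⊢
    calc ‖x - y - x₀‖ = ‖(x - x₀) - y‖ := by congr 1; abel
      _ ≤ ‖x - x₀‖ + ‖y‖ := norm_sub_le _ _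
      _ < R := by linarith
  have hsm : ∀ j, ContDiff ℝ ∞ (moll (κ j) f) := fun j => (hκ j).1.contDiff_moll lf
  have mean : ∀ j, ∀ x ∈ Metric.ball x₀ (R / 4), moll k (moll (κ j) f) x = l • moll (κ j) f x := by
    intro j x hx
    ext i
    have e1 : moll k (moll (κ j) f) x i = moll k (fun y => moll (κ j) f y i) x :=
      clm_moll hk (hsm j).continuous.locallyIntegrable (EuclideanSpace.proj (𝕜 := ℝ) i) x
    rw [e1, hkl _ (contDiff_coord (hsm j) i) x fun y hy => ?_]
    · simp
    · refine laplacian_of_isBeltrami (hsm j) Metric.isOpen_ball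
        (hbel (hκ j).1 (hκ j).2) ?_ i
      rw [Metric.mem_closedBall] at hy
      rw [Metric.mem_ball] at hx ⊢
      linarith [dist_triangle y x x₀]
  have lim1 : ∀ x ∈ Metric.ball x₀ (R / 4),
      Tendsto (fun j => moll (κ j) f x) atTop (𝓝 (l⁻¹ • moll k f x)) := by
    intro x hx
    have hm : Tendsto (fun j => moll k (moll (κ j) f) x) atTop (𝓝 (moll k f x)) := by
      rw [tendsto_iff_edist_tendsto_0]
      refine tendsto_of_tendsto_of_tendsto_of_le_of_le tendsto_const_nhds
        (h := fun j => eLpNorm (fun z => k (x - z)) 2 volume * eLpNorm (moll (κ j) f - f) 2) ?_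
        (fun _ => zero_le) fun j => ?_
      · simpa using ENNReal.Tendsto.const_mul hκt (Or.inr (hk.memLp_sub x).2.ne)
      · have e : moll k (moll (κ j) f) x - moll k f x = moll k (moll (κ j) f - f) x := by
          rw [moll_apply k (moll (κ j) f), moll_apply k f, moll_apply k (moll (κ j) f - f),
            ← integral_sub (hk.integrable_smul (hsm j).continuous.locallyIntegrable x)
            (hk.integrable_smul lf x)]
          simp [smul_sub]
        change edist _ _ ≤ _
        rw [edist_eq_enorm_sub, e]
        exact enorm_moll_le hk ((hsm j).continuous.aestronglyMeasurable.sub hf.1) x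
    refine (hm.const_smul l⁻¹).congr fun j => ?_
    rw [mean j x hx, inv_smul_smul₀ hl]
  obtain ⟨σ, hσ, hσt⟩ := (tendstoInMeasure_of_tendsto_eLpNorm two_ne_zero
    (fun j => (hsm j).continuous.aestronglyMeasurable) hf.1 hκt).exists_seq_tendsto_ae
  refine ⟨R / 4, hr, fun x => l⁻¹ • moll k f x, (hk.contDiff_moll lf).const_smul l⁻¹, hsub,
    ?_, fun x hx => ?_⟩
  · rw [EventuallyEq, ae_restrict_iff' measurableSet_ball]
    filter_upwards [hσt] with x h1 hx
    have := tendsto_nhds_unique h1 ((lim1 x hx).comp hσ.tendsto_atTop)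
    rw [← this, hfdef, Set.indicator_of_mem (hsub hx)]
  · have hB := hbel hk hks x (Metric.ball_subset_ball (by linarith) hx)
    have hdf : fderiv ℝ (fun x => l⁻¹ • moll k f x) x = l⁻¹ • fderiv ℝ (moll k f) x :=
      fderiv_fun_const_smul ((hk.contDiff_moll lf).differentiable (by simp) x) _
    rw [IsBeltramiAt, hdf, ← divL_apply, ← curlL_apply, map_smul, map_smul, divL_apply,
      curlL_apply, hB.1, hB.2]
    refine ⟨smul_zero _, ?_⟩
    rw [smul_neg, smul_comm]

/-- A field of unit vectors with `div u = 0` and `curl u = - τ u` in the weak sense agrees almost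
everywhere with a smooth one. -/
theorem exists_smooth_representative (hΩ : IsOpen Ω) {τ : ℝ}
    {u : E3 → E3} {G : E3 → E3 →L[ℝ] E3} (h : HasWeakGrad Ω u G)
    (hu : MemLp u 2 (volume.restrict Ω)) (hG : MemLp G 2 (volume.restrict Ω))
    (hd : ∀ᵐ x ∂(volume.restrict Ω), divOf (G x) = 0)
    (hc : ∀ᵐ x ∂(volume.restrict Ω), curlOf (G x) = -(τ • u x))
    (h1 : ∀ᵐ x ∂(volume.restrict Ω), ‖u x‖ = 1) :
    ∃ f : E3 → E3, u =ᵐ[volume.restrict Ω] f ∧ ∀ x ∈ Ω, ∃ r > 0, ∃ v : E3 → E3,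
      ContDiff ℝ ∞ v ∧ Metric.ball x r ⊆ Ω ∧ ∀ y ∈ Metric.ball x r,
        f y = v y ∧ ‖v y‖ = 1 ∧ IsBeltramiAt τ v y := by
  have loc := fun x (hx : x ∈ Ω) => exists_local_smooth_representative hΩ h hu hG hd hc hx
  choose! r hr v hv hrΩ hvu hB using loc
  -- Two local representatives are continuous and equal almost everywhere on the overlap, hence
  -- equal there, so they glue along the diagonal.
  have agree : ∀ x ∈ Ω, ∀ y ∈ Ω, ∀ z ∈ Metric.ball x (r x), z ∈ Metric.ball y (r y) →
      v x z = v y z := by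
    intro x hx y hy z hzx hzy
    refine Measure.eqOn_open_of_ae_eq (μ := volume)
      (U := Metric.ball x (r x) ∩ Metric.ball y (r y)) ?_
      (Metric.isOpen_ball.inter Metric.isOpen_ball) (hv x hx).continuous.continuousOn
      (hv y hy).continuous.continuousOn ⟨hzx, hzy⟩
    have a1 := ae_restrict_of_ae_restrict_of_subset
      (s := Metric.ball x (r x) ∩ Metric.ball y (r y)) Set.inter_subset_left (hvu x hx)
    have a2 := ae_restrict_of_ae_restrict_of_subset
      (s := Metric.ball x (r x) ∩ Metric.ball y (r y)) Set.inter_subset_right (hvu y hy)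
    filter_upwards [a1, a2] with w h1 h2
    rw [h1, h2]
  have fv : ∀ x ∈ Ω, ∀ y ∈ Metric.ball x (r x), v y y = v x y := fun x hx y hy =>
    agree y (hrΩ x hx hy) x hx y (Metric.mem_ball_self (hr y (hrΩ x hx hy))) hy
  refine ⟨fun x => v x x, ?_, fun x hx => ⟨r x, hr x hx, v x, hv x hx, hrΩ x hx, fun y hy =>
    ⟨fv x hx y hy, ?_, hB x hx y hy⟩⟩⟩
  · rw [EventuallyEq, ae_restrict_iff' hΩ.measurableSet, ae_iff]
    refine measure_null_of_locally_null _ fun x hx => ?_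
    have hxΩ : x ∈ Ω := by
      by_contra h'
      exact hx fun h'' => absurd h'' h'
    refine ⟨Metric.ball x (r x) ∩ {x | ¬(x ∈ Ω → u x = v x x)}, Filter.inter_mem
      (mem_nhdsWithin_of_mem_nhds (Metric.ball_mem_nhds x (hr x hxΩ))) self_mem_nhdsWithin, ?_⟩
    have := hvu x hxΩ
    rw [EventuallyEq, ae_restrict_iff' measurableSet_ball, ae_iff] at this
    refine measure_mono_null (fun y hy => ?_) this
    intro h'
    exact hy.2 fun _ => by rw [fv x hxΩ y hy.1, h' hy.1]
  · refine Measure.eqOn_open_of_ae_eq (μ := volume) (U := Metric.ball x (r x))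
      (f := fun y => ‖v x y‖) (g := fun _ => 1) ?_ Metric.isOpen_ball
      (hv x hx).continuous.norm.continuousOn continuousOn_const hy
    have a1 := ae_restrict_of_ae_restrict_of_subset (hrΩ x hx) h1
    filter_upwards [hvu x hx, a1] with w h1 h2
    rw [h1, h2]

/-! ### Smooth unit fields with `div v = 0` and `curl v = - τ v` -/

/-- On the plane orthogonal to v the matrix acts as a 2 × 2 matrix with trace and trace of the
square zero, so its determinant vanishes and the rank is at most one. In coordinates, the cofactor
matrix has the form v ⊗ c; A v = 0 makes c parallel to v, and the trace of the cofactor matrix is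
zero. -/
theorem minors_eq_zero {A : Matrix (Fin 3) (Fin 3) ℝ} {v : Fin 3 → ℝ} (hv : ∑ i, v i ^ 2 = 1)
    (h1 : ∀ j, ∑ i, v i * A i j = 0) (h2 : ∀ i, ∑ j, A i j * v j = 0) (h3 : A.trace = 0)
    (h4 : (A * A).trace = 0) (i k j l : Fin 3) : A i j * A k l = A i l * A k j := by
  simp only [Fin.sum_univ_three, Matrix.trace_fin_three, Matrix.mul_apply] at *
  -- the cross products of the columns are multiples `c` of `v`
  have par : ∀ j l, A 1 j * A 2 l - A 2 j * A 1 l = (v 0 * (A 1 j * A 2 l - A 2 j * A 1 l)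
        + v 1 * (A 2 j * A 0 l - A 0 j * A 2 l) + v 2 * (A 0 j * A 1 l - A 1 j * A 0 l)) * v 0 ∧
      A 2 j * A 0 l - A 0 j * A 2 l = (v 0 * (A 1 j * A 2 l - A 2 j * A 1 l)
        + v 1 * (A 2 j * A 0 l - A 0 j * A 2 l) + v 2 * (A 0 j * A 1 l - A 1 j * A 0 l)) * v 1 ∧
      A 0 j * A 1 l - A 1 j * A 0 l = (v 0 * (A 1 j * A 2 l - A 2 j * A 1 l)
        + v 1 * (A 2 j * A 0 l - A 0 j * A 2 l) + v 2 * (A 0 j * A 1 l - A 1 j * A 0 l)) * v 2 := by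
    intro j l
    refine ⟨?_, ?_, ?_⟩
    · linear_combination -(A 1 j * A 2 l - A 2 j * A 1 l) * hv
        + (v 1 * A 2 l - v 2 * A 1 l) * h1 j - (v 1 * A 2 j - v 2 * A 1 j) * h1 l
    · linear_combination -(A 2 j * A 0 l - A 0 j * A 2 l) * hv
        + (v 2 * A 0 l - v 0 * A 2 l) * h1 j - (v 2 * A 0 j - v 0 * A 2 j) * h1 l
    · linear_combination -(A 0 j * A 1 l - A 1 j * A 0 l) * hv
        + (v 0 * A 1 l - v 1 * A 0 l) * h1 j - (v 0 * A 1 j - v 1 * A 0 j) * h1 l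
  obtain ⟨p00, p01, p02⟩ := par 1 2
  obtain ⟨p10, p11, p12⟩ := par 2 0
  obtain ⟨p20, p21, p22⟩ := par 0 1
  set c0 := v 0 * (A 1 1 * A 2 2 - A 2 1 * A 1 2) + v 1 * (A 2 1 * A 0 2 - A 0 1 * A 2 2)
    + v 2 * (A 0 1 * A 1 2 - A 1 1 * A 0 2) with hc0
  set c1 := v 0 * (A 1 2 * A 2 0 - A 2 2 * A 1 0) + v 1 * (A 2 2 * A 0 0 - A 0 2 * A 2 0)
    + v 2 * (A 0 2 * A 1 0 - A 1 2 * A 0 0) with hc1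
  set c2 := v 0 * (A 1 0 * A 2 1 - A 2 0 * A 1 1) + v 1 * (A 2 0 * A 0 1 - A 0 0 * A 2 1)
    + v 2 * (A 0 0 * A 1 1 - A 1 0 * A 0 1) with hc2
  have q0 : v 1 * c2 = v 2 * c1 := by
    rw [hc1, hc2]
    linear_combination (v 1 * A 2 0 - v 2 * A 1 0) * h2 0 + (v 2 * A 0 0 - v 0 * A 2 0) * h2 1
      + (v 0 * A 1 0 - v 1 * A 0 0) * h2 2
  have q1 : v 2 * c0 = v 0 * c2 := by
    rw [hc0, hc2]
    linear_combination (v 1 * A 2 1 - v 2 * A 1 1) * h2 0 + (v 2 * A 0 1 - v 0 * A 2 1) * h2 1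
      + (v 0 * A 1 1 - v 1 * A 0 1) * h2 2
  have q2 : v 0 * c1 = v 1 * c0 := by
    rw [hc0, hc1]
    linear_combination (v 1 * A 2 2 - v 2 * A 1 2) * h2 0 + (v 2 * A 0 2 - v 0 * A 2 2) * h2 1
      + (v 0 * A 1 2 - v 1 * A 0 2) * h2 2
  -- The trace of the cofactor matrix is ((tr A)² - tr A²)/2.
  have tr : c0 * v 0 + c1 * v 1 + c2 * v 2 = 0 := by
    rw [← p00, ← p11, ← p22]
    linear_combination (1 / 2) * (A 0 0 + A 1 1 + A 2 2) * h3 - (1 / 2) * h4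
  have z0 : c0 = 0 := by
    linear_combination -c0 * hv + v 0 * tr - v 1 * q2 + v 2 * q1
  have z1 : c1 = 0 := by
    linear_combination -c1 * hv + v 1 * tr - v 2 * q0 + v 0 * q2
  have z2 : c2 = 0 := by
    linear_combination -c2 * hv + v 2 * tr - v 0 * q1 + v 1 * q0
  clear_value c0 c1 c2
  subst z0 z1 z2
  simp only [zero_mul] at p00 p01 p02 p10 p11 p12 p20 p21 p22
  fin_cases i <;> fin_cases k <;> fin_cases j <;> fin_cases l <;>
    simp only [Fin.zero_eta, Fin.mk_one, Fin.reduceFinMk] <;> linarith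

theorem pd_inner {f g : E3 → E3} (hf : ContDiff ℝ ∞ f) (hg : ContDiff ℝ ∞ g) (v x : E3) :
    pd v (fun y => inner ℝ (f y) (g y)) x =
      inner ℝ (pd v f x) (g x) + inner ℝ (f x) (pd v g x) := by
  rw [pd, fderiv_inner_apply ℝ (hf.differentiable (by simp) x) (hg.differentiable (by simp) x)]
  simp only [pd]; ring

theorem pd_sum {F ι : Type*} [NormedAddCommGroup F] [NormedSpace ℝ F] [Fintype ι] {f : ι → E3 → F}
    (hf : ∀ i, ContDiff ℝ ∞ (f i)) (v x : E3) :
    pd v (fun y => ∑ i, f i y) x = ∑ i, pd v (f i) x := by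
  rw [pd, fderiv_fun_sum fun i _ => (hf i).differentiable (by simp) x]
  simp [pd, sum_apply]

theorem pd_coord {f : E3 → E3} (hf : ContDiff ℝ ∞ f) (v x : E3) (i : Fin 3) :
    pd v (fun y => f y i) x = pd v f x i := by
  have h := ((EuclideanSpace.proj (𝕜 := ℝ) i : E3 →L[ℝ] ℝ).hasFDerivAt.comp x
    (hf.differentiable (by simp) x).hasFDerivAt).fderiv
  change fderiv ℝ ((EuclideanSpace.proj (𝕜 := ℝ) i : E3 →L[ℝ] ℝ) ∘ f) x _ = _
  rw [h]; rfl

theorem pd_neg_const_smul {f : E3 → E3} (hf : ContDiff ℝ ∞ f) (c : ℝ) (v x : E3) :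
    pd v (fun y => -(c • f y)) x = -(c • pd v f x) := by
  rw [pd, fderiv_fun_neg, fderiv_fun_const_smul (hf.differentiable (by simp) x)]; rfl

/-- The Hessian of a smooth unit Beltrami field. -/
theorem hessian_of_isBeltrami {τ : ℝ} {v : E3 → E3} (hv : ContDiff ℝ ∞ v) {U : Set E3}
    (hU : IsOpen U) (hn : ∀ x ∈ U, ‖v x‖ = 1) (h : ∀ x ∈ U, IsBeltramiAt τ v x) {x : E3}
    (hx : x ∈ U) :
    (∀ j, inner ℝ (v x) (pd (basisVec j) v x) = 0) ∧
    (∑ j, inner ℝ (pd (basisVec j) v x) (pd (basisVec j) v x) = τ ^ 2) ∧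
    (∀ i j k l, inner ℝ (pd (basisVec i) v x) (pd (basisVec j) v x) *
      inner ℝ (pd (basisVec k) v x) (pd (basisVec l) v x) =
      inner ℝ (pd (basisVec i) v x) (pd (basisVec l) v x) *
      inner ℝ (pd (basisVec k) v x) (pd (basisVec j) v x)) ∧
    ∀ i j, pd (basisVec j) (pd (basisVec i) v) x =
      -((inner ℝ (pd (basisVec i) v x) (pd (basisVec j) v x) : ℝ) • v x) := by
  let D : Fin 3 → (E3 → E3) → E3 → E3 := fun j f => pd (basisVec j) f
  have hD : ∀ {f : E3 → E3}, ContDiff ℝ ∞ f → ∀ j, ContDiff ℝ ∞ (D j f) := fun hf j =>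
    contDiff_pd hf _
  have comm : ∀ {f : E3 → E3}, ContDiff ℝ ∞ f → ∀ i j, D i (D j f) = D j (D i f) :=
    fun hf i j => funext fun y => pd_pd_comm hf _ _ y
  have Dcongr : ∀ {f g : E3 → E3}, (∀ x ∈ U, f x = g x) → ∀ x ∈ U, ∀ j, D j f x = D j g x :=
    fun hfg x hx j => pd_congr_of_eqOn hU hfg hx _
  have lap : ∀ x ∈ U, ∑ k, D k (D k v) x = -(τ ^ 2 • v x) := by
    intro x hx
    ext i
    have := laplacian_of_isBeltrami hv hU h hx i
    have e : ∀ k, (D k (D k v) x) i = pd (basisVec k) (pd (basisVec k) fun y => v y i) x :=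
      fun k => by
        rw [← pd_coord (hD hv k)]
        congr 1
        exact funext fun y => (pd_coord hv _ y i).symm
    rw [Fin.sum_univ_three] at this ⊢
    simpa [e] using this
  have f1 : ∀ x ∈ U, ∀ j, inner ℝ (v x) (D j v x) = 0 := fun x hx j => by
    have := pd_congr_of_eqOn hU (f := fun y => inner ℝ (v y) (v y)) (g := fun _ => (1 : ℝ))
      (fun y hy => by rw [real_inner_self_eq_norm_sq, hn y hy, one_pow]) hx (basisVec j)
    rw [pd_inner hv hv, pd_const, real_inner_comm] at this
    change inner ℝ (v x) (D j v x) + inner ℝ (v x) (D j v x) = 0 at this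
    linarith
  have f2 : ∀ x ∈ U, ∀ k j, inner ℝ (D k v x) (D j v x) + inner ℝ (v x) (D k (D j v) x) = 0 :=
    fun x hx k j => by
      have := pd_congr_of_eqOn hU (g := fun _ => (0 : ℝ)) (fun y hy => f1 y hy j) hx (basisVec k)
      rwa [pd_inner hv (hD hv j), pd_const] at this
  -- Half the Laplacian of |v|² = 1: 0 = |Dv|² + v·Δv = |Dv|² - τ².
  have f4 : ∀ x ∈ U, ∑ j, inner ℝ (D j v x) (D j v x) = τ ^ 2 := fun x hx => by
    have s : ∑ j, (inner ℝ (D j v x) (D j v x) + inner ℝ (v x) (D j (D j v) x)) = 0 :=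
      Finset.sum_eq_zero fun j _ => f2 x hx j j
    rw [Finset.sum_add_distrib, ← inner_sum, lap x hx, inner_neg_right, inner_smul_right,
      real_inner_self_eq_norm_sq, hn x hx] at s
    linarith
  have f5 : ∀ x ∈ U, ∀ k, ∑ j, inner ℝ (D k (D j v) x) (D j v x) = 0 := fun x hx k => by
    have := pd_congr_of_eqOn hU (g := fun _ => (τ ^ 2 : ℝ)) f4 hx (basisVec k)
    rw [pd_const, pd_sum fun j => (hD hv j).inner ℝ (hD hv j)] at this
    have e : ∀ j, pd (basisVec k) (fun y => inner ℝ (D j v y) (D j v y)) x =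
        2 * inner ℝ (D k (D j v) x) (D j v x) := fun j => by
      rw [pd_inner (hD hv j) (hD hv j), real_inner_comm (pd _ _ _), two_mul]
    rw [Finset.sum_congr rfl fun j _ => e j, ← Finset.mul_sum] at this
    linarith
  have lapD : ∀ x ∈ U, ∀ j, ∑ k, D k (D k (D j v)) x = -(τ ^ 2 • D j v x) := fun x hx j => by
    have := Dcongr lap x hx j
    have e1 : D j (fun y => -(τ ^ 2 • v y)) x = -(τ ^ 2 • D j v x) := pd_neg_const_smul hv _ _ _
    have e2 : D j (fun y => ∑ k, D k (D k v) y) x = ∑ k, D j (D k (D k v)) x :=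
      pd_sum (fun k => hD (hD hv k) k) _ _
    rw [e1, e2] at this
    rw [← this]
    refine Finset.sum_congr rfl fun k _ => ?_
    rw [comm hv k j, comm (hD hv k) k j]
  -- Half the Laplacian of |Dv|² = τ²: |D²v|² = -∑ ∂ⱼv·Δ∂ⱼv = τ²|Dv|².
  have f6 : ∑ k, ∑ j, ‖D k (D j v) x‖ ^ 2 = τ ^ 4 := by
    have e : ∀ k, ∑ j, (inner ℝ (D k (D k (D j v)) x) (D j v x) + ‖D k (D j v) x‖ ^ 2) = 0 :=
      fun k => by
        have := pd_congr_of_eqOn hU (g := fun _ => (0 : ℝ)) (fun y hy => f5 y hy k) hx (basisVec k)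
        rw [pd_const, pd_sum fun j => (hD (hD hv j) k).inner ℝ (hD hv j)] at this
        rw [← this]
        refine Finset.sum_congr rfl fun j _ => ?_
        rw [pd_inner (hD (hD hv j) k) (hD hv j), ← real_inner_self_eq_norm_sq]
    have s : ∑ k, ∑ j, (inner ℝ (D k (D k (D j v)) x) (D j v x) + ‖D k (D j v) x‖ ^ 2) = 0 :=
      Finset.sum_eq_zero fun k _ => e k
    simp_rw [Finset.sum_add_distrib] at s
    rw [Finset.sum_comm] at s
    simp_rw [← sum_inner, lapD x hx, inner_neg_left, inner_smul_left] at s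
    rw [Finset.sum_neg_distrib, ← Finset.mul_sum, f4 x hx] at s
    simp only [conj_trivial] at s
    linarith
  have rank : ∀ i j k l, inner ℝ (D i v x) (D j v x) * inner ℝ (D k v x) (D l v x) =
      inner ℝ (D i v x) (D l v x) * inner ℝ (D k v x) (D j v x) := by
    have hd : DifferentiableAt ℝ v x := hv.differentiable (by simp) x
    set A := jacobian (fderiv ℝ v x) with hA
    have hAD : ∀ i j, A i j = D j v x i := fun i j => rfl
    have nv : ∑ i, v x i ^ 2 = 1 := by
      have := hn x hx
      rw [EuclideanSpace.norm_eq, Real.sqrt_eq_one] at this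
      simpa using this
    have a1 : ∀ j, ∑ i, v x i * A i j = 0 := fun j => by
      rw [← f1 x hx j, PiLp.inner_apply]
      simp [hAD, mul_comm]
    obtain ⟨b1, b2⟩ := h x hx
    have c0 : A 2 1 - A 1 2 = -(τ * v x 0) := by
      simpa [curlOf] using congrArg (fun w : E3 => w 0) b2
    have c1 : A 0 2 - A 2 0 = -(τ * v x 1) := by
      simpa [curlOf] using congrArg (fun w : E3 => w 1) b2
    have c2 : A 1 0 - A 0 1 = -(τ * v x 2) := by
      simpa [curlOf] using congrArg (fun w : E3 => w 2) b2
    -- The antisymmetric part of Dv acts as a multiple of curl v × (·), and curl v is parallel to v,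
    -- so both orders of contraction with v agree.
    have a2 : ∀ i, ∑ j, A i j * v x j = 0 := fun i => by
      have a0 := a1 i
      rw [Fin.sum_univ_three] at a0 ⊢
      fin_cases i <;> simp only [Fin.zero_eta, Fin.mk_one, Fin.reduceFinMk] at a0 ⊢
      · linear_combination a0 - v x 1 * c2 + v x 2 * c1
      · linear_combination a0 + v x 0 * c2 - v x 2 * c0
      · linear_combination a0 - v x 0 * c1 + v x 1 * c0
    have a4 : (A * A).trace = 0 := by
      have e1 := frobSq_eq (fderiv ℝ v x)
      rw [b2, norm_neg, norm_smul, hn x hx] at e1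
      have e2 : frobSq (fderiv ℝ v x) = τ ^ 2 := by
        rw [← f4 x hx, frobSq, Finset.sum_comm]
        refine Finset.sum_congr rfl fun j _ => ?_
        rw [real_inner_self_eq_norm_sq, EuclideanSpace.norm_sq_eq]
        exact Finset.sum_congr rfl fun i _ => by rw [Real.norm_eq_abs, sq_abs]; rfl
      rw [e2, Real.norm_eq_abs, mul_one, sq_abs] at e1
      linarith
    have min := minors_eq_zero nv a1 a2 b1 a4
    have ein : ∀ i j, inner ℝ (D i v x) (D j v x) = ∑ p, A p i * A p j := fun i j => by
      rw [PiLp.inner_apply]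
      simp [hAD, mul_comm]
    intro i j k l
    simp only [ein, Finset.sum_mul_sum]
    refine Finset.sum_congr rfl fun p _ => Finset.sum_congr rfl fun q _ => ?_
    linear_combination A p i * A q k * min p q j l
  refine ⟨f1 x hx, f4 x hx, rank, fun i j => ?_⟩
  -- The normal part of D²v is minus the Gram matrix. By rank one, its squared norm is the square of
  -- its trace, which already exhausts |D²v|²; the tangential part must vanish.
  have f7 : ∑ k, ∑ j, inner ℝ (v x) (D k (D j v) x) ^ 2 = τ ^ 4 := by
    have e : ∀ k j, inner ℝ (v x) (D k (D j v) x) ^ 2 =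
        inner ℝ (D k v x) (D k v x) * inner ℝ (D j v x) (D j v x) := fun k j => by
      have e1 := f2 x hx k j
      have e2 := rank k k j j
      rw [e2, show inner ℝ (v x) (D k (D j v) x) = -inner ℝ (D k v x) (D j v x) by linarith,
        real_inner_comm (D k v x) (D j v x)]
      ring
    simp_rw [e]
    rw [← Finset.sum_mul_sum, f4 x hx]; ring
  have f8 : ∀ k j, ‖D k (D j v) x - (inner ℝ (v x) (D k (D j v) x) : ℝ) • v x‖ ^ 2 =
      ‖D k (D j v) x‖ ^ 2 - inner ℝ (v x) (D k (D j v) x) ^ 2 := fun k j => by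
    rw [norm_sub_sq_real, inner_smul_right, norm_smul, hn x hx, real_inner_comm (D k (D j v) x),
      Real.norm_eq_abs, mul_one, sq_abs]
    ring
  have f9 : ∑ k, ∑ j, ‖D k (D j v) x - (inner ℝ (v x) (D k (D j v) x) : ℝ) • v x‖ ^ 2 = 0 := by
    simp_rw [f8, Finset.sum_sub_distrib]
    rw [f6, f7, sub_self]
  rw [Finset.sum_eq_zero_iff_of_nonneg fun _ _ => Finset.sum_nonneg fun _ _ => sq_nonneg _] at f9
  have f10 := (Finset.sum_eq_zero_iff_of_nonneg fun _ _ => sq_nonneg _).1 (f9 j (Finset.mem_univ _))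
    i (Finset.mem_univ _)
  have f11 := sub_eq_zero.1 (norm_eq_zero.1 (pow_eq_zero_iff two_ne_zero |>.1 f10))
  have f12 := f2 x hx j i
  change D j (D i v) x = _
  rw [f11, show inner ℝ (v x) (D j (D i v) x) = -inner ℝ (D j v x) (D i v x) by linarith, neg_smul,
    real_inner_comm]

/-! ### Reconstruction of the helix from its frame -/

theorem frame_mem_specialOrthogonalGroup {c s m : E3} (cc : ∑ i, c i * c i = 1)
    (ss : ∑ i, s i * s i = 1) (mm : ∑ i, m i * m i = 1) (cs : ∑ i, c i * s i = 0)
    (cm : ∑ i, c i * m i = 0) (sm : ∑ i, s i * m i = 0) (h0 : c 0 = s 1 * m 2 - s 2 * m 1)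
    (h1 : c 1 = s 2 * m 0 - s 0 * m 2) (h2 : c 2 = s 0 * m 1 - s 1 * m 0) :
    (Matrix.of fun i j => ![c i, s i, m i] j : Matrix (Fin 3) (Fin 3) ℝ) ∈
      Matrix.specialOrthogonalGroup (Fin 3) ℝ := by
  rw [Fin.sum_univ_three] at cc ss mm cs cm sm
  rw [Matrix.mem_specialOrthogonalGroup_iff, Matrix.mem_orthogonalGroup_iff']
  constructor
  · rw [← Matrix.ext_iff]
    intro i j
    rw [Matrix.mul_apply, Fin.sum_univ_three]
    fin_cases i <;> fin_cases j <;> simp <;> linarith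
  · rw [Matrix.det_fin_three]
    simp
    linear_combination cc - c 0 * h0 - c 1 * h1 - c 2 * h2

theorem rotatedHelix_frame (τ : ℝ) (c s m x : E3) :
    rotatedHelix τ (Matrix.of fun i j => ![c i, s i, m i] j) x =
      Real.cos (τ * inner ℝ m x) • c + Real.sin (τ * inner ℝ m x) • s := by
  have h : (Matrix.toEuclideanLin (Matrix.of fun i j => ![c i, s i, m i] j :
      Matrix (Fin 3) (Fin 3) ℝ).transpose x) 2 = inner ℝ m x := by
    simp [Matrix.toLpLin_apply, Matrix.mulVec, dotProduct, PiLp.inner_apply, mul_comm]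
  rw [rotatedHelix, helix, h]
  ext i
  simp [Matrix.toLpLin_apply, mul_comm]

theorem fderiv_eq_of_pd {F : Type*} [NormedAddCommGroup F] [NormedSpace ℝ F] {f : E3 → F} {x : E3}
    {m : E3} {b : F} {t : ℝ} (h : ∀ j, pd (basisVec j) f x = (t * m j) • b) :
    fderiv ℝ f x = (t • innerSL ℝ m).smulRight b := by
  refine ext_basisVec fun j => ?_
  change pd (basisVec j) f x = _
  rw [h]
  simp [basisVec, EuclideanSpace.inner_single_right]

/-- Smooth unit fields with `div f = 0` and `curl f = - τ f` are helices. -/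
theorem eq_rotatedHelix {Ω : Set E3} (hΩ : IsOpen Ω) (hconn : IsConnected Ω) {τ : ℝ} (hτ : 0 < τ)
    {f : E3 → E3} (hf : ∀ x ∈ Ω, ∃ r > 0, ∃ v : E3 → E3,
      ContDiff ℝ ∞ v ∧ Metric.ball x r ⊆ Ω ∧ ∀ y ∈ Metric.ball x r,
        f y = v y ∧ ‖v y‖ = 1 ∧ IsBeltramiAt τ v y) :
    ∃ Q ∈ Matrix.specialOrthogonalGroup (Fin 3) ℝ, ∀ x ∈ Ω, f x = rotatedHelix τ Q x := by
  have loc : ∀ x ∈ Ω, DifferentiableAt ℝ f x ∧ (∀ i, DifferentiableAt ℝ (pd (basisVec i) f) x) ∧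
      ‖f x‖ = 1 ∧ IsBeltramiAt τ f x ∧ (∀ j, inner ℝ (f x) (pd (basisVec j) f x) = 0) ∧
      (∑ j, inner ℝ (pd (basisVec j) f x) (pd (basisVec j) f x) = τ ^ 2) ∧
      (∀ i j k l, inner ℝ (pd (basisVec i) f x) (pd (basisVec j) f x) *
        inner ℝ (pd (basisVec k) f x) (pd (basisVec l) f x) =
        inner ℝ (pd (basisVec i) f x) (pd (basisVec l) f x) *
        inner ℝ (pd (basisVec k) f x) (pd (basisVec j) f x)) ∧
      ∀ i j, pd (basisVec j) (pd (basisVec i) f) x =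
        -((inner ℝ (pd (basisVec i) f x) (pd (basisVec j) f x) : ℝ) • f x) := by
    intro x hx
    obtain ⟨r, hr, v, hv, -, h⟩ := hf x hx
    have hxr := Metric.mem_ball_self (x := x) hr
    have e1 : ∀ y ∈ Metric.ball x r, ∀ i, pd (basisVec i) f y = pd (basisVec i) v y :=
      fun y hy i => pd_congr_of_eqOn Metric.isOpen_ball (fun z hz => (h z hz).1) hy _
    have e2 : ∀ i j, pd (basisVec j) (pd (basisVec i) f) x =
        pd (basisVec j) (pd (basisVec i) v) x :=
      fun i j => pd_congr_of_eqOn Metric.isOpen_ball (fun z hz => e1 z hz i) hxr _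
    have ev : f =ᶠ[𝓝 x] v := by
      filter_upwards [Metric.ball_mem_nhds x hr] with y hy using (h y hy).1
    have ev2 : ∀ i, pd (basisVec i) f =ᶠ[𝓝 x] pd (basisVec i) v := fun i => by
      filter_upwards [Metric.ball_mem_nhds x hr] with y hy using e1 y hy i
    have key := hessian_of_isBeltrami hv Metric.isOpen_ball (fun y hy => (h y hy).2.1)
      (fun y hy => (h y hy).2.2) hxr
    simp only [e2, e1 x hxr, (h x hxr).1, (h x hxr).2.1]
    refine ⟨(hv.differentiable (by simp) x).congr_of_eventuallyEq ev, fun i =>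
      ((contDiff_pd hv _).differentiable (by simp) x).congr_of_eventuallyEq (ev2 i),
      trivial, ?_, key⟩
    rw [IsBeltramiAt, ev.fderiv_eq, (h x hxr).1]
    exact (h x hxr).2.2
  obtain ⟨x₀, hx₀⟩ := hconn.nonempty
  -- the first fundamental form is constant
  have Gconst : ∀ i j, ∀ x ∈ Ω, inner ℝ (pd (basisVec i) f x) (pd (basisVec j) f x) =
      inner ℝ (pd (basisVec i) f x₀) (pd (basisVec j) f x₀) := by
    intro i j x hx
    refine hΩ.is_const_of_fderiv_eq_zero (𝕜 := ℝ) hconn.isPreconnected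
      (f := fun x => (inner ℝ (pd (basisVec i) f x) (pd (basisVec j) f x) : ℝ))
      (fun y hy => ((loc y hy).2.1 i).differentiableWithinAt.inner ℝ
        ((loc y hy).2.1 j).differentiableWithinAt) (fun y hy => ?_) hx hx₀
    obtain ⟨-, hd, -, -, h0, -, -, hh⟩ := loc y hy
    refine ext_basisVec fun k => ?_
    rw [fderiv_inner_apply ℝ (hd i) (hd j)]
    change inner ℝ _ (pd (basisVec k) (pd (basisVec j) f) y) +
      inner ℝ (pd (basisVec k) (pd (basisVec i) f) y) _ = 0
    rw [hh, hh, inner_neg_right, inner_neg_left, inner_smul_left, inner_smul_right,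
      real_inner_comm (f y) (pd (basisVec i) f y), h0, h0]
    simp
  set G : Fin 3 → Fin 3 → ℝ := fun i j => inner ℝ (pd (basisVec i) f x₀) (pd (basisVec j) f x₀)
    with hG
  obtain ⟨-, -, -, bel, -, trG, rkG, -⟩ := loc x₀ hx₀
  change ∑ j, G j j = τ ^ 2 at trG
  have rkG : ∀ i j k l, G i j * G k l = G i l * G k j := rkG
  have symG : ∀ i j, G i j = G j i := fun i j => real_inner_comm _ _
  obtain ⟨k, hk⟩ : ∃ k, 0 < G k k := by
    by_contra! h'
    have : ∑ j, G j j ≤ 0 := Finset.sum_nonpos fun j _ => h' j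
    have := pow_pos hτ 2
    linarith
  obtain ⟨g, hg, hgk⟩ : ∃ g : ℝ, 0 < g ∧ g ^ 2 = G k k :=
    ⟨√(G k k), Real.sqrt_pos.2 hk, Real.sq_sqrt hk.le⟩
  -- The constant Gram matrix has rank one and trace τ², so it is τ² m ⊗ m for a unit vector m, read
  -- off (up to sign) from a column with positive diagonal entry.
  let m : E3 := WithLp.toLp 2 fun i => G i k / (τ * g)
  have hm : ∀ i, m i = G i k / (τ * g) := fun i => rfl
  let β : E3 → E3 := fun x => g⁻¹ • pd (basisVec k) f x
  -- Rank one of the Gram matrix is equality in Cauchy–Schwarz: all partial derivatives are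
  -- multiples of ∂ₖf.
  have hfj : ∀ x ∈ Ω, ∀ j, pd (basisVec j) f x = (τ * m j) • β x := by
    intro x hx j
    have e : (τ * m j) • β x = (G j k / G k k) • pd (basisVec k) f x := by
      simp only [β, smul_smul, hm, ← hgk]
      congr 1
      field_simp
    have n1 : ‖pd (basisVec j) f x‖ ^ 2 = G j j := by
      rw [← real_inner_self_eq_norm_sq, Gconst _ _ x hx]
    have n2 : ‖pd (basisVec k) f x‖ ^ 2 = G k k := by
      rw [← real_inner_self_eq_norm_sq, Gconst _ _ x hx]
    have n3 : inner ℝ (pd (basisVec j) f x) (pd (basisVec k) f x) = G j k := Gconst _ _ x hx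
    rw [e, ← sub_eq_zero, ← norm_eq_zero, ← pow_eq_zero_iff two_ne_zero, norm_sub_sq_real,
      norm_smul, inner_smul_right, mul_pow, n1, n2, n3, Real.norm_eq_abs, sq_abs]
    have := rkG j j k k
    rw [symG k j] at this
    field_simp
    linear_combination this
  have hβj : ∀ x ∈ Ω, ∀ j, pd (basisVec j) β x = (-τ * m j) • f x := by
    intro x hx j
    obtain ⟨-, hd, -, -, -, -, -, hh⟩ := loc x hx
    have e : pd (basisVec j) β x = g⁻¹ • pd (basisVec j) (pd (basisVec k) f) x := by
      simp only [pd, β]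
      rw [fderiv_fun_const_smul]
      · rfl
      · exact hd k
    rw [e, hh, Gconst _ _ x hx, smul_neg, smul_smul, ← neg_smul, hm]
    change -(g⁻¹ * G k j) • f x = _
    rw [symG k j]
    congr 1
    field_simp
  let θ : E3 →L[ℝ] ℝ := τ • innerSL ℝ m
  have hθ : ∀ x, θ x = τ * inner ℝ m x := fun x => rfl
  have df : ∀ x ∈ Ω, HasFDerivAt f (θ.smulRight (β x)) x := fun x hx => by
    rw [← fderiv_eq_of_pd (hfj x hx)]; exact (loc x hx).1.hasFDerivAt
  have dβ : ∀ x ∈ Ω, HasFDerivAt β (-θ.smulRight (f x)) x := fun x hx => by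
    have e := fderiv_eq_of_pd (hβj x hx)
    have : DifferentiableAt ℝ β x := ((loc x hx).2.1 k).const_smul g⁻¹
    convert this.hasFDerivAt using 1
    rw [e]
    ext w
    simp [θ]
  have dθ : ∀ x, HasFDerivAt θ θ x := fun x => θ.hasFDerivAt
  -- The pair (f, β) rotates at rate τ in the direction m; undoing the rotation gives constant
  -- vectors, which are the first two columns of Q.
  let c : E3 → E3 := fun x => Real.cos (θ x) • f x - Real.sin (θ x) • β x
  let s : E3 → E3 := fun x => Real.sin (θ x) • f x + Real.cos (θ x) • β x
  have dc : ∀ x ∈ Ω, HasFDerivAt c 0 x := fun x hx => by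
    refine HasFDerivAt.congr_fderiv (f := c)
      (((dθ x).cos.smul (df x hx)).sub ((dθ x).sin.smul (dβ x hx))) ?_
    ext1 w
    simp
    module
  have ds : ∀ x ∈ Ω, HasFDerivAt s 0 x := fun x hx => by
    refine HasFDerivAt.congr_fderiv (f := s)
      (((dθ x).sin.smul (df x hx)).add ((dθ x).cos.smul (dβ x hx))) ?_
    ext1 w
    simp
    module
  have cconst : ∀ x ∈ Ω, c x = c x₀ := fun x hx =>
    hΩ.is_const_of_fderiv_eq_zero (𝕜 := ℝ) hconn.isPreconnected
      (fun y hy => (dc y hy).differentiableAt.differentiableWithinAt)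
      (fun y hy => (dc y hy).fderiv) hx hx₀
  have sconst : ∀ x ∈ Ω, s x = s x₀ := fun x hx =>
    hΩ.is_const_of_fderiv_eq_zero (𝕜 := ℝ) hconn.isPreconnected
      (fun y hy => (ds y hy).differentiableAt.differentiableWithinAt)
      (fun y hy => (ds y hy).fderiv) hx hx₀
  have inn : ∀ a b : E3, inner ℝ a b = ∑ i, a i * b i := fun a b => by
    simp [PiLp.inner_apply, mul_comm]
  have ff : ∑ i, f x₀ i * f x₀ i = 1 := by
    rw [← inn, real_inner_self_eq_norm_sq, (loc x₀ hx₀).2.2.1, one_pow]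
  have fβ : ∑ i, f x₀ i * β x₀ i = 0 := by
    rw [← inn, inner_smul_right, (loc x₀ hx₀).2.2.2.2.1, mul_zero]
  have ββ : ∑ i, β x₀ i * β x₀ i = 1 := by
    rw [← inn, inner_smul_right, inner_smul_left]
    change g⁻¹ * (g⁻¹ * G k k) = 1
    rw [← hgk]; field_simp
  have mm : ∑ i, m i * m i = 1 := by
    have e : ∀ i, m i * m i = G i i / τ ^ 2 := fun i => by
      have := rkG i i k k
      rw [symG k i] at this
      rw [hm]
      field_simp
      rw [hgk]
      linear_combination -this
    simp_rw [e]
    rw [← Finset.sum_div, trG, div_self (pow_pos hτ 2).ne']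
  have jac : ∀ i j, jacobian (fderiv ℝ f x₀) i j = τ * m j * β x₀ i := fun i j => by
    have := congrArg (fun w : E3 => w i) (hfj x₀ hx₀ j)
    simpa using! this
  obtain ⟨b1, b2⟩ := bel
  have mβ : ∑ i, β x₀ i * m i = 0 := by
    rw [divOf, Matrix.trace_fin_three, jac, jac, jac] at b1
    rw [Fin.sum_univ_three]
    refine (mul_eq_zero_iff_left hτ.ne').1 ?_
    linear_combination b1
  -- The curl equation at x₀ reads f = β × m. It fixes the orientation of the frame, hence the
  -- determinant +1.
  have c0 : f x₀ 0 = β x₀ 1 * m 2 - β x₀ 2 * m 1 := by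
    have := congrArg (fun w : E3 => w 0) b2
    simp [curlOf, jac] at this
    refine mul_left_cancel₀ hτ.ne' ?_
    linear_combination this
  have c1 : f x₀ 1 = β x₀ 2 * m 0 - β x₀ 0 * m 2 := by
    have := congrArg (fun w : E3 => w 1) b2
    simp [curlOf, jac] at this
    refine mul_left_cancel₀ hτ.ne' ?_
    linear_combination this
  have c2 : f x₀ 2 = β x₀ 0 * m 1 - β x₀ 1 * m 0 := by
    have := congrArg (fun w : E3 => w 2) b2
    simp [curlOf, jac] at this
    refine mul_left_cancel₀ hτ.ne' ?_
    linear_combination this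
  have fm : ∑ i, f x₀ i * m i = 0 := by
    rw [Fin.sum_univ_three, c0, c1, c2]; ring
  have hcs := Real.sin_sq_add_cos_sq (θ x₀)
  have hci : ∀ i, c x₀ i = Real.cos (θ x₀) * f x₀ i - Real.sin (θ x₀) * β x₀ i := fun i => rfl
  have hsi : ∀ i, s x₀ i = Real.sin (θ x₀) * f x₀ i + Real.cos (θ x₀) * β x₀ i := fun i => rfl
  have mm' := mm
  rw [Fin.sum_univ_three] at mm'
  refine ⟨_, frame_mem_specialOrthogonalGroup (c := c x₀) (s := s x₀) (m := m) ?_ ?_ mm ?_ ?_ ?_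
    ?_ ?_ ?_, fun x hx => ?_⟩
  any_goals simp only [hci, hsi, Fin.sum_univ_three] at ff fβ ββ mβ fm ⊢
  · linear_combination Real.cos (θ x₀) ^ 2 * ff - 2 * Real.cos (θ x₀) * Real.sin (θ x₀) * fβ
      + Real.sin (θ x₀) ^ 2 * ββ + hcs
  · linear_combination Real.sin (θ x₀) ^ 2 * ff + 2 * Real.cos (θ x₀) * Real.sin (θ x₀) * fβ
      + Real.cos (θ x₀) ^ 2 * ββ + hcs
  · linear_combination Real.cos (θ x₀) * Real.sin (θ x₀) * (ff - ββ)
      + (Real.cos (θ x₀) ^ 2 - Real.sin (θ x₀) ^ 2) * fβ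
  · linear_combination Real.cos (θ x₀) * fm - Real.sin (θ x₀) * mβ
  · linear_combination Real.sin (θ x₀) * fm + Real.cos (θ x₀) * mβ
  · linear_combination Real.cos (θ x₀) * c0 + Real.sin (θ x₀) *
      (m 1 * c2 - m 2 * c1 + β x₀ 0 * mm' - m 0 * mβ)
  · linear_combination Real.cos (θ x₀) * c1 + Real.sin (θ x₀) *
      (m 2 * c0 - m 0 * c2 + β x₀ 1 * mm' - m 1 * mβ)
  · linear_combination Real.cos (θ x₀) * c2 + Real.sin (θ x₀) *
      (m 0 * c1 - m 1 * c0 + β x₀ 2 * mm' - m 2 * mβ)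
  · change f x = rotatedHelix τ (Matrix.of fun i j => ![c x₀ i, s x₀ i, m i] j) x
    rw [rotatedHelix_frame, ← hθ, ← cconst x hx, ← sconst x hx]
    calc f x = (Real.sin (θ x) ^ 2 + Real.cos (θ x) ^ 2) • f x := by
          rw [Real.sin_sq_add_cos_sq, one_smul]
      _ = _ := by simp only [c, s]; module

/-! ### Convergence tools -/

theorem exists_cutoff (hΩ : IsOpen Ω) {D : Set E3} (hD : IsCompact D) (hDΩ : D ⊆ Ω) :
    ∃ η : E3 → ℝ, ContDiff ℝ ∞ η ∧ HasCompactSupport η ∧ tsupport η ⊆ Ω ∧ ∀ x ∈ D, η x = 1 := by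
  obtain ⟨δ, hδ, h⟩ := hD.exists_cthickening_subset_open hΩ hDΩ
  obtain ⟨f, h0, h1, -⟩ := exists_contMDiffMap_zero_one_of_isClosed (n := (⊤ : ℕ∞))
    (modelWithCornersSelf ℝ E3) (Metric.isOpen_thickening (δ := δ) (E := D)).isClosed_compl
    hD.isClosed (Set.disjoint_left.2 fun x hx hxD => hx (Metric.self_subset_thickening hδ D hxD))
  have hs : tsupport f ⊆ Metric.cthickening δ D :=
    closure_minimal (fun x hx => by_contra fun h' => hx (h0 fun hx' =>
      h' (Metric.thickening_subset_cthickening _ _ hx'))) Metric.isClosed_cthickening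
  exact ⟨f, f.contMDiff.contDiff, hD.cthickening.of_isClosed_subset (isClosed_tsupport _) hs,
    hs.trans h, fun x hx => h1 hx⟩

theorem ae_restrict_of_forall_isCompact (hΩ : IsOpen Ω) {p : E3 → Prop}
    (h : ∀ D, IsCompact D → D ⊆ Ω → ∀ᵐ x ∂(volume.restrict D), p x) :
    ∀ᵐ x ∂(volume.restrict Ω), p x := by
  rw [ae_restrict_iff' hΩ.measurableSet, ae_iff]
  refine measure_null_of_locally_null _ fun x hx => ?_
  have hxΩ : x ∈ Ω := by
    by_contra h'
    exact hx fun h'' => absurd h'' h'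
  obtain ⟨r, hr, hrΩ⟩ := Metric.nhds_basis_closedBall.mem_iff.1 (hΩ.mem_nhds hxΩ)
  refine ⟨Metric.closedBall x r ∩ {x | ¬(x ∈ Ω → p x)}, Filter.inter_mem
    (mem_nhdsWithin_of_mem_nhds (Metric.closedBall_mem_nhds x hr)) self_mem_nhdsWithin, ?_⟩
  have := h _ (isCompact_closedBall x r) hrΩ
  rw [ae_restrict_iff' measurableSet_closedBall, ae_iff] at this
  refine measure_mono_null (fun y hy => ?_) this
  intro h'
  exact hy.2 fun _ => h' hy.1

/-- A sequence bounded in `L^q` that converges to zero in measure converges to zero in `L^p`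
for `p < q`. -/
theorem tendsto_eLpNorm_zero_of_measure {X F : Type*} [MeasurableSpace X] {μ : Measure X}
    [IsFiniteMeasure μ] [NormedAddCommGroup F] {f : ℕ → X → F}
    (hf : ∀ j, AEStronglyMeasurable (f j) μ) {p q : ℝ≥0∞} (hp : 1 ≤ p) (hpq : p < q) {B : ℝ≥0}
    (hB : ∀ j, eLpNorm (f j) q μ ≤ B)
    (h : ∀ ε : ℝ≥0, 0 < ε → Tendsto (fun j => μ {x | ε ≤ ‖f j x‖₊}) atTop (𝓝 0)) :
    Tendsto (fun j => eLpNorm (f j) p μ) atTop (𝓝 0) := by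
  have hp0 : 0 < p := zero_lt_one.trans_le hp
  -- The exponent gained by Hölder's inequality on the set where `f j` is large. For `q = ⊤` the
  -- convention `⊤.toReal = 0` makes it 1/p.
  set s : ℝ := 1 / p.toReal - 1 / q.toReal with hs
  have hs0 : 0 < s := by
    have h1 : 0 < p.toReal := ENNReal.toReal_pos hp0.ne' hpq.ne_top
    by_cases hq : q = ⊤
    · simp [hs, hq, h1]
    · have := one_div_lt_one_div_of_lt h1 ((ENNReal.toReal_lt_toReal hpq.ne_top hq).2 hpq)
      exact sub_pos.2 this
  set V := μ Set.univ ^ (p.toReal⁻¹) with hV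
  have hVt : V ≠ ⊤ := ENNReal.rpow_ne_top_of_nonneg (by positivity) (measure_ne_top _ _)
  have key : ∀ (ε : ℝ≥0) j, 0 < ε → eLpNorm (f j) p μ ≤ B * μ {x | ε ≤ ‖f j x‖₊} ^ s + V * ε := by
    intro ε j hε
    -- The superlevel set of an almost everywhere measurable function need not be measurable; this
    -- hull has the same measure.
    let S := toMeasurable μ {x | ε ≤ ‖f j x‖₊}
    have hS : MeasurableSet S := measurableSet_toMeasurable _ _
    have e : f j = S.indicator (f j) + Sᶜ.indicator (f j) := (Set.indicator_self_add_compl S _).symm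
    have h1 : eLpNorm (S.indicator (f j)) p μ ≤ B * μ {x | ε ≤ ‖f j x‖₊} ^ s := by
      rw [eLpNorm_indicator_eq_eLpNorm_restrict hS]
      refine (eLpNorm_le_eLpNorm_mul_rpow_measure_univ hpq.le (hf j).restrict).trans ?_
      rw [Measure.restrict_apply_univ, measure_toMeasurable]
      refine mul_le_mul' (le_trans ?_ (hB j)) le_rfl
      exact eLpNorm_mono_measure _ Measure.restrict_le_self
    have h2 : eLpNorm (Sᶜ.indicator (f j)) p μ ≤ V * ε := by
      have : ∀ᵐ x ∂μ, ‖Sᶜ.indicator (f j) x‖ ≤ (ε : ℝ) := Eventually.of_forall fun x => by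
        by_cases hx : x ∈ S
        · simp [hx]
        · have : ¬ ε ≤ ‖f j x‖₊ := fun h' => hx (subset_toMeasurable μ _ h')
          simp only [Set.indicator, Set.mem_compl_iff, hx, not_false_eq_true, if_true]
          exact_mod_cast (not_le.1 this).le
      refine (eLpNorm_le_of_ae_bound this).trans ?_
      rw [ENNReal.ofReal_coe_nnreal]
    calc eLpNorm (f j) p μ = eLpNorm (S.indicator (f j) + Sᶜ.indicator (f j)) p μ := by rw [← e]
      _ ≤ _ := (eLpNorm_add_le ((hf j).indicator hS) ((hf j).indicator hS.compl) hp).trans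
        (add_le_add h1 h2)
  rw [ENNReal.tendsto_nhds_zero]
  intro a ha
  obtain ⟨ε, hε, hεa⟩ : ∃ ε : ℝ≥0, 0 < ε ∧ V * ε ≤ a / 2 := by
    have : Tendsto (fun ε : ℝ≥0 => V * ε) (𝓝[>] 0) (𝓝 0) := by
      have := ENNReal.Tendsto.const_mul (a := V)
        (ENNReal.tendsto_coe.2 (tendsto_id (x := 𝓝 (0 : ℝ≥0)))) (Or.inr hVt)
      simp only [id, ENNReal.coe_zero, mul_zero] at this
      exact this.mono_left nhdsWithin_le_nhds
    obtain ⟨ε, h1, h2⟩ := ((this.eventually (ge_mem_nhds (ENNReal.half_pos ha.ne'))).and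
      self_mem_nhdsWithin).exists
    exact ⟨ε, h2, h1⟩
  have lim : Tendsto (fun j => (B : ℝ≥0∞) * μ {x | ε ≤ ‖f j x‖₊} ^ s) atTop (𝓝 0) := by
    have := ENNReal.Tendsto.const_mul (a := (B : ℝ≥0∞))
      ((h ε hε).ennrpow_const s) (Or.inr ENNReal.coe_ne_top)
    simpa [ENNReal.zero_rpow_of_pos hs0] using this
  filter_upwards [lim.eventually (ge_mem_nhds (ENNReal.half_pos ha.ne'))] with j hj
  exact (key ε j hε).trans ((add_le_add hj hεa).trans_eq (ENNReal.add_halves a))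

/-- Local `L²` convergence implies convergence in measure on a set of finite measure. -/
theorem tendsto_measure_of_tendsto_eLpNorm_compact (hΩ : IsOpen Ω) (hV : volume Ω < ⊤)
    {F : Type*} [NormedAddCommGroup F] {f : ℕ → E3 → F}
    (hf : ∀ j, AEStronglyMeasurable (f j) (volume.restrict Ω))
    (h : ∀ D, IsCompact D → D ⊆ Ω →
      Tendsto (fun j => eLpNorm (f j) 2 (volume.restrict D)) atTop (𝓝 0)) {ε : ℝ≥0} (hε : 0 < ε) :
    Tendsto (fun j => volume.restrict Ω {x | ε ≤ ‖f j x‖₊}) atTop (𝓝 0) := by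
  rw [ENNReal.tendsto_nhds_zero]
  intro a ha
  obtain ⟨D, hDΩ, hD, hlt⟩ := hΩ.measurableSet.exists_isCompact_sdiff_lt hV.ne
    (ENNReal.half_pos ha.ne').ne'
  have hm : ∀ j, AEStronglyMeasurable (f j) (volume.restrict D) := fun j =>
    (hf j).mono_measure (Measure.restrict_mono hDΩ le_rfl)
  have lim : Tendsto (fun j => volume.restrict D {x | ε ≤ ‖f j x‖₊}) atTop (𝓝 0) := by
    have := tendstoInMeasure_of_tendsto_eLpNorm (g := fun _ => (0 : F)) two_ne_zero hm
      aestronglyMeasurable_const (by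
        refine (h D hD hDΩ).congr fun j => ?_
        congr 1; ext x; simp) (ε : ℝ≥0∞) (by simpa using hε)
    refine this.congr fun j => ?_
    congr 1; ext x
    simp [edist_eq_enorm_sub, enorm_eq_nnnorm]
  filter_upwards [lim.eventually (ge_mem_nhds (ENNReal.half_pos ha.ne'))] with j hj
  calc volume.restrict Ω {x | ε ≤ ‖f j x‖₊}
      ≤ (volume.restrict D + volume.restrict (Ω \ D)) {x | ε ≤ ‖f j x‖₊} := by
        have : Ω = D ∪ (Ω \ D) := (Set.union_sdiff_cancel hDΩ).symm
        conv_lhs => rw [this]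
        exact Measure.restrict_union_le _ _ _
    _ ≤ a / 2 + a / 2 := by
        rw [Measure.add_apply]
        refine add_le_add hj (le_trans ?_ hlt.le)
        exact (measure_mono (Set.subset_univ _)).trans_eq (Measure.restrict_apply_univ _)
    _ = a := ENNReal.add_halves a

/-! ### The limit of fields with small divergence and small `curl n + τ n` -/

section WeakOps

variable {X : Type*} [MeasurableSpace X] {μ : Measure X}
  {E E' : Type*} [NormedAddCommGroup E] [NormedSpace ℝ E] [NormedAddCommGroup E'] [NormedSpace ℝ E']

theorem WeakTendsto.clm {f : ℕ → X → E} {g : X → E} (h : WeakTendsto μ f g) (T : E →L[ℝ] E') :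
    WeakTendsto μ (fun k x => T (f k x)) fun x => T (g x) :=
  fun L w hw => h (L.comp T) w hw

theorem WeakTendsto.congr_limit {f : ℕ → X → E} {g g' : X → E} (h : WeakTendsto μ f g)
    (hg : g =ᵐ[μ] g') : WeakTendsto μ f g' := fun L w hw => by
  rw [← integral_congr_ae (f := fun x => w x * L (g x))]
  · exact h L w hw
  · filter_upwards [hg] with x hx; rw [hx]

theorem WeakTendsto.add {f f' : ℕ → X → E} {g g' : X → E} (h : WeakTendsto μ f g)
    (h' : WeakTendsto μ f' g') (hf : ∀ k, MemLp (f k) 2 μ) (hf' : ∀ k, MemLp (f' k) 2 μ)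
    (hg : MemLp g 2 μ) (hg' : MemLp g' 2 μ) :
    WeakTendsto μ (fun k x => f k x + f' k x) fun x => g x + g' x := fun L w hw => by
  simp only [map_add, mul_add]
  rw [integral_add (MemLp.integrable_mul_clm hw hg L) (MemLp.integrable_mul_clm hw hg' L)]
  refine ((h L w hw).add (h' L w hw)).congr fun k => ?_
  rw [integral_add (MemLp.integrable_mul_clm hw (hf k) L) (MemLp.integrable_mul_clm hw (hf' k) L)]

end WeakOps

theorem MemH1Sphere.eLpNorm_eq {u : E3 → E3} (hu : MemH1Sphere Ω u) (p : ℝ≥0∞) :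
    eLpNorm u p (volume.restrict Ω) = eLpNorm (fun _ : E3 => (1 : ℝ)) p (volume.restrict Ω) :=
  eLpNorm_congr_norm_ae (by filter_upwards [hu.2] with x hx; simp [hx])

/-- The unit constraint bounds the fields in L² and the gradients are bounded by assumption, so both
converge weakly along a subsequence; local compactness makes the convergence of the fields strong on
compact sets. -/
theorem exists_weak_limit (hΩ : IsOpen Ω) (hfc : IsCompact (frontier Ω)) {α : ℝ≥0}
    (hb : HasC2HolderBoundary α Ω) {u : ℕ → E3 → E3} (hu : ∀ j, MemH1Sphere Ω (u j)) {B : ℝ≥0}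
    (hB : ∀ j, eLpNorm (weakGrad Ω (u j)) 2 (volume.restrict Ω) ≤ B) :
    ∃ (n₀ : E3 → E3) (σ : ℕ → ℕ), StrictMono σ ∧ MemH1Sphere Ω n₀ ∧
      WeakTendsto (volume.restrict Ω) (fun j => u (σ j)) n₀ ∧
      WeakTendsto (volume.restrict Ω) (fun j => weakGrad Ω (u (σ j))) (weakGrad Ω n₀) ∧
      ∀ D, IsCompact D → D ⊆ Ω →
        Tendsto (fun j => eLpNorm (u (σ j) - n₀) 2 (volume.restrict D)) atTop (𝓝 0) := by
  have hV := (hu 0).volume_lt_top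
  have : IsFiniteMeasure ((volume : Measure E3).restrict Ω) := ⟨by simpa using hV⟩
  have hB0 : ∀ j, eLpNorm (u j) 2 (volume.restrict Ω) ≤
      ((eLpNorm (u 0) 2 (volume.restrict Ω)).toNNReal : ℝ≥0∞) := fun j => by
    rw [ENNReal.coe_toNNReal (hu 0).1.1.2.ne, (hu j).eLpNorm_eq, (hu 0).eLpNorm_eq]
  obtain ⟨n₀, σ₁, hσ₁, hn₀, w₁⟩ := exists_weakTendsto_subseq (fun j => (hu j).1.1) hB0
  obtain ⟨G₀, σ₂, hσ₂, hG₀, w₂⟩ := exists_weakTendsto_subseq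
    (fun j => (hu (σ₁ j)).1.memLp_weakGrad hΩ) fun j => hB (σ₁ j)
  have w₁' := w₁.comp hσ₂
  have hw : HasWeakGrad Ω n₀ G₀ := HasWeakGrad.of_weakTendsto hV
    (fun j => (hu (σ₁ (σ₂ j))).1.hasWeakGrad) (fun j => (hu _).1.1)
    (fun j => (hu _).1.memLp_weakGrad hΩ) hn₀ hG₀ w₁' w₂
  have hH1 : MemH1 Ω n₀ := ⟨hn₀, G₀, hw, hG₀⟩
  have hloc : ∀ D, IsCompact D → D ⊆ Ω →
      Tendsto (fun j => eLpNorm (u (σ₁ (σ₂ j)) - n₀) 2 (volume.restrict D)) atTop (𝓝 0) :=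
    fun D hD hDΩ => tendsto_eLpNorm_sub_of_weakTendsto hΩ hfc hb (fun j => (hu _).1) hH1
      (fun j => by filter_upwards [(hu (σ₁ (σ₂ j))).2] with x hx using hx.le)
      (fun j => hB _) w₁' hD hDΩ
  refine ⟨n₀, fun j => σ₁ (σ₂ j), hσ₁.comp hσ₂, ⟨hH1, ?_⟩, w₁',
    w₂.congr_limit (hw.weakGrad_ae_eq hΩ).symm, hloc⟩
  -- Weak convergence alone would lose the unit length. On each compact set a further subsequence
  -- converges almost everywhere and keeps it.
  refine ae_restrict_of_forall_isCompact hΩ fun D hD hDΩ => ?_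
  have hle : (volume : Measure E3).restrict D ≤ volume.restrict Ω :=
    Measure.restrict_mono hDΩ le_rfl
  obtain ⟨ρ, hρ, hρt⟩ := (tendstoInMeasure_of_tendsto_eLpNorm two_ne_zero
    (fun j => (hu (σ₁ (σ₂ j))).1.1.1.mono_measure hle) (hn₀.1.mono_measure hle)
    (hloc D hD hDΩ)).exists_seq_tendsto_ae
  have h1 : ∀ᵐ x ∂(volume.restrict D), ∀ j, ‖u (σ₁ (σ₂ (ρ j))) x‖ = 1 :=
    ae_all_iff.2 fun j => ae_restrict_of_ae_restrict_of_subset hDΩ (hu _).2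
  filter_upwards [hρt, h1] with x hx h1x
  refine tendsto_nhds_unique hx.norm ?_
  simp only [h1x]
  exact tendsto_const_nhds

theorem limit_div_curl (hΩ : IsOpen Ω) {u : ℕ → E3 → E3} (hu : ∀ j, MemH1Sphere Ω (u j))
    {n₀ : E3 → E3} (hn₀ : MemH1Sphere Ω n₀) {τ : ℝ}
    (hd : Tendsto (fun j => eLpNorm (fun x => divOf (weakGrad Ω (u j) x)) 2 (volume.restrict Ω))
      atTop (𝓝 0))
    (hc : Tendsto (fun j => eLpNorm (fun x => curlOf (weakGrad Ω (u j) x) + τ • u j x) 2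
      (volume.restrict Ω)) atTop (𝓝 0))
    (w1 : WeakTendsto (volume.restrict Ω) u n₀)
    (w2 : WeakTendsto (volume.restrict Ω) (fun j => weakGrad Ω (u j)) (weakGrad Ω n₀)) :
    (∀ᵐ x ∂(volume.restrict Ω), divOf (weakGrad Ω n₀ x) = 0) ∧
    ∀ᵐ x ∂(volume.restrict Ω), curlOf (weakGrad Ω n₀ x) = -(τ • n₀ x) := by
  have hG₀ := hn₀.1.memLp_weakGrad hΩ
  have hG := fun j => (hu j).1.memLp_weakGrad hΩ
  constructor
  -- The divergence is encoded as a vector field along a fixed unit vector, because the vanishing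
  -- criterion for weak limits is stated for values in ℝ³.
  · let T : (E3 →L[ℝ] E3) →L[ℝ] E3 := divL.smulRight (basisVec 0)
    have hT : ∀ A, T A = divOf A • basisVec 0 := fun A => rfl
    have hb : ‖basisVec 0‖ = 1 := by simp [basisVec]
    have := (w2.clm T).ae_eq_zero (fun j => T.comp_memLp' (hG j)) (T.comp_memLp' hG₀) (by
      refine hd.congr fun j => ?_
      refine eLpNorm_congr_norm_ae (Eventually.of_forall fun x => ?_)
      rw [hT, norm_smul, hb, mul_one])
    filter_upwards [this] with x hx
    have h0 : divOf (weakGrad Ω n₀ x) • basisVec 0 = 0 := hx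
    rcases smul_eq_zero.1 h0 with h' | h'
    · exact h'
    · rw [h', norm_zero] at hb; exact absurd hb zero_ne_one
  · have m1 : ∀ j, MemLp (fun x => τ • u j x) 2 (volume.restrict Ω) := fun j =>
      (hu j).1.1.const_smul τ
    have m2 : MemLp (fun x => τ • n₀ x) 2 (volume.restrict Ω) := hn₀.1.1.const_smul τ
    have a1 := w1.clm (τ • ContinuousLinearMap.id ℝ E3)
    have a2 := (w2.clm curlL).add a1 (fun j => (hu j).memLp_curl hΩ) m1 (hn₀.memLp_curl hΩ) m2
    have := a2.ae_eq_zero (fun j => ((hu j).memLp_curl hΩ).add (m1 j))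
      ((hn₀.memLp_curl hΩ).add m2) hc
    filter_upwards [this] with x hx
    exact eq_neg_of_add_eq_zero_left hx

/-- The error (τ - t_j) u_j has norm |τ - t_j| times the norm of a unit field, the same for all j.
-/
theorem tendsto_curl_add_smul (hΩ : IsOpen Ω) {u : ℕ → E3 → E3} (hu : ∀ j, MemH1Sphere Ω (u j))
    {τ : ℝ} {t : ℕ → ℝ} (ht : Tendsto t atTop (𝓝 τ))
    (hc : Tendsto (fun j => eLpNorm (fun x => curlOf (weakGrad Ω (u j) x) + t j • u j x) 2
      (volume.restrict Ω)) atTop (𝓝 0)) :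
    Tendsto (fun j => eLpNorm (fun x => curlOf (weakGrad Ω (u j) x) + τ • u j x) 2
      (volume.restrict Ω)) atTop (𝓝 0) := by
  have lim : Tendsto (fun j => ENNReal.ofReal |τ - t j| * eLpNorm (u 0) 2 (volume.restrict Ω))
      atTop (𝓝 0) := by
    have h1 : Tendsto (fun j => |τ - t j|) atTop (𝓝 0) := by
      simpa using ((tendsto_const_nhds (x := τ)).sub ht).abs
    have h2 := ENNReal.tendsto_ofReal h1
    rw [ENNReal.ofReal_zero] at h2
    have := ENNReal.Tendsto.mul_const h2 (Or.inr (hu 0).1.1.2.ne)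
    rwa [zero_mul] at this
  have lim2 := hc.add lim
  rw [add_zero] at lim2
  refine tendsto_of_tendsto_of_tendsto_of_le_of_le tendsto_const_nhds lim2 (fun _ => zero_le)
    fun j => ?_
  have m1 : MemLp (fun x => curlOf (weakGrad Ω (u j) x) + t j • u j x) 2 (volume.restrict Ω) :=
    ((hu j).memLp_curl hΩ).add ((hu j).1.1.const_smul (t j))
  have m2 : MemLp ((τ - t j) • u j) 2 (volume.restrict Ω) := (hu j).1.1.const_smul _
  have e : (fun x => curlOf (weakGrad Ω (u j) x) + τ • u j x) =
      (fun x => curlOf (weakGrad Ω (u j) x) + t j • u j x) + (τ - t j) • u j := by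
    ext1 x; simp only [Pi.add_apply, Pi.smul_apply]; module
  rw [e]
  refine (eLpNorm_add_le m1.1 m2.1 (by norm_num)).trans (add_le_add le_rfl ?_)
  rw [eLpNorm_const_smul, (hu j).eLpNorm_eq, ← (hu 0).eLpNorm_eq, ← ofReal_norm,
    Real.norm_eq_abs]

/-- The distance of two unit fields is at most `2`. -/
theorem MemH1Sphere.norm_sub_le_two {u v : E3 → E3} (hu : MemH1Sphere Ω u) (hv : MemH1Sphere Ω v) :
    ∀ᵐ x ∂(volume.restrict Ω), ‖(u - v) x‖ ≤ 2 := by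
  filter_upwards [hu.2, hv.2] with x h1 h2
  rw [Pi.sub_apply]
  refine (norm_sub_le _ _).trans ?_
  rw [h1, h2]; norm_num

theorem tendsto_eLpNorm_sub_of_local (hΩ : IsOpen Ω) {u : ℕ → E3 → E3}
    (hu : ∀ j, MemH1Sphere Ω (u j)) {n₀ : E3 → E3} (hn₀ : MemH1Sphere Ω n₀)
    (hloc : ∀ D, IsCompact D → D ⊆ Ω →
      Tendsto (fun j => eLpNorm (u j - n₀) 2 (volume.restrict D)) atTop (𝓝 0))
    {p : ℝ≥0∞} (hp : 1 ≤ p) (hp' : p < ⊤) :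
    Tendsto (fun j => eLpNorm (u j - n₀) p (volume.restrict Ω)) atTop (𝓝 0) := by
  have hV := hn₀.volume_lt_top
  have : IsFiniteMeasure ((volume : Measure E3).restrict Ω) := ⟨by simpa using hV⟩
  have hm : ∀ j, AEStronglyMeasurable (u j - n₀) (volume.restrict Ω) := fun j =>
    (hu j).1.1.1.sub hn₀.1.1.1
  refine tendsto_eLpNorm_zero_of_measure hm hp hp' (B := 2) (fun j => ?_) fun ε hε =>
    tendsto_measure_of_tendsto_eLpNorm_compact hΩ hV hm hloc hε
  refine (eLpNorm_le_of_ae_bound ((hu j).norm_sub_le_two hn₀)).trans ?_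
  simp

/-- The interior div-curl estimate for u_j - n₀. Its curl is (curl u_j + τu_j) - τ(u_j - n₀), and
both pieces tend to zero. -/
theorem tendsto_eLpNorm_weakGrad_local (hΩ : IsOpen Ω) (hfc : IsCompact (frontier Ω)) {α : ℝ≥0}
    (hb : HasC2HolderBoundary α Ω) {u : ℕ → E3 → E3} (hu : ∀ j, MemH1Sphere Ω (u j))
    {n₀ : E3 → E3} (hn₀ : MemH1Sphere Ω n₀) {τ : ℝ}
    (hd : Tendsto (fun j => eLpNorm (fun x => divOf (weakGrad Ω (u j) x)) 2 (volume.restrict Ω))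
      atTop (𝓝 0))
    (hc : Tendsto (fun j => eLpNorm (fun x => curlOf (weakGrad Ω (u j) x) + τ • u j x) 2
      (volume.restrict Ω)) atTop (𝓝 0))
    (hd₀ : ∀ᵐ x ∂(volume.restrict Ω), divOf (weakGrad Ω n₀ x) = 0)
    (hc₀ : ∀ᵐ x ∂(volume.restrict Ω), curlOf (weakGrad Ω n₀ x) = -(τ • n₀ x))
    (hL2 : Tendsto (fun j => eLpNorm (u j - n₀) 2 (volume.restrict Ω)) atTop (𝓝 0))
    {D : Set E3} (hD : IsCompact D) (hDΩ : D ⊆ Ω) :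
    Tendsto (fun j => eLpNorm (weakGrad Ω (u j) - weakGrad Ω n₀) 2 (volume.restrict D))
      atTop (𝓝 0) := by
  obtain ⟨η, h1, h2, h3, h4⟩ := exists_cutoff hΩ hD hDΩ
  obtain ⟨C, hC⟩ := exists_div_curl_estimate hΩ hfc hb h1 h2 h3
  have key : ∀ j, eLpNorm (weakGrad Ω (u j) - weakGrad Ω n₀) 2 (volume.restrict D) ≤
      C * ((eLpNorm (fun x => curlOf (weakGrad Ω (u j) x) + τ • u j x) 2 (volume.restrict Ω)
        + ‖τ‖ₑ * eLpNorm (u j - n₀) 2 (volume.restrict Ω))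
        + eLpNorm (fun x => divOf (weakGrad Ω (u j) x)) 2 (volume.restrict Ω)
        + eLpNorm (u j - n₀) 2 (volume.restrict Ω)) := by
    intro j
    have hs := weakGrad_sub_ae_eq hΩ (hu j).1 hn₀.1
    have e1 : eLpNorm (weakGrad Ω (u j) - weakGrad Ω n₀) 2 (volume.restrict D) ≤
        eLpNorm (fun x => η x • weakGrad Ω (u j - n₀) x) 2 (volume.restrict Ω) := by
      refine le_trans (le_of_eq ?_) (eLpNorm_mono_measure _ (Measure.restrict_mono hDΩ le_rfl))
      refine eLpNorm_congr_ae ?_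
      filter_upwards [ae_restrict_of_ae_restrict_of_subset hDΩ hs,
        ae_restrict_mem hD.measurableSet] with x hx hxD
      rw [hx, h4 x hxD, one_smul]
    have e2 : eLpNorm (fun x => curlOf (weakGrad Ω (u j - n₀) x)) 2 (volume.restrict Ω) ≤
        eLpNorm (fun x => curlOf (weakGrad Ω (u j) x) + τ • u j x) 2 (volume.restrict Ω)
          + ‖τ‖ₑ * eLpNorm (u j - n₀) 2 (volume.restrict Ω) := by
      have m1 : MemLp (fun x => curlOf (weakGrad Ω (u j) x) + τ • u j x) 2 (volume.restrict Ω) :=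
        ((hu j).memLp_curl hΩ).add ((hu j).1.1.const_smul τ)
      have m2 : MemLp (τ • (u j - n₀)) 2 (volume.restrict Ω) :=
        ((hu j).1.1.sub hn₀.1.1).const_smul τ
      rw [← eLpNorm_const_smul]
      refine le_trans (le_of_eq ?_) (eLpNorm_sub_le m1.1 m2.1 (by norm_num))
      refine eLpNorm_congr_ae ?_
      filter_upwards [hs, hc₀] with x hx hx0
      rw [hx, Pi.sub_apply, ← curlL_apply, map_sub, curlL_apply, curlL_apply, hx0]
      simp only [Pi.sub_apply, Pi.smul_apply]
      module
    have e3 : eLpNorm (fun x => divOf (weakGrad Ω (u j - n₀) x)) 2 (volume.restrict Ω) =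
        eLpNorm (fun x => divOf (weakGrad Ω (u j) x)) 2 (volume.restrict Ω) := by
      refine eLpNorm_congr_ae ?_
      filter_upwards [hs, hd₀] with x hx hx0
      rw [hx, Pi.sub_apply, ← divL_apply, map_sub, divL_apply, divL_apply, hx0, sub_zero]
    refine e1.trans ((hC _ ((hu j).1.sub hΩ hn₀.1)).trans (mul_le_mul' le_rfl ?_))
    rw [e3]
    exact add_le_add (add_le_add e2 le_rfl) le_rfl
  have l1 : Tendsto (fun j => ‖τ‖ₑ * eLpNorm (u j - n₀) 2 (volume.restrict Ω)) atTop (𝓝 0) := by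
    have := ENNReal.Tendsto.const_mul (a := ‖τ‖ₑ) hL2 (Or.inr enorm_ne_top)
    rwa [mul_zero] at this
  have l2 := ENNReal.Tendsto.const_mul (a := (C : ℝ≥0∞)) (((hc.add l1).add hd).add hL2)
    (Or.inr ENNReal.coe_ne_top)
  simp only [add_zero, mul_zero] at l2
  exact tendsto_of_tendsto_of_tendsto_of_le_of_le tendsto_const_nhds l2 (fun _ => zero_le) key

/-- Convergence on compact sets gives convergence in measure on Ω; the L² bound makes every lower
power uniformly integrable, but not the square itself. -/
theorem tendsto_eLpNorm_weakGrad (hΩ : IsOpen Ω) {u : ℕ → E3 → E3}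
    (hu : ∀ j, MemH1Sphere Ω (u j)) {n₀ : E3 → E3} (hn₀ : MemH1Sphere Ω n₀) {B : ℝ≥0}
    (hB : ∀ j, eLpNorm (weakGrad Ω (u j) - weakGrad Ω n₀) 2 (volume.restrict Ω) ≤ B)
    (hloc : ∀ D, IsCompact D → D ⊆ Ω → Tendsto (fun j =>
      eLpNorm (weakGrad Ω (u j) - weakGrad Ω n₀) 2 (volume.restrict D)) atTop (𝓝 0))
    {r : ℝ≥0∞} (hr : 1 ≤ r) (hr' : r < 2) :
    Tendsto (fun j => eLpNorm (weakGrad Ω (u j) - weakGrad Ω n₀) r (volume.restrict Ω))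
      atTop (𝓝 0) := by
  have hV := hn₀.volume_lt_top
  have : IsFiniteMeasure ((volume : Measure E3).restrict Ω) := ⟨by simpa using hV⟩
  have hm : ∀ j, AEStronglyMeasurable (weakGrad Ω (u j) - weakGrad Ω n₀) (volume.restrict Ω) :=
    fun j => ((hu j).1.memLp_weakGrad hΩ).1.sub (hn₀.1.memLp_weakGrad hΩ).1
  exact tendsto_eLpNorm_zero_of_measure hm hr hr' hB fun ε hε =>
    tendsto_measure_of_tendsto_eLpNorm_compact hΩ hV hm hloc hε

theorem tendsto_zero_of_tendsto_sq_zero {ι : Type*} {l : Filter ι} {f : ι → ℝ≥0∞}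
    (h : Tendsto (fun s => f s ^ 2) l (𝓝 0)) : Tendsto f l (𝓝 0) := by
  have h1 := ((ENNReal.continuous_rpow_const (y := 1 / 2)).tendsto 0).comp h
  simp only [Function.comp_def, one_div, ENNReal.zero_rpow_of_pos (inv_pos.2 two_pos)] at h1
  refine h1.congr fun s => ?_
  rw [← ENNReal.rpow_natCast, ← ENNReal.rpow_mul]
  norm_num

/-- The multiplicative inequality gives convergence of traces even in L²(∂Ω); smaller exponents
follow from the finiteness of the surface measure. -/
theorem tendsto_trace (hΩ : IsOpen Ω) (hfc : IsCompact (frontier Ω)) {α : ℝ≥0}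
    (hb : HasC2HolderBoundary α Ω) {u : ℕ → E3 → E3}
    (hu : ∀ j, MemH1Sphere Ω (u j)) {n₀ : E3 → E3} (hn₀ : MemH1Sphere Ω n₀) {B : ℝ≥0}
    (hB : ∀ j, eLpNorm (weakGrad Ω (u j) - weakGrad Ω n₀) 2 (volume.restrict Ω) ≤ B)
    (hL2 : Tendsto (fun j => eLpNorm (u j - n₀) 2 (volume.restrict Ω)) atTop (𝓝 0)) :
    ∃ (t : ℕ → E3 → E3) (t₀ : E3 → E3), (∀ s, HasTrace Ω (u s) (t s)) ∧ HasTrace Ω n₀ t₀ ∧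
      ∀ r : ℝ≥0∞, 1 ≤ r → r < 2 →
        Tendsto (fun s => eLpNorm (t s - t₀) r (surfaceMeasure Ω)) atTop (𝓝 0) := by
  have hV := hn₀.volume_lt_top
  have := isFiniteMeasure_surfaceMeasure hΩ hfc hb hV
  choose t ht using fun j => (hu j).1.exists_hasTrace hΩ hfc hb hV
  obtain ⟨t₀, ht₀⟩ := hn₀.1.exists_hasTrace hΩ hfc hb hV
  obtain ⟨C, hC⟩ := exists_eLpNorm_trace_sub_le (F := E3) hΩ hfc hb
  refine ⟨t, t₀, ht, ht₀, fun r _ hr => ?_⟩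
  have l2 : Tendsto (fun s => eLpNorm (t s - t₀) 2 (surfaceMeasure Ω)) atTop (𝓝 0) := by
    have b1 := ENNReal.Tendsto.mul_const (b := (B : ℝ≥0∞)) hL2 (Or.inr ENNReal.coe_ne_top)
    have b2 := ENNReal.Tendsto.const_mul (a := (C : ℝ≥0∞))
      ((((ENNReal.continuous_pow 2).tendsto 0).comp hL2).add b1) (Or.inr ENNReal.coe_ne_top)
    have b3 : Tendsto (fun s => eLpNorm (t s - t₀) 2 (surfaceMeasure Ω) ^ 2) atTop (𝓝 0) := by
      refine tendsto_of_tendsto_of_tendsto_of_le_of_le tendsto_const_nhds (by simpa using b2)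
        (fun _ => zero_le) fun s => (hC _ _ _ _ (ht s) ht₀).trans ?_
      exact mul_le_mul' le_rfl (add_le_add le_rfl (mul_le_mul' le_rfl (hB s)))
    exact tendsto_zero_of_tendsto_sq_zero b3
  have l3 := ENNReal.Tendsto.mul_const
    (b := surfaceMeasure Ω Set.univ ^ (1 / r.toReal - 1 / (2 : ℝ≥0∞).toReal)) l2 (Or.inr ?_)
  · rw [zero_mul] at l3
    exact tendsto_of_tendsto_of_tendsto_of_le_of_le tendsto_const_nhds l3 (fun _ => zero_le)
      fun s => eLpNorm_le_eLpNorm_mul_rpow_measure_univ hr.le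
        ((ht s).2.1.1.sub ht₀.2.1.1)
  · refine ENNReal.rpow_ne_top_of_nonneg ?_ (measure_ne_top _ _)
    have h1 : 0 < r.toReal := ENNReal.toReal_pos (by positivity) hr.ne_top
    have := one_div_le_one_div_of_le h1 (ENNReal.toReal_mono (by norm_num) hr.le)
    exact sub_nonneg.2 this

/-! ### Asymptotics of the energy of minimizers -/

/-- Division by κ² leaves c₁I + (y - 2c₂)S bounded, with y = e/κ². Once y ≥ 2c₂ both summands are
nonnegative and inherit the bound. -/
theorem energy_balance {κ l e y I S t T V c₁ c₂ : ℝ} (hκ : 0 < κ) (hy : e / κ ^ 2 = y)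
    (h1 : c₁ * κ ^ 2 ≤ l) (h2 : l ≤ c₂ * κ ^ 2) (hc₁ : 0 < c₁) (hyc : 2 * c₂ ≤ y) (hI : 0 ≤ I)
    (hS : 0 ≤ S) (hV : 0 ≤ V) (ht : t ^ 2 ≤ T)
    (h : l * I + (e - 2 * l) * S ≤ (κ ^ 2 / 2 + 2 * l * t ^ 2) * V) :
    c₁ * I ≤ (1 / 2 + 2 * c₂ * T) * V ∧ (y - 2 * c₂) * S ≤ (1 / 2 + 2 * c₂ * T) * V := by
  have hk : 0 < κ ^ 2 := pow_pos hκ 2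
  have he : e = y * κ ^ 2 := by rw [← hy, div_mul_cancel₀ _ hk.ne']
  have a1 := mul_le_mul_of_nonneg_right h1 hI
  have a2 : κ ^ 2 * ((y - 2 * c₂) * S) ≤ (e - 2 * l) * S := by
    have : κ ^ 2 * (y - 2 * c₂) ≤ e - 2 * l := by rw [he]; linarith
    calc κ ^ 2 * ((y - 2 * c₂) * S) = κ ^ 2 * (y - 2 * c₂) * S := by ring
      _ ≤ _ := mul_le_mul_of_nonneg_right this hS
  have a3 : (κ ^ 2 / 2 + 2 * l * t ^ 2) * V ≤ κ ^ 2 * ((1 / 2 + 2 * c₂ * T) * V) := by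
    have : l * t ^ 2 ≤ c₂ * κ ^ 2 * T :=
      mul_le_mul h2 ht (sq_nonneg t) (by nlinarith)
    calc (κ ^ 2 / 2 + 2 * l * t ^ 2) * V ≤ (κ ^ 2 / 2 + 2 * (c₂ * κ ^ 2 * T)) * V :=
          mul_le_mul_of_nonneg_right (by linarith) hV
      _ = _ := by ring
  have b1 : 0 ≤ (y - 2 * c₂) * S := mul_nonneg (by linarith) hS
  have b2 : 0 ≤ c₁ * I := mul_nonneg hc₁.le hI
  constructor
  · refine le_of_mul_le_mul_left ?_ hk
    have := mul_nonneg hk.le b1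
    linarith
  · refine le_of_mul_le_mul_left ?_ hk
    have := mul_nonneg hk.le b2
    linarith

/-- Asymptotics of minimizers: bounded gradients, and convergence to zero of the divergence and of
`curl n + τ n`. -/
theorem minimizers_asymptotics {Ω : Set E3} (hΩ : IsOpen Ω) {e : ℝ → ℝ}
    (he_lim : Tendsto (fun κ => e κ / κ ^ 2) atTop atTop) {P : ℕ → Params}
    (hκ_pos : ∀ j, 0 < (P j).κ) (hκ_lim : Tendsto (fun j => (P j).κ) atTop atTop)
    (hK_lower : ∀ j, e (P j).κ ≤ min (P j).K₁ (min (P j).K₂ (P j).K₃))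
    {τ : ℝ} (hτ_lim : Tendsto (fun j => (P j).τ) atTop (𝓝 τ))
    {c₁ c₂ : ℝ} (hc₁ : 0 < c₁)
    (hK₄ : ∀ j, c₁ * (P j).κ ^ 2 ≤ (P j).K₂ + (P j).K₄ ∧
      (P j).K₂ + (P j).K₄ ≤ c₂ * (P j).κ ^ 2)
    {ψ : ℕ → E3 → ℂ} {n : ℕ → E3 → E3} (hmin : ∀ j, IsMinimizerLdG Ω (P j) (ψ j) (n j)) :
    (∃ B : ℝ≥0, ∀ᶠ j in atTop, eLpNorm (weakGrad Ω (n j)) 2 (volume.restrict Ω) ≤ B) ∧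
    Tendsto (fun j => eLpNorm (fun x => divOf (weakGrad Ω (n j) x)) 2 (volume.restrict Ω))
      atTop (𝓝 0) ∧
    Tendsto (fun j => eLpNorm (fun x => curlOf (weakGrad Ω (n j) x) + (P j).τ • n j x) 2
      (volume.restrict Ω)) atTop (𝓝 0) := by
  have hn : ∀ j, MemH1Sphere Ω (n j) := fun j => (hmin j).2.1
  -- Any number above τ² would do; it eventually bounds the squares of the twists τ_j.
  set T : ℝ := τ ^ 2 + 1
  set K : ℝ := (1 / 2 + 2 * c₂ * T) * volume.real Ω with hK
  let y : ℕ → ℝ := fun j => e (P j).κ / (P j).κ ^ 2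
  have hy : Tendsto y atTop atTop := he_lim.comp hκ_lim
  have hy' : ∀ᶠ j in atTop, 2 * c₂ + 1 ≤ y j := hy.eventually_ge_atTop _
  have hT : ∀ᶠ j in atTop, (P j).τ ^ 2 ≤ T :=
    (hτ_lim.pow 2).eventually (ge_mem_nhds (by simp only [T]; linarith))
  have S0 : ∀ j, 0 ≤ energyOFPlus Ω (P j).τ 1 1 1 (n j) := fun j =>
    energyOFPlus_nonneg zero_le_one zero_le_one zero_le_one _
  have bounds : ∀ᶠ j in atTop, c₁ * (∫ x in Ω, ‖weakGrad Ω (n j) x‖ ^ 2) ≤ K ∧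
      (y j - 2 * c₂) * energyOFPlus Ω (P j).τ 1 1 1 (n j) ≤ K := by
    filter_upwards [hy', hT] with j h1 h2
    have hl : 0 ≤ (P j).K₂ + (P j).K₄ :=
      (mul_nonneg hc₁.le (sq_nonneg _)).trans (hK₄ j).1
    exact energy_balance (hκ_pos j) rfl (hK₄ j).1 (hK₄ j).2 hc₁ (by linarith)
      (integral_nonneg fun x => by positivity) (S0 j) measureReal_nonneg h2
      ((hmin j).energy_bound hΩ hl (hK_lower j))
  have hS : Tendsto (fun j => energyOFPlus Ω (P j).τ 1 1 1 (n j)) atTop (𝓝 0) := by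
    have h1 : Tendsto (fun j => K / (y j - 2 * c₂)) atTop (𝓝 0) :=
      tendsto_const_nhds.div_atTop (tendsto_atTop_add_const_right _ (-(2 * c₂)) hy)
    refine tendsto_of_tendsto_of_tendsto_of_le_of_le' tendsto_const_nhds h1
      (Eventually.of_forall S0) ?_
    filter_upwards [hy', bounds] with j h1 h2
    rw [le_div_iff₀ (by linarith), mul_comm]
    exact h2.2
  have hS' : Tendsto (fun j => ENNReal.ofReal (energyOFPlus Ω (P j).τ 1 1 1 (n j))) atTop
      (𝓝 0) := by
    have := ENNReal.tendsto_ofReal hS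
    rwa [ENNReal.ofReal_zero] at this
  refine ⟨⟨NNReal.sqrt (K / c₁).toNNReal, ?_⟩, ?_, ?_⟩
  · filter_upwards [bounds] with j hj
    rw [← ENNReal.pow_le_pow_left_iff two_ne_zero,
      eLpNorm_two_sq_eq_ofReal ((hn j).1.memLp_weakGrad hΩ), ← ENNReal.coe_pow, NNReal.sq_sqrt]
    refine ENNReal.ofReal_le_ofReal ?_
    rw [le_div_iff₀ hc₁, mul_comm]
    exact hj.1
  · refine tendsto_zero_of_tendsto_sq_zero (tendsto_of_tendsto_of_tendsto_of_le_of_le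
      tendsto_const_nhds hS' (fun _ => zero_le) fun j => ?_)
    exact ((hn j).eLpNorm_div_curl_sq_le hΩ (P j).τ).1
  · refine tendsto_zero_of_tendsto_sq_zero (tendsto_of_tendsto_of_tendsto_of_le_of_le
      tendsto_const_nhds hS' (fun _ => zero_le) fun j => ?_)
    exact ((hn j).eLpNorm_div_curl_sq_le hΩ (P j).τ).2

end LandauDeGennes

end

/-! ### Assembly of the theorem -/

theorem theorem1p0
    -- the domain
    (Ω : Set LandauDeGennes.E3) (hΩ_open : IsOpen Ω) (hΩ_conn : IsConnected Ω)
    (hΩ_compact : IsCompact (frontier Ω))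
    (hΩ_components : Finite (ConnectedComponents (frontier Ω)))
    (α : ℝ≥0) (hα_pos : 0 < α) (hα_lt : α < 1)
    (hΩ_bdry : LandauDeGennes.HasC2HolderBoundary α Ω)
    -- the elastic constants are comparable with `e(κ)`, which dominates `κ²`
    (M : ℝ) (hM : 1 < M)
    (e : ℝ → ℝ) (he_pos : ∀ κ, 0 < κ → 0 < e κ)
    (he_lim : Tendsto (fun κ => e κ / κ ^ 2) atTop atTop)
    (P : ℕ → LandauDeGennes.Params)
    (hκ_pos : ∀ j, 0 < (P j).κ) (hq_pos : ∀ j, 0 < (P j).q) (hτ_pos : ∀ j, 0 < (P j).τ)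
    (hκ_lim : Tendsto (fun j => (P j).κ) atTop atTop)
    (hK_lower : ∀ j, e (P j).κ ≤ min (P j).K₁ (min (P j).K₂ (P j).K₃))
    (hK_upper : ∀ j, max (P j).K₁ (max (P j).K₂ (P j).K₃) ≤ M * e (P j).κ)
    -- the limit chiral twist
    (τ : ℝ) (hτ : 0 < τ) (hτ_lim : Tendsto (fun j => (P j).τ) atTop (𝓝 τ))
    -- the null Lagrangian coefficient
    (c₁ c₂ : ℝ) (hc₁ : 0 < c₁) (hc₂ : c₁ < c₂)
    (hK₄ : ∀ j, c₁ * (P j).κ ^ 2 ≤ (P j).K₂ + (P j).K₄ ∧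
      (P j).K₂ + (P j).K₄ ≤ c₂ * (P j).κ ^ 2)
    -- the minimizers
    (ψ : ℕ → LandauDeGennes.E3 → ℂ) (n : ℕ → LandauDeGennes.E3 → LandauDeGennes.E3)
    (hmin : ∀ j, LandauDeGennes.IsMinimizerLdG Ω (P j) (ψ j) (n j)) :
    ∃ (n₀ : LandauDeGennes.E3 → LandauDeGennes.E3) (σ : ℕ → ℕ),
      StrictMono σ ∧
      -- the limit belongs to `𝒞(τ)` (for all values of the elastic constants)
      (∀ K₁ K₂ K₃ : ℝ, 0 < K₁ → 0 < K₂ → 0 < K₃ →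
        n₀ ∈ LandauDeGennes.minimizersOFPlus Ω τ K₁ K₂ K₃) ∧
      -- and is a rotated helix
      (∃ Q ∈ Matrix.specialOrthogonalGroup (Fin 3) ℝ,
        n₀ =ᵐ[volume.restrict Ω] LandauDeGennes.rotatedHelix τ Q) ∧
      -- convergence in `H¹_loc(Ω)`
      (∀ D : Set LandauDeGennes.E3, IsCompact D → D ⊆ Ω →
        Tendsto (fun s => eLpNorm (n (σ s) - n₀) 2 (volume.restrict D)) atTop (𝓝 0) ∧
        Tendsto (fun s => eLpNorm
          (LandauDeGennes.weakGrad Ω (n (σ s)) - LandauDeGennes.weakGrad Ω n₀) 2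
          (volume.restrict D)) atTop (𝓝 0)) ∧
      -- convergence in `L^p(Ω)`, `1 ≤ p < ∞`
      (∀ p : ℝ≥0∞, 1 ≤ p → p < ⊤ →
        Tendsto (fun s => eLpNorm (n (σ s) - n₀) p (volume.restrict Ω)) atTop (𝓝 0)) ∧
      -- convergence in `W^{1,r}(Ω)`, `1 ≤ r < 2`
      (∀ r : ℝ≥0∞, 1 ≤ r → r < 2 →
        Tendsto (fun s => eLpNorm (n (σ s) - n₀) r (volume.restrict Ω)) atTop (𝓝 0) ∧
        Tendsto (fun s => eLpNorm
          (LandauDeGennes.weakGrad Ω (n (σ s)) - LandauDeGennes.weakGrad Ω n₀) r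
          (volume.restrict Ω)) atTop (𝓝 0)) ∧
      -- convergence of the boundary traces in `L^r(∂Ω)`, `1 ≤ r < 2`
      (∃ (t : ℕ → LandauDeGennes.E3 → LandauDeGennes.E3)
          (t₀ : LandauDeGennes.E3 → LandauDeGennes.E3),
        (∀ s, LandauDeGennes.HasTrace Ω (n (σ s)) (t s)) ∧ LandauDeGennes.HasTrace Ω n₀ t₀ ∧
        ∀ r : ℝ≥0∞, 1 ≤ r → r < 2 →
          Tendsto (fun s => eLpNorm (t s - t₀) r (LandauDeGennes.surfaceMeasure Ω))
            atTop (𝓝 0)) := by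
  open LandauDeGennes in
  obtain ⟨⟨B, hB⟩, hd, hc⟩ := minimizers_asymptotics hΩ_open he_lim hκ_pos hκ_lim hK_lower hτ_lim
    hc₁ hK₄ hmin
  -- The gradient bound holds only from an index N on, so the sequence is shifted by N and the final
  -- subsequence is s ↦ σ s + N.
  obtain ⟨N, hN⟩ := eventually_atTop.1 hB
  have hn : ∀ j, MemH1Sphere Ω (n (j + N)) := fun j => (hmin (j + N)).2.1
  have shift := tendsto_add_atTop_nat N
  obtain ⟨n₀, σ, hσ, hn₀, w1, w2, hloc⟩ := exists_weak_limit hΩ_open hΩ_compact hΩ_bdry hn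
    fun j => hN _ (Nat.le_add_left N j)
  have hσt := hσ.tendsto_atTop
  have hu : ∀ s, MemH1Sphere Ω (n (σ s + N)) := fun s => hn (σ s)
  have hd' := (hd.comp shift).comp hσt
  have hc' := ((tendsto_curl_add_smul hΩ_open hn (hτ_lim.comp shift) (hc.comp shift))).comp hσt
  obtain ⟨hd₀, hc₀⟩ := limit_div_curl hΩ_open hu hn₀ hd' hc' w1 w2
  have hLp : ∀ p : ℝ≥0∞, 1 ≤ p → p < ⊤ →
      Tendsto (fun s => eLpNorm (n (σ s + N) - n₀) p (volume.restrict Ω)) atTop (𝓝 0) :=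
    fun p hp hp' => tendsto_eLpNorm_sub_of_local hΩ_open hu hn₀ hloc hp hp'
  have hL2 := hLp 2 (by norm_num) (by norm_num)
  have hgrad : ∀ D : Set E3, IsCompact D → D ⊆ Ω → Tendsto (fun s =>
      eLpNorm (weakGrad Ω (n (σ s + N)) - weakGrad Ω n₀) 2 (volume.restrict D)) atTop (𝓝 0) :=
    fun D hD hDΩ => tendsto_eLpNorm_weakGrad_local hΩ_open hΩ_compact hΩ_bdry hu hn₀ hd' hc' hd₀
      hc₀ hL2 hD hDΩ
  have hG₀ := hn₀.1.memLp_weakGrad hΩ_open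
  have hBd : ∀ s, eLpNorm (weakGrad Ω (n (σ s + N)) - weakGrad Ω n₀) 2 (volume.restrict Ω) ≤
      ((B + (eLpNorm (weakGrad Ω n₀) 2 (volume.restrict Ω)).toNNReal : ℝ≥0) : ℝ≥0∞) := fun s => by
    rw [ENNReal.coe_add, ENNReal.coe_toNNReal hG₀.2.ne]
    exact (eLpNorm_sub_le ((hu s).1.memLp_weakGrad hΩ_open).1 hG₀.1 (by norm_num)).trans
      (add_le_add (hN _ (Nat.le_add_left N _)) le_rfl)
  obtain ⟨f, hf, hf'⟩ := exists_smooth_representative hΩ_open hn₀.1.hasWeakGrad hn₀.1.1 hG₀ hd₀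
    hc₀ hn₀.2
  obtain ⟨Q, hQ, hfQ⟩ := eq_rotatedHelix hΩ_open hΩ_conn hτ hf'
  refine ⟨n₀, fun s => σ s + N, fun a b h => Nat.add_lt_add_right (hσ h) N,
    fun K₁ K₂ K₃ h1 h2 h3 => ⟨hn₀, fun u _ => ?_⟩, ⟨Q, hQ, ?_⟩,
    fun D hD hDΩ => ⟨hloc D hD hDΩ, hgrad D hD hDΩ⟩, hLp,
    fun r hr hr' => ⟨hLp r hr hr'.lt_top, ?_⟩,
    tendsto_trace hΩ_open hΩ_compact hΩ_bdry hu hn₀ hBd hL2⟩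
  -- The limit has energy zero and the functional is nonnegative, so minimality holds whatever the
  -- positive constants are.
  · rw [energyOFPlus_eq_zero hn₀.2 hd₀ hc₀]
    exact energyOFPlus_nonneg h1.le h2.le h3.le u
  · filter_upwards [hf, ae_restrict_mem hΩ_open.measurableSet] with x hx hxΩ
    rw [hx, hfQ x hxΩ]
  · exact tendsto_eLpNorm_weakGrad hΩ_open hu hn₀ hBd hgrad hr hr'
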